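/- Let $c>0$, $k>0$ and $s=\operatorname{sgn}(k)=1$. Consider the system $$U''-cU+\tfrac12U^2+sA^2=0,\qquad A''+(\Omega+kU)A=0 \qquad\text{on }\mathbb{R},$$ whose uncoupled solution is $(U_0,0)$ with $U_0(\xi)=3c\,\mathrm{sech}^2\!\big(\tfrac{\sqrt c}{2}\xi\big)$, and set $$\Omega_c=-\tfrac{c}{16}\big(\sqrt{1+48k}-1\big)^2,\qquad g(\xi)=\mathrm{sech}^{p}\!\big(\tfrac{\sqrt c}{2}\xi\big),\quad p=\tfrac{\sqrt{1+48k}-1}{2}.$$ Let $L_1^{-1}g^2$ denote the unique even $\eta\in H^2(\mathbb{R})$ with $-\eta''+c\eta-U_0\eta=g^2$, and let $\langle\cdot,\cdot\rangle$ be the inner product of $L^2(\mathbb{R})$. For a solution $(U,A)\in H^2(\mathbb{R})\times H^2(\mathbb{R})$ of the system, let $\mathcal{L}:(H^2(\mathbb{R}))^3\subset(L^2(\mathbb{R}))^3\to(L^2(\mathbb{R}))^3$ be the Hessian operator $$\mathcal{L}=-\begin{pmatrix}\partial_\xi^2+U-c&2sA&0\\2sA&\frac{2s}{k}(\partial_\xi^2+kU+\Omega)&0\\0&0&\frac{2s}{k}(\partial_\xi^2+kU+\Omega)\end{pmatrix}.$$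 Its Morse index is the number of its negative eigenvalues counted with multiplicity, and its nullity index is the dimension of its kernel. There is $\varepsilon>0$, depending only on $c$ and $k$, such that the following holds for every profile of the first bifurcating branch in the $\varepsilon$-neighbourhood of the bifurcation point $(U_0,0,\Omega_c)$, that is, for every $\Omega\in\mathbb{R}$ and every solution $(U,A)$ of the system with $U,A\in H^2(\mathbb{R})$ even, $A\neq0$, $|\Omega-\Omega_c|<\varepsilon$, $\|U-U_0\|_{H^2}<\varepsilon$ and $\|A\|_{H^2}<\varepsilon$: (i) if $\langle g^2,L_1^{-1}g^2\rangle<0$, then $\mathcal{L}$ has Morse index $1$ and nullity index $2$; (ii) if $\langle g^2,L_1^{-1}g^2\rangle>0$, then $\mathcal{L}$ has Morse index $2$ and nullity index $2$. -/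

import Mathlib

open MeasureTheory
open scoped ContDiff

noncomputable section

namespace KdVLS

/-- Classes of real measurable functions on the line modulo almost everywhere equality. -/
abbrev L0 : Type := ℝ →ₘ[volume] ℝ

/-- The real Lebesgue space `L²(ℝ)`. -/
abbrev L2 : Type := Lp ℝ 2 (volume : Measure ℝ)

/-- `g` is the weak derivative of `f`. -/
def IsWeakDeriv (f g : L2) : Prop :=
  ∀ φ : ℝ → ℝ, ContDiff ℝ ∞ φ → HasCompactSupport φ →
    ∫ x, deriv φ x * f x = -∫ x, φ x * g x

theorem integrable_test_mul {φ : ℝ → ℝ} (hφ : Continuous φ) (hc : HasCompactSupport φ)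
    (f : L2) : Integrable (fun x => φ x * f x) :=
  (hφ.memLp_of_hasCompactSupport (p := 2) hc).integrable_mul (Lp.memLp f)

theorem IsWeakDeriv.unique {f g h : L2} (hg : IsWeakDeriv f g) (hh : IsWeakDeriv f h) :
    g = h := by
  apply Lp.ext
  refine ae_eq_of_integral_contDiff_smul_eq
    ((Lp.memLp g).locallyIntegrable (by norm_num))
    ((Lp.memLp h).locallyIntegrable (by norm_num)) ?_
  intro φ hφ hc
  have h1 := hg φ hφ hc
  have h2 := hh φ hφ hc
  simp only [smul_eq_mul]
  linarith

theorem IsWeakDeriv.add {f g f' g' : L2} (hf : IsWeakDeriv f f') (hg : IsWeakDeriv g g') :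
    IsWeakDeriv (f + g) (f' + g') := by
  intro φ hφ hc
  have hφ' : Continuous (deriv φ) := hφ.continuous_deriv (by simp)
  have e1 : ∫ x, deriv φ x * (f + g : L2) x
      = ∫ x, (deriv φ x * f x + deriv φ x * g x) := by
    apply integral_congr_ae
    filter_upwards [Lp.coeFn_add f g] with x hx
    rw [hx, Pi.add_apply, mul_add]
  have e2 : ∫ x, φ x * (f' + g' : L2) x = ∫ x, (φ x * f' x + φ x * g' x) := by
    apply integral_congr_ae
    filter_upwards [Lp.coeFn_add f' g'] with x hx
    rw [hx, Pi.add_apply, mul_add]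
  rw [e1, e2, integral_add (integrable_test_mul hφ' hc.deriv f)
    (integrable_test_mul hφ' hc.deriv g),
    integral_add (integrable_test_mul hφ.continuous hc f')
    (integrable_test_mul hφ.continuous hc g'), hf φ hφ hc, hg φ hφ hc]
  ring

theorem IsWeakDeriv.smul {f f' : L2} (a : ℝ) (hf : IsWeakDeriv f f') :
    IsWeakDeriv (a • f) (a • f') := by
  intro φ hφ hc
  have e1 : ∫ x, deriv φ x * (a • f : L2) x = ∫ x, a * (deriv φ x * f x) := by
    apply integral_congr_ae
    filter_upwards [Lp.coeFn_smul a f] with x hx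
    rw [hx, Pi.smul_apply, smul_eq_mul]
    ring
  have e2 : ∫ x, φ x * (a • f' : L2) x = ∫ x, a * (φ x * f' x) := by
    apply integral_congr_ae
    filter_upwards [Lp.coeFn_smul a f'] with x hx
    rw [hx, Pi.smul_apply, smul_eq_mul]
    ring
  rw [e1, e2, integral_const_mul, integral_const_mul, hf φ hφ hc]
  ring

theorem IsWeakDeriv.zero : IsWeakDeriv 0 0 := by
  intro φ hφ hc
  have e : ∀ ψ : ℝ → ℝ, ∫ x, ψ x * (0 : L2) x = 0 := by
    intro ψ
    rw [← integral_zero ℝ ℝ (μ := (volume : Measure ℝ))]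
    apply integral_congr_ae
    filter_upwards [Lp.coeFn_zero ℝ 2 (volume : Measure ℝ)] with x hx
    rw [hx, Pi.zero_apply, mul_zero]
  rw [e, e, neg_zero]

/-- The real Sobolev space `H²(ℝ)`. -/
def H2 : Submodule ℝ L2 where
  carrier := {f | ∃ f' f'' : L2, IsWeakDeriv f f' ∧ IsWeakDeriv f' f''}
  zero_mem' := ⟨0, 0, IsWeakDeriv.zero, IsWeakDeriv.zero⟩
  add_mem' := by
    rintro f g ⟨f', f'', h1, h2⟩ ⟨g', g'', h3, h4⟩
    exact ⟨f' + g', f'' + g'', h1.add h3, h2.add h4⟩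
  smul_mem' := by
    rintro a f ⟨f', f'', h1, h2⟩
    exact ⟨a • f', a • f'', h1.smul a, h2.smul a⟩

/-- The first weak derivative of an `H²` function. -/
def D1fun (f : H2) : L2 := f.2.choose

/-- The second weak derivative of an `H²` function. -/
def D2fun (f : H2) : L2 := f.2.choose_spec.choose

theorem isWeakDeriv_D1fun (f : H2) : IsWeakDeriv f (D1fun f) := f.2.choose_spec.choose_spec.1

theorem isWeakDeriv_D2fun (f : H2) : IsWeakDeriv (D1fun f) (D2fun f) :=
  f.2.choose_spec.choose_spec.2

/-- The operator `∂ : H²(ℝ) → L²(ℝ)`. -/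
def D1 : H2 →ₗ[ℝ] L2 where
  toFun := D1fun
  map_add' f g := (isWeakDeriv_D1fun (f + g)).unique
    ((isWeakDeriv_D1fun f).add (isWeakDeriv_D1fun g))
  map_smul' a f := (isWeakDeriv_D1fun (a • f)).unique ((isWeakDeriv_D1fun f).smul a)

/-- The operator `∂² : H²(ℝ) → L²(ℝ)`. -/
def D2 : H2 →ₗ[ℝ] L2 where
  toFun := D2fun
  map_add' f g := by
    have h := isWeakDeriv_D2fun (f + g)
    rw [show D1fun (f + g) = D1fun f + D1fun g from D1.map_add f g] at h
    exact h.unique ((isWeakDeriv_D2fun f).add (isWeakDeriv_D2fun g))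
  map_smul' a f := by
    have h := isWeakDeriv_D2fun (a • f)
    rw [show D1fun (a • f) = a • D1fun f from D1.map_smul a f] at h
    exact h.unique ((isWeakDeriv_D2fun f).smul a)

/-- The norm of `H²(ℝ)`. -/
def h2Norm (f : H2) : ℝ := √(‖(f : L2)‖ ^ 2 + ‖D1 f‖ ^ 2 + ‖D2 f‖ ^ 2)

/-- Even functions, up to null sets. -/
def IsEven (f : H2) : Prop := ∀ᵐ x : ℝ, (f : L2) (-x) = (f : L2) x

/-- The inclusion of `H²(ℝ)` into classes of measurable functions. -/
def incl : H2 →ₗ[ℝ] L0 where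
  toFun f := ((f : L2) : L0)
  map_add' _ _ := rfl
  map_smul' _ _ := rfl

/-- The class of a continuous function. -/
def ofCont (V : ℝ → ℝ) (hV : Continuous V) : L0 := AEEqFun.mk V hV.aestronglyMeasurable

/-- Pointwise multiplication by `V`, as a map on `H²(ℝ)`. -/
def mulBy (V : L0) : H2 →ₗ[ℝ] L0 where
  toFun f := V * incl f
  map_add' f g := by
    rw [map_add]
    apply AEEqFun.ext
    filter_upwards [AEEqFun.coeFn_mul V (incl f + incl g), AEEqFun.coeFn_add (incl f) (incl g),
      AEEqFun.coeFn_add (V * incl f) (V * incl g), AEEqFun.coeFn_mul V (incl f),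
      AEEqFun.coeFn_mul V (incl g)] with x h1 h2 h3 h4 h5
    simp only [h1, h2, h3, h4, h5, Pi.mul_apply, Pi.add_apply, mul_add]
  map_smul' a f := by
    rw [map_smul, RingHom.id_apply]
    apply AEEqFun.ext
    filter_upwards [AEEqFun.coeFn_mul V (a • incl f), AEEqFun.coeFn_smul a (incl f),
      AEEqFun.coeFn_smul a (V * incl f), AEEqFun.coeFn_mul V (incl f)] with x h1 h2 h3 h4
    simp only [h1, h2, h3, h4, Pi.mul_apply, Pi.smul_apply, smul_eq_mul]
    ring

/-- The Schrödinger operator `-∂² + V` with domain `H²(ℝ)`. Its values are recorded as classes of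
measurable functions; they lie in `L²(ℝ)` whenever `V` is bounded, as it is for all the potentials
used below, since `H²(ℝ) ⊆ L^∞(ℝ)`. -/
def schrodinger (V : L0) : H2 →ₗ[ℝ] L0 where
  toFun f := -((D2 f : L2) : L0) + mulBy V f
  map_add' f g := by
    rw [map_add, map_add]
    change -(((D2 f : L2) : L0) + ((D2 g : L2) : L0)) + _ = _
    abel
  map_smul' a f := by
    rw [map_smul, map_smul, RingHom.id_apply]
    change -(a • ((D2 f : L2) : L0)) + _ = _
    rw [smul_add, smul_neg]

/-- `L₁ = -∂² + c - U`. -/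
def opL1 (c : ℝ) (U : L0) : H2 →ₗ[ℝ] L0 := schrodinger (c • (1 : L0) - U)

/-- `L₂ = (2s/k) (-∂² - Ω - kU)`. -/
def opL2 (s k Ω : ℝ) (U : L0) : H2 →ₗ[ℝ] L0 :=
  (2 * s / k) • schrodinger (-(Ω • (1 : L0)) - k • U)

/-- `(H²(ℝ))³`, with coordinates `(w, z₁, z₂)`. -/
abbrev H2x3 : Type := H2 × H2 × H2

/-- The Hessian operator with domain `(H²(ℝ))³` at the profile `(U, A)`:
`(w, z₁, z₂) ↦ (L₁ w - 2sA z₁, -2sA w + L₂ z₁, L₂ z₂)`. -/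
def hessian (s k c Ω : ℝ) (U A : H2) : H2x3 →ₗ[ℝ] L0 × L0 × L0 :=
  let w : H2x3 →ₗ[ℝ] H2 := LinearMap.fst ℝ H2 (H2 × H2)
  let z₁ : H2x3 →ₗ[ℝ] H2 := LinearMap.fst ℝ H2 H2 ∘ₗ LinearMap.snd ℝ H2 (H2 × H2)
  let z₂ : H2x3 →ₗ[ℝ] H2 := LinearMap.snd ℝ H2 H2 ∘ₗ LinearMap.snd ℝ H2 (H2 × H2)
  (opL1 c (incl U) ∘ₗ w - (2 * s) • (mulBy (incl A) ∘ₗ z₁)).prod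
    ((-((2 * s) • (mulBy (incl A) ∘ₗ w)) + opL2 s k Ω (incl U) ∘ₗ z₁).prod
      (opL2 s k Ω (incl U) ∘ₗ z₂))

/-- The eigenspace `{v ∈ (H²(ℝ))³ : T v = lam v}` of an operator with domain `(H²(ℝ))³`. -/
def eigenspace (T : H2x3 →ₗ[ℝ] L0 × L0 × L0) (lam : ℝ) : Submodule ℝ H2x3 :=
  LinearMap.eqLocus T (lam • incl.prodMap (incl.prodMap incl))

/-- The Morse index: the number of negative eigenvalues counted with multiplicity, i.e. the
dimension of the (direct) sum of the eigenspaces of all negative eigenvalues. -/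
def morseIndex (T : H2x3 →ₗ[ℝ] L0 × L0 × L0) : Cardinal :=
  Module.rank ℝ ↥(⨆ lam : Set.Iio (0 : ℝ), eigenspace T lam)

/-- The nullity index: the multiplicity of the zero eigenvalue. -/
def nullityIndex (T : H2x3 →ₗ[ℝ] L0 × L0 × L0) : Cardinal :=
  Module.rank ℝ ↥(eigenspace T 0)

/-- The KdV soliton `U₀(ξ) = 3c sech²(√c ξ / 2)`. -/
def soliton (c ξ : ℝ) : ℝ := 3 * c / Real.cosh (√c / 2 * ξ) ^ 2

/-- The exponent `p = (√(1 + 48k) - 1) / 2`. -/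
def gExponent (k : ℝ) : ℝ := (√(1 + 48 * k) - 1) / 2

/-- The function `g(ξ) = sech^p(√c ξ / 2)`. -/
def gFun (c k ξ : ℝ) : ℝ := (1 / Real.cosh (√c / 2 * ξ)) ^ gExponent k

/-- The first bifurcation value `Ω_c`. -/
def OmegaC (c k : ℝ) : ℝ := -(c / 16) * (√(1 + 48 * k) - 1) ^ 2

theorem continuous_soliton (c : ℝ) : Continuous (soliton c) := by
  unfold soliton
  exact continuous_const.div (by fun_prop) (fun x => pow_ne_zero 2 (Real.cosh_pos _).ne')

theorem continuous_gFun (c k : ℝ) : Continuous (gFun c k) := by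
  unfold gFun
  refine Continuous.rpow_const ?_ (fun x => Or.inl (one_div_pos.2 (Real.cosh_pos _)).ne')
  exact continuous_const.div (by fun_prop) (fun x => (Real.cosh_pos _).ne')

/-- The soliton `U₀` as a class of functions. -/
def U0 (c : ℝ) : L0 := ofCont (soliton c) (continuous_soliton c)

/-- The function `g²` as a class of functions. -/
def gSq (c k : ℝ) : L0 := ofCont (fun ξ => gFun c k ξ ^ 2) ((continuous_gFun c k).pow 2)

open Classical in
/-- The inverse of `L₁ = -∂² + c - U₀` on even functions: the even `η ∈ H²(ℝ)` with `L₁ η = f`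
(there is at most one, as `ker L₁` is spanned by the odd function `U₀'`), and `0` if there is
none. -/
def L1Inv (c : ℝ) (f : L0) : H2 :=
  if h : ∃ η : H2, IsEven η ∧ opL1 c (U0 c) η = f then h.choose else 0

/-- The number `⟨g², L₁⁻¹ g²⟩`. -/
def pairing (c k : ℝ) : ℝ := ∫ ξ, gFun c k ξ ^ 2 * (L1Inv c (gSq c k) : L2) ξ

/-- `(U, A)` solves `U'' - cU + U²/2 + sA² = 0` and `A'' + (Ω + kU)A = 0`. -/
def IsProfile (s k c Ω : ℝ) (U A : H2) : Prop :=
  ((D2 U : L2) : L0) - c • incl U + (1 / 2 : ℝ) • incl U ^ 2 + s • incl A ^ 2 = 0 ∧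
  ((D2 A : L2) : L0) + (Ω • (1 : L0) + k • incl U) * incl A = 0

/-- `(U, A)` is a profile of the branch bifurcating from `(U₀, 0)` at `Ω = Ω_c`, within distance
`ε` of the bifurcation point: an even solution with `A ≠ 0` (the solutions with `A = 0` form the
primary branch) such that `Ω - Ω_c`, `U - U₀` and `A` are smaller than `ε`. -/
structure IsBranchProfile (s k c ε Ω : ℝ) (U A : H2) : Prop where
  profile : IsProfile s k c Ω U A
  even_U : IsEven U
  even_A : IsEven A
  ne_zero : A ≠ 0
  near_Omega : |Ω - OmegaC c k| < ε
  near_U : ∃ w : H2, incl w = incl U - U0 c ∧ h2Norm w < ε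
  near_A : h2Norm A < ε

end KdVLS

end

/-!
The Hessian at a branch profile is compared with the Hessian at the bifurcation point, and its
negative eigenvalues and kernel are counted through its quadratic form `Q`.

*The limiting form.* Put `a = √c / 2` and let `p` be the exponent of `g`, so that
`p (p + 1) = 12 k`. At the bifurcation point the Hessian is diagonal, with blocks
`-∂² + 4 a² - 12 a² sech²(a ξ)` and, twice, `(2 / k) (-∂² + p² a² - p (p + 1) a² sech²(a ξ))`.
These Pöschl–Teller operators factor through `∂ + q a tanh(a ξ)` (`norm_ladder_sq`); a duality
argument with the adjoint factor gives spectral gaps above the eigenfunctions `sech³`, `sech² tanh`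
of the first operator and above the ground state `g = sech^p` of the second (`exists_gap`,
`exists_gap_three`). Hence the limiting form is positive definite on a subspace of codimension
four (`exists_limitForm_gap`), it is negative at `(sech³, 0, 0)`, and both facts persist for `Q`.

*The critical direction.* On the branch `A = t g + O(ε t)` with `t ≠ 0` (`exists_amplitude`). With
`η = L₁⁻¹ g²`, the direction `e = (2 t² η, A, 0)` satisfies `Q(e) = -4 t⁴ ⟨g², η⟩ + O(ε t⁴)`, and it
is coupled to every other direction `v` only by `O(ε t² ‖v‖)` (`exists_critical_direction`). So `Q`
is positive on a subspace of codimension three if `⟨g², η⟩ < 0`, while it is negative definite on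
the plane spanned by `e` and `(sech³, 0, 0)` if `⟨g², η⟩ > 0`.

*Counting.* Positivity in codimension `m` bounds the Morse index plus the nullity index by `m`
(`rank_iSup_eig_add_rank_ker_le`). Conversely, a subspace of dimension `n` on which `Q` is negative
gives `n` negative eigenvalues (`le_rank_iSup_eig`): they are found as maxima of the Rayleigh
quotient of the bounded resolvent, which exists since the Hessian is a bounded symmetric
perturbation of `-∂²`. The kernel contains `(U', A', 0)` and `(0, 0, A)`, from translations and
phase rotations, so the nullity index is at least two (`two_le_rank_ker`). For `⟨g², η⟩ < 0` this
gives `1 + 2 ≤ 3`, and for `⟨g², η⟩ > 0` it gives `2 + 2 ≤ 4`, with equality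
throughout.
-/

noncomputable section

open Filter Topology Set
open scoped BoundedContinuousFunction

namespace KdVLS

/-! ### One-dimensional Sobolev functions -/

/-- A smooth compactly supported function of integral zero has a compactly supported primitive. -/
theorem exists_primitive_of_integral_eq_zero {χ : ℝ → ℝ} (hχ : ContDiff ℝ ∞ χ)
    (hc : HasCompactSupport χ) (h0 : ∫ x, χ x = 0) :
    ∃ θ : ℝ → ℝ, ContDiff ℝ ∞ θ ∧ HasCompactSupport θ ∧ deriv θ = χ := by
  obtain ⟨R, hR⟩ := hc.isBounded.subset_closedBall (0 : ℝ)
  rw [Real.closedBall_eq_Icc, zero_sub, zero_add] at hR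
  have hzero : ∀ x, x ∉ Icc (-R) R → χ x = 0 := fun x hx =>
    image_eq_zero_of_notMem_tsupport (fun h => hx (hR h))
  have hint : Integrable χ := hχ.continuous.integrable_of_hasCompactSupport hc
  have hd : ∀ x, HasDerivAt (fun y => ∫ t in Iic y, χ t) (χ x) x := by
    intro x
    have h1 : (fun y => ∫ t in Iic y, χ t)
        = fun y => (∫ t in Iic 0, χ t) + ∫ t in (0 : ℝ)..y, χ t := by
      funext y
      rw [intervalIntegral.integral_Iic_sub_Iic (a := 0) (b := y) hint.integrableOn
        hint.integrableOn |>.symm]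
      ring
    rw [h1]
    exact (intervalIntegral.integral_hasDerivAt_right (hint.intervalIntegrable)
      (hχ.continuous.stronglyMeasurableAtFilter _ _) hχ.continuous.continuousAt).const_add _
  have hderiv : deriv (fun y => ∫ t in Iic y, χ t) = χ := funext fun x => (hd x).deriv
  refine ⟨_, ?_, ?_, hderiv⟩
  · rw [contDiff_infty_iff_deriv, hderiv]
    exact ⟨fun x => (hd x).differentiableAt, hχ⟩
  · refine HasCompactSupport.intro (isCompact_Icc (a := -R) (b := R)) fun x hx => ?_
    rcases not_and_or.1 hx with h | h
    · refine setIntegral_eq_zero_of_forall_eq_zero fun t ht => hzero t fun h2 => ?_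
      exact h (h2.1.trans ht)
    · rw [← h0]
      refine setIntegral_eq_integral_of_forall_compl_eq_zero fun t ht => hzero t fun h2 => ?_
      simp only [mem_Iic, not_le] at ht h
      linarith [h2.2]

/-- A distribution on the line with vanishing derivative is constant. -/
theorem ae_eq_const_of_integral_deriv_mul_eq_zero {f : ℝ → ℝ} (hf : LocallyIntegrable f)
    (h : ∀ φ : ℝ → ℝ, ContDiff ℝ ∞ φ → HasCompactSupport φ → ∫ x, deriv φ x * f x = 0) :
    ∃ C : ℝ, ∀ᵐ x, f x = C := by
  let b : ContDiffBump (0 : ℝ) := ⟨1, 2, by norm_num, by norm_num⟩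
  let ψ : ℝ → ℝ := b.normed volume
  have hψ : ContDiff ℝ ∞ ψ := b.contDiff_normed
  have hψc : HasCompactSupport ψ := b.hasCompactSupport_normed
  have hψ1 : ∫ x, ψ x = 1 := b.integral_normed
  have hint : ∀ φ : ℝ → ℝ, Continuous φ → HasCompactSupport φ →
      Integrable (fun x => φ x * f x) := fun φ h1 h2 =>
    hf.integrable_smul_left_of_hasCompactSupport h1 h2
  refine ⟨∫ x, ψ x * f x, ?_⟩
  refine ae_eq_of_integral_contDiff_smul_eq hf (locallyIntegrable_const _) ?_
  intro φ hφ hφc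
  have hφi : Integrable φ := hφ.continuous.integrable_of_hasCompactSupport hφc
  have hψi : Integrable ψ := hψ.continuous.integrable_of_hasCompactSupport hψc
  obtain ⟨θ, hθ, hθc, hθd⟩ := exists_primitive_of_integral_eq_zero
    (χ := fun x => φ x - (∫ y, φ y) * ψ x) (hφ.sub (contDiff_const.mul hψ))
    (hφc.sub (hψc.mul_left)) (by
      rw [integral_sub hφi (hψi.const_mul _), integral_const_mul, hψ1]; ring)
  have := h θ hθ hθc
  simp only [hθd, sub_mul, mul_assoc] at this
  rw [integral_sub (hint φ hφ.continuous hφc) ((hint ψ hψ.continuous hψc).const_mul _),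
    integral_const_mul] at this
  simp only [smul_eq_mul]
  rw [integral_mul_const]
  linarith

/-- The product rule for primitives of locally integrable functions. -/
theorem integral_mul_primitive {f g : ℝ → ℝ} (hf : LocallyIntegrable f)
    (hg : LocallyIntegrable g) (C D a b : ℝ) :
    ∫ x in a..b, f x * (D + ∫ t in (0 : ℝ)..x, g t) + (C + ∫ t in (0 : ℝ)..x, f t) * g x
      = (C + ∫ t in (0 : ℝ)..b, f t) * (D + ∫ t in (0 : ℝ)..b, g t)
        - (C + ∫ t in (0 : ℝ)..a, f t) * (D + ∫ t in (0 : ℝ)..a, g t) := by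
  have hii : ∀ {f : ℝ → ℝ}, LocallyIntegrable f → ∀ x y, IntervalIntegrable f volume x y :=
    fun hf x y => intervalIntegrable_iff.mpr <|
      (hf.integrableOn_isCompact isCompact_uIcc).mono_set uIoc_subset_uIcc
  have hac : ∀ {f : ℝ → ℝ} (_ : LocallyIntegrable f) (C : ℝ),
      AbsolutelyContinuousOnInterval (fun x => C + ∫ t in (0 : ℝ)..x, f t) a b := by
    intro f hf C
    have h1 : AbsolutelyContinuousOnInterval (fun x => ∫ t in a..x, f t) a b :=
      (hii hf a b).absolutelyContinuousOnInterval_intervalIntegral (by simp)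
    have h2 : AbsolutelyContinuousOnInterval (fun _ : ℝ => C + ∫ t in (0 : ℝ)..a, f t) a b :=
      (contDiff_const.contDiffOn).absolutelyContinuousOnInterval
    have e : (fun x => C + ∫ t in (0 : ℝ)..x, f t)
        = (fun _ => C + ∫ t in (0 : ℝ)..a, f t) + fun x => ∫ t in a..x, f t := by
      funext x
      rw [Pi.add_apply, add_assoc,
        intervalIntegral.integral_add_adjacent_intervals (hii hf _ _) (hii hf _ _)]
    rw [e]
    exact h2.add h1
  rw [← AbsolutelyContinuousOnInterval.integral_deriv_mul_eq_sub (hac hf C) (hac hg D)]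
  apply intervalIntegral.integral_congr_ae
  filter_upwards [_root_.LocallyIntegrable.ae_hasDerivAt_integral hf,
    _root_.LocallyIntegrable.ae_hasDerivAt_integral hg] with x h1 h2 _
  rw [((h1 0).const_add C).deriv, ((h2 0).const_add D).deriv]

/-- The integral of a derivative vanishes as soon as the function is itself integrable. -/
theorem integral_eq_zero_of_primitive {h P : ℝ → ℝ} (hh : Integrable h) (hP : Integrable P)
    (hPh : ∀ a b, ∫ x in a..b, h x = P b - P a) : ∫ x, h x = 0 := by
  have hPx : ∀ x, P x = P 0 + ∫ t in (0 : ℝ)..x, h t := fun x => by rw [hPh]; ring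
  have htop : Tendsto P atTop (𝓝 (P 0 + ∫ t in Ioi 0, h t)) := by
    rw [show P = _ from funext hPx]
    simpa using (intervalIntegral_tendsto_integral_Ioi 0 hh.integrableOn
      tendsto_id).const_add (P 0)
  have hbot : Tendsto P atBot (𝓝 (P 0 - ∫ t in Iic 0, h t)) := by
    have e : P = fun x => P 0 - ∫ t in x..(0 : ℝ), h t := funext fun x => by rw [hPh]; ring
    rw [e]
    simpa using (intervalIntegral_tendsto_integral_Iic 0 hh.integrableOn
      tendsto_id).const_sub (P 0)
  have t0 : P 0 + ∫ t in Ioi 0, h t = 0 := by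
    refine (IntegrableAtFilter.eq_zero_of_tendsto (μ := volume) (f := P)
      ⟨univ, univ_mem, hP.integrableOn⟩ ?_ htop)
    intro s hs
    obtain ⟨b, hb⟩ := mem_atTop_sets.1 hs
    rw [← top_le_iff]
    exact (Real.volume_Ici (a := b)).symm ▸ measure_mono hb
  have b0 : P 0 - ∫ t in Iic 0, h t = 0 := by
    refine (IntegrableAtFilter.eq_zero_of_tendsto (μ := volume) (f := P)
      ⟨univ, univ_mem, hP.integrableOn⟩ ?_ hbot)
    intro s hs
    obtain ⟨b, hb⟩ := mem_atBot_sets.1 hs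
    rw [← top_le_iff]
    exact (Real.volume_Iic (a := b)).symm ▸ measure_mono hb
  rw [← intervalIntegral.integral_Iic_add_Ioi hh.integrableOn hh.integrableOn (b := 0)]
  linarith

theorem locallyIntegrable_L2 (f : L2) : LocallyIntegrable f volume :=
  (Lp.memLp f).locallyIntegrable (by norm_num)

theorem integrable_mul_L2 (f g : L2) : Integrable (fun x => f x * g x) :=
  (Lp.memLp f).integrable_mul (Lp.memLp g)

theorem inner_L2 (f g : L2) : inner ℝ f g = ∫ x, f x * g x := by
  rw [MeasureTheory.L2.inner_def]
  refine integral_congr_ae (Eventually.of_forall fun x => ?_)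
  simp [mul_comm]

/-- A square integrable function with a weak derivative is a primitive of it. -/
theorem IsWeakDeriv.exists_primitive {f g : L2} (h : IsWeakDeriv f g) :
    ∃ C : ℝ, ∀ᵐ x, f x = C + ∫ t in (0 : ℝ)..x, g t := by
  have hg := locallyIntegrable_L2 g
  have hcont : Continuous fun x => ∫ t in (0 : ℝ)..x, g t :=
    intervalIntegral.continuous_primitive (fun a b => intervalIntegrable_iff.mpr <|
      (hg.integrableOn_isCompact isCompact_uIcc).mono_set uIoc_subset_uIcc) 0
  obtain ⟨C, hC⟩ := ae_eq_const_of_integral_deriv_mul_eq_zero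
    (f := fun x => f x - ∫ t in (0 : ℝ)..x, g t)
    ((locallyIntegrable_L2 f).sub hcont.locallyIntegrable) (by
      intro φ hφ hc
      have hφ' : Continuous (deriv φ) := hφ.continuous_deriv (by simp)
      have i1 : Integrable fun x => deriv φ x * ∫ t in (0 : ℝ)..x, g t :=
        (hφ'.mul hcont).integrable_of_hasCompactSupport hc.deriv.mul_right
      have i2 := integrable_test_mul hφ.continuous hc g
      have e : ∀ x, φ x = φ 0 + ∫ t in (0 : ℝ)..x, deriv φ t := by
        intro x
        rw [intervalIntegral.integral_deriv_eq_sub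
          (fun y _ => (hφ.differentiable (by simp)) y) (hφ'.intervalIntegrable _ _)]
        ring
      have key : ∫ x, (deriv φ x * (∫ t in (0 : ℝ)..x, g t) + φ x * g x) = 0 := by
        refine integral_eq_zero_of_primitive
          (P := fun x => φ x * ∫ t in (0 : ℝ)..x, g t) (i1.add i2)
          ((hφ.continuous.mul hcont).integrable_of_hasCompactSupport hc.mul_right) ?_
        intro a b
        have := integral_mul_primitive hφ'.locallyIntegrable hg (φ 0) 0 a b
        simpa only [← e, zero_add] using this
      rw [integral_add i1 i2] at key
      simp only [mul_sub]
      rw [integral_sub (integrable_test_mul hφ' hc.deriv f) i1, h φ hφ hc]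
      linarith)
  refine ⟨C, ?_⟩
  filter_upwards [hC] with x hx
  linarith

/-- Integration by parts in `H¹(ℝ)`. -/
theorem IsWeakDeriv.inner_left {f f' g g' : L2} (hf : IsWeakDeriv f f') (hg : IsWeakDeriv g g') :
    inner ℝ f' g = -inner ℝ f g' := by
  obtain ⟨C, hC⟩ := hf.exists_primitive
  obtain ⟨D, hD⟩ := hg.exists_primitive
  have i1 := integrable_mul_L2 f' g
  have i2 := integrable_mul_L2 f g'
  rw [inner_L2, inner_L2, eq_neg_iff_add_eq_zero, ← integral_add i1 i2]
  refine integral_eq_zero_of_primitive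
    (P := fun x => (C + ∫ t in (0 : ℝ)..x, f' t) * (D + ∫ t in (0 : ℝ)..x, g' t)) (i1.add i2)
    ((integrable_mul_L2 f g).congr ?_) ?_
  · filter_upwards [hC, hD] with x h1 h2
    rw [h1, h2]
  · intro a b
    rw [← integral_mul_primitive (locallyIntegrable_L2 f') (locallyIntegrable_L2 g') C D a b]
    apply intervalIntegral.integral_congr_ae
    filter_upwards [hC, hD] with x h1 h2 _
    rw [h1, h2]

/-- A function whose weak derivative is continuous is continuously differentiable. -/
theorem IsWeakDeriv.exists_hasDerivAt {f g : L2} (h : IsWeakDeriv f g) {v : ℝ → ℝ}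
    (hv : Continuous v) (hgv : ∀ᵐ x, g x = v x) :
    ∃ F : ℝ → ℝ, (∀ x, HasDerivAt F (v x) x) ∧ ∀ᵐ x, f x = F x := by
  obtain ⟨C, hC⟩ := h.exists_primitive
  refine ⟨fun x => C + ∫ t in (0 : ℝ)..x, v t, fun x => ?_, ?_⟩
  · exact (intervalIntegral.integral_hasDerivAt_right (hv.intervalIntegrable _ _)
      (hv.stronglyMeasurableAtFilter _ _) hv.continuousAt).const_add _
  · filter_upwards [hC] with x hx
    rw [hx, intervalIntegral.integral_congr_ae]
    filter_upwards [hgv] with t ht _ using ht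

/-- The Sobolev inequality in `H¹(ℝ)`. -/
theorem IsWeakDeriv.exists_continuous {f g : L2} (h : IsWeakDeriv f g) :
    ∃ F : ℝ → ℝ, Continuous F ∧ (∀ᵐ x, f x = F x) ∧
      ∀ x, F x ^ 2 ≤ 2 * ‖f‖ ^ 2 + 2 * ‖g‖ ^ 2 := by
  obtain ⟨C, hC⟩ := h.exists_primitive
  have hg := locallyIntegrable_L2 g
  have hii : ∀ x y, IntervalIntegrable g volume x y := fun a b => intervalIntegrable_iff.mpr <|
      (hg.integrableOn_isCompact isCompact_uIcc).mono_set uIoc_subset_uIcc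
  have hcont : Continuous fun x => C + ∫ t in (0 : ℝ)..x, g t :=
    continuous_const.add (intervalIntegral.continuous_primitive hii 0)
  refine ⟨_, hcont, hC, fun x => ?_⟩
  set F := fun x => C + ∫ t in (0 : ℝ)..x, g t with hF
  have hsq : ∀ f : L2, Integrable (fun t => f t ^ 2) := fun f => by
    simpa only [pow_two] using integrable_mul_L2 f f
  have hnorm : ∀ f : L2, ∫ t, f t ^ 2 = ‖f‖ ^ 2 := fun f => by
    rw [← real_inner_self_eq_norm_sq, inner_L2]; simp only [pow_two]
  -- Cauchy-Schwarz on `[x, y] ⊆ [x, x + 1]`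
  have hdiff : ∀ y ∈ Icc x (x + 1), (F x - F y) ^ 2 ≤ ‖g‖ ^ 2 := by
    intro y hy
    have e : F x - F y = -∫ t in x..y, g t := by
      have := intervalIntegral.integral_add_adjacent_intervals (hii 0 x) (hii x y)
      simp only [hF]; linarith
    have hgi := (hsq g).intervalIntegrable (a := x) (b := y)
    have hle : ∫ t in x..y, g t ^ 2 ≤ ‖g‖ ^ 2 := by
      rw [← hnorm, intervalIntegral.integral_of_le hy.1]
      exact setIntegral_le_integral (hsq g) (Eventually.of_forall fun t => sq_nonneg _)
    set m := ∫ t in x..y, g t with hm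
    have h0 : 0 ≤ ∫ t in x..y, (g t - m) ^ 2 :=
      intervalIntegral.integral_nonneg hy.1 fun t _ => sq_nonneg _
    have hex : ∫ t in x..y, (g t - m) ^ 2
        = (∫ t in x..y, g t ^ 2) - 2 * m * m + m ^ 2 * (y - x) := by
      have : ∀ t, (g t - m) ^ 2 = g t ^ 2 - 2 * m * g t + m ^ 2 := fun t => by ring
      simp only [this]
      rw [intervalIntegral.integral_add (hgi.sub ((hii x y).const_mul _)) (by simp),
        intervalIntegral.integral_sub hgi ((hii x y).const_mul _),
        intervalIntegral.integral_const_mul, intervalIntegral.integral_const]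
      simp only [smul_eq_mul]; ring
    rw [e, neg_sq]
    nlinarith [sq_nonneg m, hy.2]
  have hconst : ∫ y in x..(x + 1), F x ^ 2 = F x ^ 2 := by
    rw [intervalIntegral.integral_const]; simp
  have hFint : Integrable fun y => F y ^ 2 := (hsq f).congr (by
    filter_upwards [hC] with t ht; rw [ht])
  calc F x ^ 2 = ∫ y in x..(x + 1), F x ^ 2 := hconst.symm
    _ ≤ ∫ y in x..(x + 1), (2 * F y ^ 2 + 2 * ‖g‖ ^ 2) := by
        refine intervalIntegral.integral_mono_on (by linarith) (by simp)
          ((hFint.intervalIntegrable.const_mul _).add (by simp)) fun y hy => ?_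
        nlinarith [hdiff y hy, sq_nonneg (F x - 2 * F y)]
    _ = 2 * (∫ y in x..(x + 1), F y ^ 2) + 2 * ‖g‖ ^ 2 := by
        rw [intervalIntegral.integral_add (hFint.intervalIntegrable.const_mul _) (by simp),
          intervalIntegral.integral_const_mul, intervalIntegral.integral_const]
        simp
    _ ≤ 2 * ‖f‖ ^ 2 + 2 * ‖g‖ ^ 2 := by
        have : ∫ y in x..(x + 1), F y ^ 2 ≤ ∫ y, F y ^ 2 := by
          rw [intervalIntegral.integral_of_le (by linarith)]
          exact setIntegral_le_integral hFint (Eventually.of_forall fun t => sq_nonneg _)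
        have e : ∫ y, F y ^ 2 = ‖f‖ ^ 2 := by
          rw [← hnorm]
          exact integral_congr_ae (by filter_upwards [hC] with t ht; rw [ht])
        linarith

/-! ### Multiplication operators and elements of `H²(ℝ)` -/

theorem memLp_mul_L2 (V : ℝ →ᵇ ℝ) (f : L2) : MemLp (fun x => V x * f x) 2 :=
  MemLp.of_le_mul (g := f) (c := ‖V‖) (Lp.memLp f)
    (V.continuous.aestronglyMeasurable.mul (Lp.aestronglyMeasurable f))
    (Eventually.of_forall fun x => by
      rw [norm_mul]
      exact mul_le_mul_of_nonneg_right (V.norm_coe_le_norm x) (norm_nonneg _))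

/-- Multiplication by a bounded continuous function, as a bounded operator on `L²(ℝ)`. -/
def mulOp (V : ℝ →ᵇ ℝ) : L2 →L[ℝ] L2 :=
  LinearMap.mkContinuous
    { toFun := fun f => (memLp_mul_L2 V f).toLp _
      map_add' := fun f g => by
        apply Lp.ext
        filter_upwards [Lp.coeFn_add f g, (memLp_mul_L2 V f).coeFn_toLp,
          (memLp_mul_L2 V g).coeFn_toLp, (memLp_mul_L2 V (f + g)).coeFn_toLp,
          Lp.coeFn_add ((memLp_mul_L2 V f).toLp _) ((memLp_mul_L2 V g).toLp _)]
          with x h1 h2 h3 h4 h5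
        rw [h5, h4, h1, Pi.add_apply, Pi.add_apply, h2, h3, mul_add]
      map_smul' := fun r f => by
        apply Lp.ext
        filter_upwards [Lp.coeFn_smul r f, (memLp_mul_L2 V f).coeFn_toLp,
          (memLp_mul_L2 V (r • f)).coeFn_toLp, Lp.coeFn_smul r ((memLp_mul_L2 V f).toLp _)]
          with x h1 h2 h3 h4
        rw [RingHom.id_apply, h4, h3, h1, Pi.smul_apply, Pi.smul_apply, h2, smul_eq_mul,
          smul_eq_mul]
        ring }
    ‖V‖ fun f => by
      refine Lp.norm_le_mul_norm_of_ae_le_mul ?_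
      filter_upwards [(memLp_mul_L2 V f).coeFn_toLp] with x hx
      simp only [LinearMap.coe_mk, AddHom.coe_mk]
      rw [hx, norm_mul]
      exact mul_le_mul_of_nonneg_right (V.norm_coe_le_norm x) (norm_nonneg _)

theorem coeFn_mulOp (V : ℝ →ᵇ ℝ) (f : L2) : ∀ᵐ x, mulOp V f x = V x * f x :=
  (memLp_mul_L2 V f).coeFn_toLp

theorem norm_mulOp_le (V : ℝ →ᵇ ℝ) (f : L2) : ‖mulOp V f‖ ≤ ‖V‖ * ‖f‖ :=
  (mulOp V).le_of_opNorm_le (LinearMap.mkContinuous_norm_le _ (norm_nonneg _) _) f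

theorem inner_mulOp_comm (V : ℝ →ᵇ ℝ) (f g : L2) :
    inner ℝ (mulOp V f) g = inner ℝ f (mulOp V g) := by
  rw [inner_L2, inner_L2]
  refine integral_congr_ae ?_
  filter_upwards [coeFn_mulOp V f, coeFn_mulOp V g] with x h1 h2
  rw [h1, h2]; ring

theorem mulOp_mulOp (V W : ℝ →ᵇ ℝ) (f : L2) : mulOp V (mulOp W f) = mulOp (V * W) f := by
  apply Lp.ext
  filter_upwards [coeFn_mulOp V (mulOp W f), coeFn_mulOp W f, coeFn_mulOp (V * W) f]
    with x h1 h2 h3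
  rw [h1, h2, h3, BoundedContinuousFunction.mul_apply, mul_assoc]

theorem mulOp_sub (V W : ℝ →ᵇ ℝ) (f : L2) : mulOp (V - W) f = mulOp V f - mulOp W f := by
  apply Lp.ext
  filter_upwards [coeFn_mulOp V f, coeFn_mulOp W f, coeFn_mulOp (V - W) f,
    Lp.coeFn_sub (mulOp V f) (mulOp W f)] with x h1 h2 h3 h4
  rw [h4, h3, Pi.sub_apply, h1, h2, BoundedContinuousFunction.sub_apply, sub_mul]

theorem mulOp_one (f : L2) : mulOp 1 f = f := by
  apply Lp.ext
  filter_upwards [coeFn_mulOp 1 f] with x h1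
  rw [h1, BoundedContinuousFunction.coe_one, Pi.one_apply, one_mul]

theorem D1_eq {f : H2} {g : L2} (h : IsWeakDeriv f g) : D1 f = g :=
  (isWeakDeriv_D1fun f).unique h

theorem isWeakDeriv_D1 (f : H2) : IsWeakDeriv f (D1 f) := isWeakDeriv_D1fun f

theorem isWeakDeriv_D2 (f : H2) : IsWeakDeriv (D1 f) (D2 f) := isWeakDeriv_D2fun f

theorem D2_eq {f : H2} {g h : L2} (h1 : IsWeakDeriv f g) (h2 : IsWeakDeriv g h) : D2 f = h :=
  (isWeakDeriv_D2 f).unique (D1_eq h1 ▸ h2)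

/-- Classical derivatives are weak derivatives. -/
theorem isWeakDeriv_of_hasDerivAt {f f' : L2} {F F' : ℝ → ℝ} (hF : ∀ x, HasDerivAt F (F' x) x)
    (e : ∀ᵐ x, f x = F x) (e' : ∀ᵐ x, f' x = F' x) : IsWeakDeriv f f' := by
  intro φ hφ hc
  have hφ' : Continuous (deriv φ) := hφ.continuous_deriv (by simp)
  have i1 : Integrable (fun x => F x * deriv φ x) :=
    (integrable_test_mul hφ' hc.deriv f).congr (by
      filter_upwards [e] with x hx; rw [hx, mul_comm])
  have i2 : Integrable (fun x => F' x * φ x) :=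
    (integrable_test_mul hφ.continuous hc f').congr (by
      filter_upwards [e'] with x hx; rw [hx, mul_comm])
  have i3 : Integrable (fun x => F x * φ x) :=
    (integrable_test_mul hφ.continuous hc f).congr (by
      filter_upwards [e] with x hx; rw [hx, mul_comm])
  have := integral_mul_deriv_eq_deriv_mul_of_integrable (fun x _ => hF x)
    (fun x _ => (hφ.differentiable (by simp) x).hasDerivAt) i1 i2 i3
  have a1 : ∫ x, deriv φ x * f x = ∫ x, F x * deriv φ x :=
    integral_congr_ae (by filter_upwards [e] with x hx; rw [hx, mul_comm])
  have a2 : ∫ x, φ x * f' x = ∫ x, F' x * φ x :=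
    integral_congr_ae (by filter_upwards [e'] with x hx; rw [hx, mul_comm])
  rw [a1, a2, this]

/-- Functions of `H²(ℝ)` are bounded and continuously differentiable, with bounded derivative. -/
theorem exists_rep (f : H2) : ∃ F F' : ℝ →ᵇ ℝ, (∀ x, HasDerivAt F (F' x) x) ∧
    (∀ᵐ x, (f : L2) x = F x) ∧ (∀ᵐ x, D1 f x = F' x) ∧
    ‖F‖ ^ 2 ≤ 2 * ‖(f : L2)‖ ^ 2 + 2 * ‖D1 f‖ ^ 2 := by
  obtain ⟨G', hG', e', b'⟩ := (isWeakDeriv_D2 f).exists_continuous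
  obtain ⟨G, hG, e⟩ := (isWeakDeriv_D1 f).exists_hasDerivAt hG' e'
  obtain ⟨G0, hG0, e0, b0⟩ := (isWeakDeriv_D1 f).exists_continuous
  have hGc : Continuous G := continuous_iff_continuousAt.2 fun x => (hG x).continuousAt
  have : G0 = G := (hG0.ae_eq_iff_eq volume hGc).1 (by
    filter_upwards [e, e0] with x h1 h2; rw [← h1, ← h2])
  subst this
  have hb : ∀ (F : ℝ → ℝ) (C : ℝ), (∀ x, F x ^ 2 ≤ C) → ∀ x, ‖F x‖ ≤ √C := fun F C h x =>
    (Real.norm_eq_abs _).trans_le (Real.abs_le_sqrt (h x))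
  refine ⟨.ofNormedAddCommGroup G0 hGc _ (hb _ _ b0), .ofNormedAddCommGroup G' hG' _ (hb _ _ b'),
    hG, e, e', ?_⟩
  have h1 := BoundedContinuousFunction.norm_ofNormedAddCommGroup_le hGc (Real.sqrt_nonneg _)
    (hb _ _ b0)
  calc _ ≤ (√(2 * ‖(f : L2)‖ ^ 2 + 2 * ‖D1 f‖ ^ 2)) ^ 2 :=
        pow_le_pow_left₀ (norm_nonneg _) h1 2
    _ = _ := Real.sq_sqrt (by positivity)

/-- The operator `∂²` is symmetric. -/
theorem inner_D2_left (f g : H2) : inner ℝ (D2 f) (g : L2) = -inner ℝ (D1 f) (D1 g) :=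
  (isWeakDeriv_D2 f).inner_left (isWeakDeriv_D1 g)

/-! ### Powers of the hyperbolic secant -/

/-- The function `sech^q(a x)`. -/
def sechPow (a q x : ℝ) : ℝ := (1 / Real.cosh (a * x)) ^ q

theorem sechPow_pos (a q x : ℝ) : 0 < sechPow a q x :=
  Real.rpow_pos_of_pos (one_div_pos.2 (Real.cosh_pos _)) _

theorem hasDerivAt_sechPow (a q x : ℝ) :
    HasDerivAt (sechPow a q) (-(q * a * Real.tanh (a * x) * sechPow a q x)) x := by
  have hc := (Real.cosh_pos (a * x)).ne'
  have h1 : HasDerivAt (fun x => Real.cosh (a * x)) (Real.sinh (a * x) * (a * 1)) x :=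
    ((hasDerivAt_id x).const_mul a).cosh
  have h2 := (h1.inv hc).rpow_const (p := q) (Or.inl (inv_ne_zero hc))
  have e : sechPow a q = fun x => ((fun x => Real.cosh (a * x))⁻¹ x) ^ q := by
    funext y; simp [sechPow]
  rw [e]
  refine h2.congr_deriv ?_
  have hp : (0 : ℝ) < (Real.cosh (a * x))⁻¹ := inv_pos.2 (Real.cosh_pos _)
  simp only [Pi.inv_apply]
  rw [Real.rpow_sub_one hp.ne', Real.tanh_eq_sinh_div_cosh]
  field_simp

theorem hasDerivAt_tanh_mul (a x : ℝ) :
    HasDerivAt (fun x => Real.tanh (a * x)) (a * (1 / Real.cosh (a * x)) ^ 2) x := by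
  have hc := (Real.cosh_pos (a * x)).ne'
  have h0 : HasDerivAt (fun x => a * x) (a * 1) x := (hasDerivAt_id x).const_mul a
  have h2 := h0.sinh.div h0.cosh hc
  have e : (fun x => Real.tanh (a * x)) = fun x => Real.sinh (a * x) / Real.cosh (a * x) := by
    funext y; exact Real.tanh_eq_sinh_div_cosh _
  rw [e]
  refine h2.congr_deriv ?_
  have := Real.cosh_sq (a * x)
  field_simp
  rw [this]
  ring

theorem tanh_sq_add (x : ℝ) : Real.tanh x ^ 2 + (1 / Real.cosh x) ^ 2 = 1 := by
  have hc := (Real.cosh_pos x).ne'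
  rw [Real.tanh_eq_sinh_div_cosh]
  have := Real.cosh_sq x
  field_simp
  linarith

theorem continuous_sechPow (a q : ℝ) : Continuous (sechPow a q) :=
  continuous_iff_continuousAt.2 fun x => (hasDerivAt_sechPow a q x).continuousAt

theorem abs_tanh_le_one (x : ℝ) : |Real.tanh x| ≤ 1 := by
  rw [abs_le_one_iff_mul_self_le_one]
  nlinarith [tanh_sq_add x, sq_nonneg (1 / Real.cosh x)]

/-- The function `tanh(a x)`. -/
def tanhB (a : ℝ) : ℝ →ᵇ ℝ := .ofNormedAddCommGroup (fun x => Real.tanh (a * x))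
  (continuous_iff_continuousAt.2 fun x => (hasDerivAt_tanh_mul a x).continuousAt) 1
  fun _ => abs_tanh_le_one _

theorem one_div_cosh_le_one (x : ℝ) : 1 / Real.cosh x ≤ 1 :=
  (div_le_one (Real.cosh_pos x)).2 (Real.one_le_cosh x)

theorem sechPow_le_one {a q : ℝ} (hq : 0 ≤ q) (x : ℝ) : sechPow a q x ≤ 1 :=
  Real.rpow_le_one (one_div_pos.2 (Real.cosh_pos _)).le (one_div_cosh_le_one _) hq

/-- The function `sech²(a x)`. -/
def sechSqB (a : ℝ) : ℝ →ᵇ ℝ := .ofNormedAddCommGroup (fun x => (1 / Real.cosh (a * x)) ^ 2)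
  ((continuous_const.div (by fun_prop) (fun x => (Real.cosh_pos _).ne')).pow 2) 1
  fun x => by
    rw [Real.norm_of_nonneg (by positivity)]
    exact pow_le_one₀ (one_div_pos.2 (Real.cosh_pos _)).le (one_div_cosh_le_one _)

theorem integrable_sechPow {a q : ℝ} (ha : 0 < a) (hq : 0 < q) : Integrable (sechPow a q) := by
  have hb : ∀ x, ‖sechPow a q x‖ ≤ 2 ^ q * Real.exp (-(q * a) * |x|) := by
    intro x
    rw [Real.norm_of_nonneg (sechPow_pos _ _ _).le]
    have h1 : 1 / Real.cosh (a * x) ≤ 2 * Real.exp (-(a * |x|)) := by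
      rw [div_le_iff₀ (Real.cosh_pos _), ← Real.cosh_abs, abs_mul, abs_of_pos ha, Real.cosh_eq]
      have := Real.exp_pos (-(a * |x|))
      have e : Real.exp (-(a * |x|)) * Real.exp (a * |x|) = 1 := by
        rw [← Real.exp_add]; simp
      nlinarith
    calc sechPow a q x ≤ (2 * Real.exp (-(a * |x|))) ^ q :=
          Real.rpow_le_rpow (one_div_pos.2 (Real.cosh_pos _)).le h1 hq.le
      _ = _ := by
          rw [Real.mul_rpow (by norm_num) (Real.exp_pos _).le, ← Real.exp_mul]
          ring_nf
  have hqa : 0 < q * a := mul_pos hq ha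
  have hi : Integrable fun x => (2 : ℝ) ^ q * Real.exp (-(q * a) * |x|) := by
    refine Integrable.const_mul ?_ _
    rw [← integrableOn_univ, ← Set.Iic_union_Ioi (a := 0)]
    refine IntegrableOn.union ?_ ?_
    · refine (integrableOn_exp_mul_Iic hqa 0).congr_fun (fun x hx => ?_) measurableSet_Iic
      simp only [abs_of_nonpos (mem_Iic.1 hx)]
      ring_nf
    · refine (integrableOn_exp_mul_Ioi (neg_lt_zero.2 hqa) 0).congr_fun (fun x hx => ?_)
        measurableSet_Ioi
      simp only [abs_of_pos (mem_Ioi.1 hx)]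
  exact hi.mono' (continuous_sechPow a q).aestronglyMeasurable (Eventually.of_forall hb)

theorem sechPow_mul (a p q x : ℝ) : sechPow a p x * sechPow a q x = sechPow a (p + q) x :=
  (Real.rpow_add (one_div_pos.2 (Real.cosh_pos _)) p q).symm

theorem memLp_sechPow {a q : ℝ} (ha : 0 < a) (hq : 0 < q) : MemLp (sechPow a q) 2 := by
  rw [memLp_two_iff_integrable_sq (continuous_sechPow a q).aestronglyMeasurable]
  refine (integrable_sechPow ha (add_pos hq hq)).congr (Eventually.of_forall fun x => ?_)
  simp only [pow_two, sechPow_mul]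

/-- The square integrable function `sech^q(a x)`. -/
def sechLp {a q : ℝ} (ha : 0 < a) (hq : 0 < q) : L2 := (memLp_sechPow ha hq).toLp _

theorem coeFn_sechLp {a q : ℝ} (ha : 0 < a) (hq : 0 < q) :
    ∀ᵐ x, sechLp ha hq x = sechPow a q x := MemLp.coeFn_toLp _

theorem isWeakDeriv_sechLp {a q : ℝ} (ha : 0 < a) (hq : 0 < q) :
    IsWeakDeriv (sechLp ha hq) (-((q * a) • mulOp (tanhB a) (sechLp ha hq))) := by
  refine isWeakDeriv_of_hasDerivAt (hasDerivAt_sechPow a q) (coeFn_sechLp ha hq) ?_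
  filter_upwards [Lp.coeFn_neg ((q * a) • mulOp (tanhB a) (sechLp ha hq)),
    Lp.coeFn_smul (q * a) (mulOp (tanhB a) (sechLp ha hq)), coeFn_mulOp (tanhB a) (sechLp ha hq),
    coeFn_sechLp ha hq] with x h1 h2 h3 h4
  rw [h1, Pi.neg_apply, h2, Pi.smul_apply, h3, h4, smul_eq_mul]
  change -(q * a * (Real.tanh (a * x) * _)) = _
  ring

theorem contDiff_tanhB (a : ℝ) : ContDiff ℝ ∞ (tanhB a) := by
  have e : (tanhB a : ℝ → ℝ) = fun x => Real.sinh (a * x) / Real.cosh (a * x) := by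
    funext y; exact Real.tanh_eq_sinh_div_cosh _
  rw [e]
  exact (Real.contDiff_sinh.comp (contDiff_const.mul contDiff_id)).div
    (Real.contDiff_cosh.comp (contDiff_const.mul contDiff_id)) fun x => (Real.cosh_pos _).ne'

/-- The product rule for multiplication by `tanh(a x)`. -/
theorem IsWeakDeriv.mulOp_tanhB {f f' : L2} (h : IsWeakDeriv f f') (a : ℝ) :
    IsWeakDeriv (mulOp (tanhB a) f) (mulOp (tanhB a) f' + a • mulOp (sechSqB a) f) := by
  intro φ hφ hc
  have hφ' : Continuous (deriv φ) := hφ.continuous_deriv (by simp)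
  have hτ := contDiff_tanhB a
  have hψ : ContDiff ℝ ∞ (fun x => φ x * tanhB a x) := hφ.mul hτ
  have hψc : HasCompactSupport (fun x => φ x * tanhB a x) := hc.mul_right
  have hd : ∀ x, deriv (fun x => φ x * tanhB a x) x
      = deriv φ x * tanhB a x + φ x * (a * sechSqB a x) := fun x =>
    ((hφ.differentiable (by simp) x).hasDerivAt.mul (hasDerivAt_tanh_mul a x)).deriv
  have key := h _ hψ hψc
  simp only [hd, add_mul] at key
  have i1 : Integrable fun x => deriv φ x * tanhB a x * f x :=
    integrable_test_mul (hφ'.mul hτ.continuous) hc.deriv.mul_right f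
  have i2 : Integrable fun x => φ x * (a * sechSqB a x) * f x :=
    integrable_test_mul (hφ.continuous.mul (continuous_const.mul (sechSqB a).continuous))
      hc.mul_right f
  have i3 : Integrable fun x => φ x * tanhB a x * f' x :=
    integrable_test_mul hψ.continuous hψc f'
  rw [integral_add i1 i2] at key
  have a1 : ∫ x, deriv φ x * mulOp (tanhB a) f x = ∫ x, deriv φ x * tanhB a x * f x :=
    integral_congr_ae (by filter_upwards [coeFn_mulOp (tanhB a) f] with x hx; rw [hx, mul_assoc])
  have a2 : ∫ x, φ x * (mulOp (tanhB a) f' + a • mulOp (sechSqB a) f : L2) x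
      = ∫ x, (φ x * tanhB a x * f' x + φ x * (a * sechSqB a x) * f x) :=
    integral_congr_ae (by
      filter_upwards [coeFn_mulOp (tanhB a) f', coeFn_mulOp (sechSqB a) f,
        Lp.coeFn_add (mulOp (tanhB a) f') (a • mulOp (sechSqB a) f),
        Lp.coeFn_smul a (mulOp (sechSqB a) f)] with x h1 h2 h3 h4
      rw [h3, Pi.add_apply, h4, Pi.smul_apply, h1, h2, smul_eq_mul]
      ring)
  rw [a1, a2, integral_add i3 i2]
  linarith

theorem mulOp_tanhB_sq (a : ℝ) (f : L2) :
    mulOp (tanhB a) (mulOp (tanhB a) f) = f - mulOp (sechSqB a) f := by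
  rw [mulOp_mulOp]
  have : tanhB a * tanhB a = 1 - sechSqB a := by
    ext x
    have := tanh_sq_add (a * x)
    change Real.tanh (a * x) * Real.tanh (a * x) = 1 - (1 / Real.cosh (a * x)) ^ 2
    linarith
  rw [this, mulOp_sub, mulOp_one]

/-- The secant powers as elements of `H²(ℝ)`. -/
theorem exists_H2_sechLp {a q : ℝ} (ha : 0 < a) (hq : 0 < q) :
    ∃ f : H2, (f : L2) = sechLp ha hq ∧
      D1 f = -((q * a) • mulOp (tanhB a) (sechLp ha hq)) ∧
      D2 f = (q ^ 2 * a ^ 2) • sechLp ha hq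
        - (q * (q + 1) * a ^ 2) • mulOp (sechSqB a) (sechLp ha hq) := by
  have w1 := isWeakDeriv_sechLp ha hq
  have w2 := (w1.mulOp_tanhB a).smul (-(q * a))
  have e : -(q * a) • (mulOp (tanhB a) (-((q * a) • mulOp (tanhB a) (sechLp ha hq)))
      + a • mulOp (sechSqB a) (sechLp ha hq)) = (q ^ 2 * a ^ 2) • sechLp ha hq
        - (q * (q + 1) * a ^ 2) • mulOp (sechSqB a) (sechLp ha hq) := by
    rw [map_neg, map_smul, mulOp_tanhB_sq]
    module
  rw [e, neg_smul] at w2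
  exact ⟨⟨_, _, _, w1, w2⟩, rfl, D1_eq w1, D2_eq (f := ⟨_, _, _, w1, w2⟩) w1 w2⟩

/-! ### Spectral gaps of the Pöschl–Teller operators -/

/-- The factorisation `|(∂ + q a tanh) f|² = |f'|² + q² a² |f|² - q (q + 1) a² ⟨sech² f, f⟩`. -/
theorem norm_ladder_sq {f f' : L2} (h : IsWeakDeriv f f') (a q : ℝ) :
    ‖f' + (q * a) • mulOp (tanhB a) f‖ ^ 2 = ‖f'‖ ^ 2 + q ^ 2 * a ^ 2 * ‖f‖ ^ 2
      - q * (q + 1) * a ^ 2 * inner ℝ (mulOp (sechSqB a) f) f := by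
  have h1 := (h.mulOp_tanhB a).inner_left h
  rw [inner_add_left, inner_smul_left, RCLike.conj_to_real, inner_mulOp_comm,
    real_inner_comm] at h1
  have h2 : ‖mulOp (tanhB a) f‖ ^ 2 = ‖f‖ ^ 2 - inner ℝ (mulOp (sechSqB a) f) f := by
    rw [← real_inner_self_eq_norm_sq, inner_mulOp_comm, mulOp_tanhB_sq, inner_sub_right,
      real_inner_self_eq_norm_sq, real_inner_comm f]
  rw [norm_add_sq_real, inner_smul_right, norm_smul, mul_pow, h2, Real.norm_eq_abs, sq_abs,
    real_inner_comm]
  linear_combination (q * a) * h1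

/-- `h` is a test function and `h'` its derivative. -/
def IsTest (h h' : L2) : Prop :=
  ∃ φ : ℝ → ℝ, ContDiff ℝ ∞ φ ∧ HasCompactSupport φ ∧ (∀ᵐ x, h x = φ x) ∧
    ∀ᵐ x, h' x = deriv φ x

theorem IsTest.isWeakDeriv {h h' : L2} (H : IsTest h h') : IsWeakDeriv h h' := by
  obtain ⟨φ, hφ, -, e, e'⟩ := H
  exact isWeakDeriv_of_hasDerivAt (fun x => (hφ.differentiable (by simp) x).hasDerivAt) e e'

theorem exists_isTest {φ : ℝ → ℝ} (hφ : ContDiff ℝ ∞ φ) (hc : HasCompactSupport φ) :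
    ∃ h h' : L2, IsTest h h' ∧ (∀ᵐ x, h x = φ x) ∧ ∀ᵐ x, h' x = deriv φ x := by
  have m0 : MemLp φ 2 := hφ.continuous.memLp_of_hasCompactSupport hc
  have m1 : MemLp (deriv φ) 2 := (hφ.continuous_deriv (by simp)).memLp_of_hasCompactSupport hc.deriv
  exact ⟨m0.toLp _, m1.toLp _, ⟨φ, hφ, hc, m0.coeFn_toLp, m1.coeFn_toLp⟩, m0.coeFn_toLp,
    m1.coeFn_toLp⟩

/-- Weak derivatives, expressed with the inner product of `L²(ℝ)`. -/
theorem isWeakDeriv_of_isTest {f g : L2}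
    (H : ∀ h h' : L2, IsTest h h' → inner ℝ h' f = -inner ℝ h g) : IsWeakDeriv f g := by
  intro φ hφ hc
  obtain ⟨h, h', ht, e, e'⟩ := exists_isTest hφ hc
  have := H h h' ht
  rw [inner_L2, inner_L2] at this
  have a1 : ∫ x, deriv φ x * f x = ∫ x, h' x * f x :=
    integral_congr_ae (by filter_upwards [e'] with x hx; rw [hx])
  have a2 : ∫ x, φ x * g x = ∫ x, h x * g x :=
    integral_congr_ae (by filter_upwards [e] with x hx; rw [hx])
  rw [a1, a2, this]

theorem IsTest.add {h h' k k' : L2} (H : IsTest h h') (K : IsTest k k') :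
    IsTest (h + k) (h' + k') := by
  obtain ⟨φ, hφ, hφc, e, e'⟩ := H
  obtain ⟨ψ, hψ, hψc, f, f'⟩ := K
  refine ⟨φ + ψ, hφ.add hψ, hφc.add hψc, ?_, ?_⟩
  · filter_upwards [e, f, Lp.coeFn_add h k] with x h1 h2 h3
    rw [h3, Pi.add_apply, Pi.add_apply, h1, h2]
  · filter_upwards [e', f', Lp.coeFn_add h' k'] with x h1 h2 h3
    rw [h3, Pi.add_apply, h1, h2, deriv_add (hφ.differentiable (by simp) x)
      (hψ.differentiable (by simp) x)]

theorem IsTest.smul {h h' : L2} (H : IsTest h h') (r : ℝ) : IsTest (r • h) (r • h') := by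
  obtain ⟨φ, hφ, hφc, e, e'⟩ := H
  refine ⟨fun x => r * φ x, contDiff_const.mul hφ, hφc.mul_left, ?_, ?_⟩
  · filter_upwards [e, Lp.coeFn_smul r h] with x h1 h2
    rw [h2, Pi.smul_apply, h1, smul_eq_mul]
  · filter_upwards [e', Lp.coeFn_smul r h'] with x h1 h2
    rw [h2, Pi.smul_apply, h1, smul_eq_mul, deriv_const_mul _ (hφ.differentiable (by simp) x)]

theorem IsTest.zero : IsTest 0 0 := by
  refine ⟨fun _ => 0, contDiff_const, HasCompactSupport.zero, ?_, ?_⟩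
  · filter_upwards [Lp.coeFn_zero ℝ 2 (volume : Measure ℝ)] with x hx using hx
  · filter_upwards [Lp.coeFn_zero ℝ 2 (volume : Measure ℝ)] with x hx
    rw [hx]; simp

/-- The image of the test functions under `-∂ + p a tanh(a x)`, the formal adjoint of
`∂ + p a tanh(a x)`. -/
def ladderRange (a p : ℝ) : Submodule ℝ L2 where
  carrier := {y | ∃ h h' : L2, IsTest h h' ∧ y = -h' + (p * a) • mulOp (tanhB a) h}
  zero_mem' := ⟨0, 0, IsTest.zero, by simp⟩
  add_mem' := by
    rintro _ _ ⟨h, h', H, rfl⟩ ⟨k, k', K, rfl⟩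
    exact ⟨_, _, H.add K, by rw [map_add]; module⟩
  smul_mem' := by
    rintro r _ ⟨h, h', H, rfl⟩
    exact ⟨_, _, H.smul r, by rw [map_smul]; module⟩

/-- The functions annihilated by `∂ + p a tanh(a x)` are the multiples of `sech^p(a x)`. -/
theorem mem_span_sechLp {a p : ℝ} (ha : 0 < a) (hp : 0 < p) {f : L2}
    (hf : IsWeakDeriv f (-((p * a) • mulOp (tanhB a) f))) :
    ∃ C : ℝ, f = C • sechLp ha hp := by
  obtain ⟨F, hF, e, -⟩ := hf.exists_continuous
  have hv : Continuous fun x => -(p * a * tanhB a x * F x) :=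
    ((continuous_const.mul (tanhB a).continuous).mul hF).neg
  obtain ⟨G, hG, e'⟩ := hf.exists_hasDerivAt hv (by
    filter_upwards [e, Lp.coeFn_neg ((p * a) • mulOp (tanhB a) f),
      Lp.coeFn_smul (p * a) (mulOp (tanhB a) f), coeFn_mulOp (tanhB a) f] with x h1 h2 h3 h4
    rw [h2, Pi.neg_apply, h3, Pi.smul_apply, h4, h1, smul_eq_mul, ← mul_assoc])
  have : F = G := (hF.ae_eq_iff_eq volume
    (continuous_iff_continuousAt.2 fun x => (hG x).continuousAt)).1 (by
      filter_upwards [e, e'] with x h1 h2; rw [← h1, ← h2])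
  subst this
  -- `F cosh^p` has vanishing derivative
  have hd : ∀ x, HasDerivAt (fun x => F x * sechPow a (-p) x) 0 x := fun x => by
    refine ((hG x).mul (hasDerivAt_sechPow a (-p) x)).congr_deriv ?_
    change -(p * a * Real.tanh (a * x) * F x) * sechPow a (-p) x + _ = _
    ring
  have hc : ∀ x, F x * sechPow a (-p) x = F 0 * sechPow a (-p) 0 := fun x =>
    is_const_of_deriv_eq_zero (fun y => (hd y).differentiableAt) (fun y => (hd y).deriv) x 0
  refine ⟨F 0 * sechPow a (-p) 0, Lp.ext ?_⟩
  filter_upwards [e, coeFn_sechLp ha hp, Lp.coeFn_smul (F 0 * sechPow a (-p) 0) (sechLp ha hp)]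
    with x h1 h2 h3
  rw [h3, Pi.smul_apply, h2, h1, smul_eq_mul, ← hc x, mul_assoc, sechPow_mul, neg_add_cancel]
  simp [sechPow]

/-- Functions orthogonal to `sech^p` are limits of functions `(-∂ + p a tanh) h`. -/
theorem exists_isTest_near {a p : ℝ} (ha : 0 < a) (hp : 0 < p) {f : L2}
    (hf : inner ℝ (sechLp ha hp) f = 0) {ε : ℝ} (hε : 0 < ε) :
    ∃ h h' : L2, IsTest h h' ∧ ‖f - (-h' + (p * a) • mulOp (tanhB a) h)‖ < ε := by
  have hmem : f ∈ (ladderRange a p).topologicalClosure := by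
    rw [← Submodule.orthogonal_orthogonal_eq_closure, Submodule.mem_orthogonal]
    intro x hx
    rw [Submodule.mem_orthogonal] at hx
    obtain ⟨C, rfl⟩ := mem_span_sechLp ha hp (f := x) (isWeakDeriv_of_isTest fun h h' H => by
      have := hx _ ⟨h, h', H, rfl⟩
      rw [inner_add_left, inner_neg_left, inner_smul_left, RCLike.conj_to_real,
        inner_mulOp_comm] at this
      rw [inner_neg_right, inner_smul_right]
      linarith)
    rw [inner_smul_left, hf, mul_zero]
  obtain ⟨_, ⟨h, h', H, rfl⟩, hy⟩ := Metric.mem_closure_iff.1 hmem ε hε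
  exact ⟨h, h', H, by rwa [dist_eq_norm] at hy⟩

theorem inner_ladder_adjoint {f f' h h' : L2} (hf : IsWeakDeriv f f') (hh : IsWeakDeriv h h')
    (r : ℝ) (V : ℝ →ᵇ ℝ) :
    inner ℝ f (-h' + r • mulOp V h) = inner ℝ (f' + r • mulOp V f) h := by
  have := hf.inner_left hh
  rw [inner_add_right, inner_add_left, inner_neg_right, inner_smul_left, inner_smul_right,
    inner_mulOp_comm, RCLike.conj_to_real]
  linarith

/-- Duality: if `f` is a limit of vectors `y` with `⟨f, y⟩ ≤ b m` and `δ m² ≤ |y|²`, then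
`δ |f|² ≤ b²`. -/
theorem norm_sq_le_of_approx {H : Type*} [NormedAddCommGroup H] [InnerProductSpace ℝ H] {f : H}
    {b δ : ℝ} (hb : 0 ≤ b) (hδ : 0 < δ)
    (h : ∀ ε > 0, ∃ y : H, ‖f - y‖ < ε ∧ ∃ m : ℝ, 0 ≤ m ∧ inner ℝ f y ≤ b * m ∧
      δ * m ^ 2 ≤ ‖y‖ ^ 2) : δ * ‖f‖ ^ 2 ≤ b ^ 2 := by
  have hsδ := Real.sqrt_pos.2 hδ
  have key : √δ * ‖f‖ ^ 2 ≤ b * ‖f‖ := by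
    refine le_of_forall_pos_le_add fun η hη => ?_
    have hden : 0 < √δ * ‖f‖ + b + 1 := by positivity
    obtain ⟨y, hy, m, hm, h1, h2⟩ := h (η / (√δ * ‖f‖ + b + 1)) (by positivity)
    set ε := η / (√δ * ‖f‖ + b + 1) with hε
    have hεη : ε * (√δ * ‖f‖ + b + 1) = η := div_mul_cancel₀ _ hden.ne'
    have hε0 : 0 < ε := by positivity
    have h3 : √δ * m ≤ ‖y‖ := by
      rw [← abs_of_nonneg (norm_nonneg y), ← abs_of_nonneg (mul_nonneg hsδ.le hm)]
      apply sq_le_sq.1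
      rw [mul_pow, Real.sq_sqrt hδ.le]
      exact h2
    have h4 : ‖y‖ ≤ ‖f‖ + ε := by
      have := norm_sub_norm_le y f
      rw [norm_sub_rev] at this
      linarith
    have h5 : ‖f‖ ^ 2 ≤ inner ℝ f y + ‖f‖ * ε := by
      have e : ‖f‖ ^ 2 = inner ℝ f y + inner ℝ f (f - y) := by
        rw [inner_sub_right, real_inner_self_eq_norm_sq]; ring
      have := real_inner_le_norm f (f - y)
      have := mul_le_mul_of_nonneg_left hy.le (norm_nonneg f)
      linarith
    calc √δ * ‖f‖ ^ 2 ≤ √δ * (b * m + ‖f‖ * ε) :=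
          mul_le_mul_of_nonneg_left (h5.trans (by linarith)) hsδ.le
      _ = b * (√δ * m) + √δ * ‖f‖ * ε := by ring
      _ ≤ b * (‖f‖ + ε) + √δ * ‖f‖ * ε := by gcongr; exact h3.trans h4
      _ ≤ b * ‖f‖ + η := by nlinarith
  rcases (norm_nonneg f).eq_or_lt with h0 | h0
  · rw [← h0]; nlinarith
  · have h1 : √δ * ‖f‖ ≤ b := by
      refine le_of_mul_le_mul_right ?_ h0
      linarith
    calc δ * ‖f‖ ^ 2 = (√δ * ‖f‖) ^ 2 := by rw [mul_pow, Real.sq_sqrt hδ.le]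
      _ ≤ b ^ 2 := pow_le_pow_left₀ (by positivity) h1 2

theorem inner_sechSqB_nonneg (a : ℝ) (f : L2) : 0 ≤ inner ℝ (mulOp (sechSqB a) f) f := by
  rw [inner_L2]
  refine integral_nonneg_of_ae ?_
  filter_upwards [coeFn_mulOp (sechSqB a) f] with x hx
  rw [hx, Pi.zero_apply, mul_assoc]
  exact mul_nonneg (sq_nonneg _) (mul_self_nonneg _)

/-- On the orthogonal complement of the ground state `sech^p`, the operator
`-∂² + p² a² - p (p + 1) a² sech²` is bounded below by a positive constant. The adjoint factor
`-∂ + p a tanh` is bounded below: its square is `-∂² + p² a² + p (1 - p) a² sech²`, which is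
at least `p² a²` for `p ≤ 1`, and at least `(2 p - 1) a²` for `p ≥ 1` by the factorisation with
`p - 1` in place of `p`. -/
theorem exists_gap {a p : ℝ} (ha : 0 < a) (hp : 0 < p) :
    ∃ δ : ℝ, 0 < δ ∧ ∀ f f' : L2, IsWeakDeriv f f' → inner ℝ (sechLp ha hp) f = 0 →
      δ * ‖f‖ ^ 2 ≤ ‖f' + (p * a) • mulOp (tanhB a) f‖ ^ 2 := by
  -- the adjoint factor is bounded below
  obtain ⟨δ, hδ, hlow⟩ : ∃ δ : ℝ, 0 < δ ∧ ∀ h h' : L2, IsWeakDeriv h h' →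
      δ * ‖h‖ ^ 2 ≤ ‖-h' + (p * a) • mulOp (tanhB a) h‖ ^ 2 := by
    have e : ∀ h h' : L2, IsWeakDeriv h h' → ‖-h' + (p * a) • mulOp (tanhB a) h‖ ^ 2
        = ‖h'‖ ^ 2 + p ^ 2 * a ^ 2 * ‖h‖ ^ 2
          + p * (1 - p) * a ^ 2 * inner ℝ (mulOp (sechSqB a) h) h := fun h h' H => by
      have h1 := norm_ladder_sq H a (-p)
      have h2 : -h' + (p * a) • mulOp (tanhB a) h
          = -(h' + (-p * a) • mulOp (tanhB a) h) := by module
      rw [h2, norm_neg, h1]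
      ring
    rcases le_total p 1 with h1 | h1
    · refine ⟨p ^ 2 * a ^ 2, by positivity, fun h h' H => ?_⟩
      rw [e h h' H]
      have := mul_nonneg (mul_nonneg (mul_nonneg hp.le (sub_nonneg.2 h1)) (sq_nonneg a))
        (inner_sechSqB_nonneg a h)
      nlinarith [sq_nonneg ‖h'‖]
    · refine ⟨(2 * p - 1) * a ^ 2, mul_pos (by linarith) (by positivity), fun h h' H => ?_⟩
      rw [e h h' H]
      have h2 := norm_ladder_sq H a (p - 1)
      have h3 := sq_nonneg ‖h' + ((p - 1) * a) • mulOp (tanhB a) h‖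
      rw [h2] at h3
      nlinarith
  refine ⟨δ, hδ, fun f f' hf h0 => norm_sq_le_of_approx (norm_nonneg _) hδ fun ε hε => ?_⟩
  obtain ⟨h, h', H, hn⟩ := exists_isTest_near ha hp h0 hε
  refine ⟨_, hn, ‖h‖, norm_nonneg _, ?_, hlow h h' H.isWeakDeriv⟩
  rw [inner_ladder_adjoint hf H.isWeakDeriv]
  exact real_inner_le_norm _ _

/-- The second gap for `p = 3`: orthogonally to the first two eigenfunctions `sech³` and
`sech² tanh`, the operator `-∂² + 4 a² - 12 a² sech²` is bounded below by a positive constant.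
The adjoint factor intertwines it with the case `p = 2`, whose ground state is `sech²`. -/
theorem exists_gap_three {a : ℝ} (ha : 0 < a) :
    ∃ δ : ℝ, 0 < δ ∧ ∀ f f' : L2, IsWeakDeriv f f' →
      inner ℝ (sechLp ha three_pos) f = 0 →
      inner ℝ (mulOp (tanhB a) (sechLp ha two_pos)) f = 0 →
      (5 * a ^ 2 + δ) * ‖f‖ ^ 2 ≤ ‖f' + (3 * a) • mulOp (tanhB a) f‖ ^ 2 := by
  obtain ⟨δ, hδ, hgap⟩ := exists_gap ha two_pos
  refine ⟨δ, hδ, fun f f' hf h0 h1 =>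
    norm_sq_le_of_approx (norm_nonneg _) (by positivity) fun ε hε => ?_⟩
  set s := sechLp ha two_pos with hs
  have ws := isWeakDeriv_sechLp ha two_pos
  rw [← hs] at ws
  -- the orthogonality to `sech² tanh` makes the first factor applied to `f` orthogonal to `sech²`
  have hs0 : inner ℝ (f' + (3 * a) • mulOp (tanhB a) f) s = 0 := by
    have := hf.inner_left ws
    rw [inner_neg_right, inner_smul_right, real_inner_comm, real_inner_comm _ f, h1] at this
    rw [inner_add_left, inner_smul_left, inner_mulOp_comm, real_inner_comm s f',
      real_inner_comm _ f, h1]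
    linarith
  obtain ⟨h, h', H, hn⟩ := exists_isTest_near ha three_pos h0 hε
  have hw := H.isWeakDeriv
  -- `k` is the component of `h` orthogonal to `s`
  set t := inner ℝ s h / ‖s‖ ^ 2 with ht
  set k := h - t • s with hk
  have hsk : inner ℝ s k = 0 := by
    rcases eq_or_ne s 0 with h2 | h2
    · rw [h2, inner_zero_left]
    · have : ‖s‖ ^ 2 ≠ 0 := pow_ne_zero 2 (norm_ne_zero_iff.2 h2)
      rw [hk, inner_sub_right, inner_smul_right, real_inner_self_eq_norm_sq, ht,
        div_mul_cancel₀ _ this, sub_self]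
  refine ⟨_, hn, ‖k‖, norm_nonneg _, ?_, ?_⟩
  · rw [inner_ladder_adjoint hf hw]
    have : h = k + t • s := by rw [hk]; abel
    rw [this, inner_add_right, inner_smul_right, hs0, mul_zero, add_zero]
    exact real_inner_le_norm _ _
  · have wk := hw.add (ws.smul (-t))
    have g := hgap (h + (-t) • s) _ wk (by
      rw [neg_smul, ← sub_eq_add_neg]; exact hsk)
    have e1 : h' + -t • -((2 * a) • mulOp (tanhB a) s) + (2 * a) • mulOp (tanhB a) (h + -t • s)
        = h' + (2 * a) • mulOp (tanhB a) h := by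
      rw [map_add, map_smul]; module
    have e2 : h + -t • s = k := by rw [hk]; module
    rw [e1, e2, norm_ladder_sq hw] at g
    have e3 : -h' + (3 * a) • mulOp (tanhB a) h
        = -(h' + (-3 * a) • mulOp (tanhB a) h) := by module
    rw [e3, norm_neg, norm_ladder_sq hw]
    have hkh : ‖k‖ ^ 2 ≤ ‖h‖ ^ 2 := by
      have : h = k + t • s := by rw [hk]; abel
      rw [this, norm_add_sq_real, inner_smul_right, real_inner_comm, hsk]
      nlinarith [sq_nonneg ‖t • s‖]
    nlinarith [mul_le_mul_of_nonneg_left hkh (sq_nonneg a)]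

/-! ### Negative eigenvalues of symmetric operators -/

section Abstract

variable {H : Type*} [NormedAddCommGroup H] [InnerProductSpace ℝ H]

/-- For a bounded symmetric operator that is at most `θ` on a subspace of finite codimension, the
supremum of the Rayleigh quotient is attained as soon as it exceeds `θ`. -/
theorem exists_eigenvector_of_rayleigh [CompleteSpace H] (R : H →L[ℝ] H)
    (hR : ∀ x y, inner ℝ (R x) y = inner ℝ x (R y)) (F : Submodule ℝ H) [FiniteDimensional ℝ F]
    {θ θ' : ℝ} (hθ : θ ≤ θ') (hF : ∀ x ∈ Fᗮ, inner ℝ (R x) x ≤ θ * ‖x‖ ^ 2)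
    {x₀ : H} (hx₀ : θ' * ‖x₀‖ ^ 2 < inner ℝ (R x₀) x₀) :
    ∃ μ : ℝ, θ' < μ ∧ ∃ x : H, x ≠ 0 ∧ R x = μ • x := by
  have hx0 : x₀ ≠ 0 := by rintro rfl; simp at hx₀
  have hn0 : 0 < ‖x₀‖ := norm_pos_iff.2 hx0
  set S : Set ℝ := {r | ∃ x : H, ‖x‖ = 1 ∧ r = inner ℝ (R x) x} with hS
  have hbdd : BddAbove S := by
    refine ⟨‖R‖, ?_⟩
    rintro _ ⟨x, hx, rfl⟩
    calc inner ℝ (R x) x ≤ ‖R x‖ * ‖x‖ := real_inner_le_norm _ _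
      _ ≤ ‖R‖ * ‖x‖ * ‖x‖ := by gcongr; exact R.le_opNorm x
      _ = ‖R‖ := by rw [hx]; ring
  have hunit : ∀ x : H, x ≠ 0 → inner ℝ (R x) x / ‖x‖ ^ 2 ∈ S := fun x hx => by
    refine ⟨‖x‖⁻¹ • x, norm_smul_inv_norm hx, ?_⟩
    rw [map_smul, inner_smul_left, inner_smul_right, RCLike.conj_to_real]
    field_simp
  set μ := sSup S with hμ
  have hμθ : θ' < μ := by
    refine lt_of_lt_of_le ?_ (le_csSup hbdd (hunit x₀ hx0))
    rwa [lt_div_iff₀ (by positivity)]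
  have hle : ∀ x, inner ℝ (R x) x ≤ μ * ‖x‖ ^ 2 := fun x => by
    rcases eq_or_ne x 0 with rfl | hx
    · simp
    · have := le_csSup hbdd (hunit x hx)
      rwa [div_le_iff₀ (pow_pos (norm_pos_iff.2 hx) 2)] at this
  obtain ⟨s, -, hs, hsS⟩ := exists_seq_tendsto_sSup ⟨_, hunit x₀ hx0⟩ hbdd
  choose x hx1 hxs using hsS
  set B : H →L[ℝ] H := μ • ContinuousLinearMap.id ℝ H - R with hB
  have hBx : ∀ y, B y = μ • y - R y := fun y => rfl
  have hBin : ∀ y, inner ℝ (B y) y = μ * ‖y‖ ^ 2 - inner ℝ (R y) y := fun y => by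
    rw [hBx, inner_sub_left, inner_smul_left, real_inner_self_eq_norm_sq, RCLike.conj_to_real]
  have hBsym : ∀ y z, inner ℝ (B y) z = inner ℝ y (B z) := fun y z => by
    rw [hBx, hBx, inner_sub_left, inner_sub_right, hR, inner_smul_left, inner_smul_right,
      RCLike.conj_to_real]
  have hBpos : ∀ y, 0 ≤ inner ℝ (B y) y := fun y => by rw [hBin]; linarith [hle y]
  -- `|B y|²` is controlled by the form of `B`, which is nonnegative
  have hBsq : ∀ y, ‖B y‖ ^ 2 ≤ (‖B‖ + 1) * inner ℝ (B y) y := fun y => by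
    have hpos : (0 : ℝ) < ‖B‖ + 1 := by positivity
    have h1 := hBpos (y - (‖B‖ + 1)⁻¹ • B y)
    rw [map_sub, map_smul, inner_sub_left, inner_sub_right, inner_sub_right, inner_smul_right,
      inner_smul_left, inner_smul_left, inner_smul_right, RCLike.conj_to_real, hBsym (B y) y,
      real_inner_self_eq_norm_sq] at h1
    have h2 : inner ℝ (B (B y)) (B y) ≤ ‖B‖ * ‖B y‖ ^ 2 := by
      calc _ ≤ ‖B (B y)‖ * ‖B y‖ := real_inner_le_norm _ _
        _ ≤ ‖B‖ * ‖B y‖ * ‖B y‖ := by gcongr; exact B.le_opNorm _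
        _ = _ := by ring
    set t := (‖B‖ + 1)⁻¹ with ht
    have ht1 : t * (‖B‖ + 1) = 1 := inv_mul_cancel₀ hpos.ne'
    have ht0 : 0 < t := by positivity
    have h3 : t * ‖B y‖ ^ 2 ≤ inner ℝ (B y) y := by
      have h4 := mul_le_mul_of_nonneg_left h2 (mul_nonneg ht0.le ht0.le)
      have h5 : t * t * (‖B‖ * ‖B y‖ ^ 2) = t * (1 - t) * ‖B y‖ ^ 2 := by
        rw [show t * t * (‖B‖ * ‖B y‖ ^ 2) = t * (t * (‖B‖ + 1) - t) * ‖B y‖ ^ 2 by ring, ht1]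
      nlinarith [mul_nonneg (mul_nonneg ht0.le ht0.le) (sq_nonneg ‖B y‖)]
    calc ‖B y‖ ^ 2 = (‖B‖ + 1) * (t * ‖B y‖ ^ 2) := by
          rw [← mul_assoc, mul_comm (‖B‖ + 1) t, ht1, one_mul]
      _ ≤ _ := mul_le_mul_of_nonneg_left h3 hpos.le
  have hBlim : Tendsto (fun n => B (x n)) atTop (𝓝 0) := by
    rw [tendsto_zero_iff_norm_tendsto_zero]
    have h1 : Tendsto (fun n => (‖B‖ + 1) * (μ - s n)) atTop (𝓝 0) := by
      simpa [← hμ] using (hs.const_sub μ).const_mul (‖B‖ + 1)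
    have h2 : Tendsto (fun n => ‖B (x n)‖ ^ 2) atTop (𝓝 0) :=
      squeeze_zero (fun n => by positivity) (fun n => (hBsq (x n)).trans_eq (by
        rw [hBin, hx1, hxs]; ring)) h1
    simpa using h2.sqrt
  -- the components in `F` converge along a subsequence
  have hyb : ∀ n, F.orthogonalProjectionOnto (x n) ∈ Metric.closedBall (0 : F) 1 := fun n => by
    rw [mem_closedBall_zero_iff]
    exact (F.norm_orthogonalProjectionOnto_apply_le (x n)).trans (hx1 n).le
  obtain ⟨y, -, φ, hφ, hy⟩ := (isCompact_closedBall (0 : F) 1).tendsto_subseq hyb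
  have hy' : Tendsto (fun n => (F.orthogonalProjectionOnto (x (φ n)) : H)) atTop (𝓝 (y : H)) :=
    (continuous_subtype_val.tendsto y).comp hy
  set u : ℕ → H := fun n => x (φ n) - F.orthogonalProjectionOnto (x (φ n)) with hu
  have huF : ∀ n, u n ∈ Fᗮ := fun n => F.sub_starProjection_mem_orthogonal (x (φ n))
  have hcoer : ∀ z ∈ Fᗮ, (μ - θ) * ‖z‖ ≤ ‖B z‖ := fun z hz => by
    rcases (norm_nonneg z).eq_or_lt with h0 | h0
    · rw [← h0, mul_zero]; exact norm_nonneg _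
    · refine le_of_mul_le_mul_right ?_ h0
      have h1 := real_inner_le_norm (B z) z
      rw [hBin] at h1
      nlinarith [hF z hz]
  have hμθ0 : 0 < μ - θ := by linarith
  have hBu : Tendsto (fun n => B (u n)) atTop (𝓝 (-B y)) := by
    have h1 := (hBlim.comp hφ.tendsto_atTop).sub ((B.continuous.tendsto _).comp hy')
    rw [zero_sub] at h1
    refine h1.congr fun n => ?_
    simp [hu]
  have huc : CauchySeq u := by
    rw [Metric.cauchySeq_iff]
    intro ε hε
    obtain ⟨N, hN⟩ := Metric.cauchySeq_iff.1 hBu.cauchySeq ((μ - θ) * ε) (by positivity)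
    refine ⟨N, fun m hm n hn => ?_⟩
    have h1 := hN m hm n hn
    have h2 := hcoer _ (Fᗮ.sub_mem (huF m) (huF n))
    rw [dist_eq_norm, ← map_sub] at h1
    rw [dist_eq_norm]
    exact lt_of_mul_lt_mul_left (h2.trans_lt h1) hμθ0.le
  obtain ⟨v, hv⟩ := cauchySeq_tendsto_of_complete huc
  have hxl : Tendsto (fun n => x (φ n)) atTop (𝓝 (v + y)) :=
    (hv.add hy').congr fun n => by simp [hu]
  refine ⟨μ, hμθ, v + y, ?_, ?_⟩
  · have h1 : ‖v + (y : H)‖ = 1 :=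
      tendsto_nhds_unique hxl.norm (by simp [hx1])
    intro h0
    rw [h0, norm_zero] at h1
    exact zero_ne_one h1
  · have h1 : B (v + y) = 0 :=
      tendsto_nhds_unique ((B.continuous.tendsto _).comp hxl) (hBlim.comp hφ.tendsto_atTop)
    rw [hBx, sub_eq_zero] at h1
    exact h1.symm

variable {D : Type*} [AddCommGroup D] [Module ℝ D]

/-- The eigenspace `{v : T v = lam v}` of an operator `T` in `H` whose domain `D` is identified
with a subspace of `H` by `ι`. -/
def eig (T ι : D →ₗ[ℝ] H) (lam : ℝ) : Submodule ℝ D := LinearMap.eqLocus T (lam • ι)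

theorem mem_eig {T ι : D →ₗ[ℝ] H} {lam : ℝ} {v : D} : v ∈ eig T ι lam ↔ T v = lam • ι v :=
  Iff.rfl

variable {T ι : D →ₗ[ℝ] H}

theorem inner_eq_zero_of_mem_eig (hT : ∀ u v, inner ℝ (T u) (ι v) = inner ℝ (ι u) (T v))
    {a b : ℝ} (hab : a ≠ b) {u v : D} (hu : u ∈ eig T ι a) (hv : v ∈ eig T ι b) :
    inner ℝ (ι u) (ι v) = 0 := by
  have h := hT u v
  rw [mem_eig.1 hu, mem_eig.1 hv, inner_smul_left, inner_smul_right, RCLike.conj_to_real] at h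
  have h2 : (a - b) * inner ℝ (ι u) (ι v) = 0 := by linarith
  exact (mul_eq_zero.1 h2).resolve_left (sub_ne_zero.2 hab)

theorem inner_nonpos_of_mem_iSup_eig
    (hT : ∀ u v, inner ℝ (T u) (ι v) = inner ℝ (ι u) (T v)) {v : D}
    (hv : v ∈ ⨆ lam : Iio (0 : ℝ), eig T ι lam) : inner ℝ (T v) (ι v) ≤ 0 := by
  obtain ⟨f, hf, rfl⟩ := (Submodule.mem_iSup_iff_exists_finsupp _ _).1 hv
  rw [Finsupp.sum, map_sum, map_sum, sum_inner]
  refine Finset.sum_nonpos fun a _ => ?_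
  rw [inner_sum]
  refine Finset.sum_nonpos fun b _ => ?_
  rw [mem_eig.1 (hf a), inner_smul_left, RCLike.conj_to_real]
  rcases eq_or_ne a b with rfl | hab
  · exact mul_nonpos_of_nonpos_of_nonneg a.2.le (real_inner_self_nonneg)
  · rw [inner_eq_zero_of_mem_eig hT (fun h => hab (Subtype.ext h)) (hf a) (hf b), mul_zero]

/-- If the form of `T` is positive on a subspace of codimension `m`, then the negative eigenvalues
and the kernel have total multiplicity at most `m`. -/
theorem rank_iSup_eig_add_rank_ker_le (hι : Function.Injective ι)
    (hT : ∀ u v, inner ℝ (T u) (ι v) = inner ℝ (ι u) (T v)) {m : ℕ} (F : D →ₗ[ℝ] (Fin m → ℝ))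
    (hF : ∀ v, v ≠ 0 → F v = 0 → 0 < inner ℝ (T v) (ι v)) :
    Module.rank ℝ ↥(⨆ lam : Iio (0 : ℝ), eig T ι lam) + Module.rank ℝ (eig T ι 0) ≤ m := by
  set N := ⨆ lam : Iio (0 : ℝ), eig T ι lam with hN
  have horth : ∀ n ∈ N, ∀ e ∈ eig T ι 0, inner ℝ (ι n) (ι e) = 0 := by
    intro n hn e he
    induction hn using Submodule.iSup_induction' with
    | mem i x hx => exact inner_eq_zero_of_mem_eig hT (ne_of_lt i.2) hx he
    | zero => simp
    | add x y _ _ h1 h2 => rw [map_add, inner_add_left, h1, h2, add_zero]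
  have hdisj : N ⊓ eig T ι 0 = ⊥ := by
    rw [eq_bot_iff]
    rintro v ⟨h1, h2⟩
    have := horth v h1 v h2
    rw [inner_self_eq_zero] at this
    exact (Submodule.mem_bot ℝ).2 (hι (by rw [this, map_zero]))
  have hsup := Submodule.rank_sup_add_rank_inf_eq N (eig T ι 0)
  rw [hdisj, rank_bot, add_zero] at hsup
  rw [← hsup]
  have hinj : Function.Injective (F ∘ₗ (N ⊔ eig T ι 0).subtype) := by
    rw [← LinearMap.ker_eq_bot, LinearMap.ker_eq_bot']
    rintro ⟨v, hv⟩ hFv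
    by_contra hne
    have hv0 : v ≠ 0 := fun h => hne (Subtype.ext h)
    have hpos := hF v hv0 hFv
    obtain ⟨n, hn, e, he, rfl⟩ := Submodule.mem_sup.1 hv
    have h0 : T e = 0 := by rw [mem_eig.1 he, zero_smul]
    have h1 := hT n e
    rw [map_add, map_add, h0, add_zero, inner_add_right, h1, h0, inner_zero_right,
      add_zero] at hpos
    exact absurd (inner_nonpos_of_mem_iSup_eig hT hn) (not_le.2 hpos)
  have := LinearMap.lift_rank_le_of_injective _ hinj
  simpa using this

/-- If `T` is self-adjoint and bounded below, its form is at least `δ > 0` on a subspace of finite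
codimension and is negative on a subspace of dimension `n`, then the negative eigenvalues have
total multiplicity at least `n`. The resolvent `R = (T + κ)⁻¹` is a bounded symmetric operator,
and eigenvalues of `R` above `1 / κ` are negative eigenvalues of `T`. -/
theorem le_rank_iSup_eig [CompleteSpace H] (hι : Function.Injective ι)
    (hT : ∀ u v, inner ℝ (T u) (ι v) = inner ℝ (ι u) (T v)) {κ : ℝ} (hκ : 0 < κ)
    (hlow : ∀ v, ‖ι v‖ ^ 2 ≤ inner ℝ (T v + κ • ι v) (ι v))
    (hsurj : ∀ h : H, ∃ v, T v + κ • ι v = h)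
    (F : Submodule ℝ H) [FiniteDimensional ℝ F] {δ : ℝ} (hδ : 0 < δ)
    (hF : ∀ v, ι v ∈ Fᗮ → δ * ‖ι v‖ ^ 2 ≤ inner ℝ (T v) (ι v)) {n : ℕ}
    (ψ : (Fin n → ℝ) →ₗ[ℝ] D) (hψ : ∀ x, x ≠ 0 → inner ℝ (T (ψ x)) (ι (ψ x)) < 0) :
    (n : Cardinal) ≤ Module.rank ℝ ↥(⨆ lam : Iio (0 : ℝ), eig T ι lam) := by
  set N := ⨆ lam : Iio (0 : ℝ), eig T ι lam with hN
  by_contra hlt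
  rw [not_le] at hlt
  have hfin : FiniteDimensional ℝ N := by
    rw [FiniteDimensional, ← Module.rank_lt_aleph0_iff]
    exact hlt.trans (Cardinal.natCast_lt_aleph0)
  have hfr : Module.finrank ℝ N < n := by
    rw [← Module.finrank_eq_rank] at hlt
    exact_mod_cast hlt
  choose ρ hρ using hsurj
  have hnorm : ∀ v, ‖ι v‖ ≤ ‖T v + κ • ι v‖ := fun v => by
    rcases (norm_nonneg (ι v)).eq_or_lt with h0 | h0
    · rw [← h0]; exact norm_nonneg _
    · refine le_of_mul_le_mul_right ?_ h0
      have := hlow v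
      have := real_inner_le_norm (T v + κ • ι v) (ι v)
      nlinarith
  have huniq : ∀ v w, T v + κ • ι v = T w + κ • ι w → v = w := fun v w h => by
    have h1 := hnorm (v - w)
    rw [map_sub, map_sub, smul_sub, sub_add_sub_comm, h, sub_self, norm_zero] at h1
    rw [← sub_eq_zero]
    exact hι (by rw [map_zero, map_sub]; exact norm_le_zero_iff.1 h1)
  let R : H →L[ℝ] H := LinearMap.mkContinuous
    { toFun := fun h => ι (ρ h)
      map_add' := fun h k => by
        rw [← map_add]
        congr 1
        apply huniq
        rw [hρ, map_add, map_add, smul_add, add_add_add_comm, hρ, hρ]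
      map_smul' := fun r h => by
        rw [RingHom.id_apply, ← map_smul]
        congr 1
        apply huniq
        rw [hρ, map_smul, map_smul, smul_comm, ← smul_add, hρ] }
    1 fun h => by
      have := hnorm (ρ h)
      rw [hρ] at this
      simpa using this
  have hRdef : ∀ h, R h = ι (ρ h) := fun h => rfl
  have hRinv : ∀ v, R (T v + κ • ι v) = ι v := fun v => by
    rw [hRdef]; congr 1; apply huniq; rw [hρ]
  have hRsym : ∀ h k, inner ℝ (R h) k = inner ℝ h (R k) := fun h k => by
    conv_lhs => rw [← hρ k]
    conv_rhs => rw [← hρ h]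
    rw [hRdef, hRdef, inner_add_right, inner_add_left, hT, inner_smul_left, inner_smul_right,
      RCLike.conj_to_real]
  have hRpos : ∀ h, 0 ≤ inner ℝ (R h) h := fun h => by
    have := hlow (ρ h)
    rw [hρ, real_inner_comm] at this
    exact (sq_nonneg _).trans this
  -- compress the resolvent to the orthogonal complement of the negative eigenspaces
  set M : Submodule ℝ H := N.map ι with hM
  have hRM : ∀ y ∈ M, R y ∈ M := by
    rintro _ ⟨v, hv, rfl⟩
    change v ∈ N at hv
    induction hv using Submodule.iSup_induction' with
    | mem i x hx =>
      rcases eq_or_ne x 0 with rfl | hx0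
      · simp
      have h1 := hRinv x
      rw [mem_eig.1 hx, ← add_smul, map_smul] at h1
      have hne : (i : ℝ) + κ ≠ 0 := by
        intro h0
        rw [h0, zero_smul] at h1
        exact hx0 (hι (by rw [map_zero, ← h1]))
      have h2 : R (ι x) = ((i : ℝ) + κ)⁻¹ • ι x := by
        rw [eq_inv_smul_iff₀ hne, h1]
      rw [h2]
      exact M.smul_mem _ ⟨x, Submodule.mem_iSup_of_mem i hx, rfl⟩
    | zero => simp
    | add x y _ _ h1 h2 => rw [map_add, map_add]; exact M.add_mem h1 h2
  have hRMo : ∀ y ∈ Mᗮ, R y ∈ Mᗮ := fun y hy => by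
    rw [Submodule.mem_orthogonal] at hy ⊢
    intro m hm
    rw [← hRsym]
    exact hy _ (hRM m hm)
  set P := Mᗮ.starProjection with hP
  have hPmem : ∀ y, P y ∈ Mᗮ := fun y => Submodule.starProjection_apply_mem _ _
  have hPself : ∀ y ∈ Mᗮ, P y = y := fun y hy => Submodule.starProjection_eq_self_iff.2 hy
  have hPsym : ∀ x y, inner ℝ (P x) y = inner ℝ x (P y) := fun x y =>
    Submodule.inner_starProjection_left_eq_right _ _ _
  set R₂ : H →L[ℝ] H := R ∘L P with hR₂
  have hR₂x : ∀ x, R₂ x = R (P x) := fun x => rfl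
  have hR₂sym : ∀ x y, inner ℝ (R₂ x) y = inner ℝ x (R₂ y) := fun x y => by
    rw [hR₂x, hR₂x, ← hPself _ (hRMo _ (hPmem x)), hPsym, hRsym, hPsym,
      hPself _ (hRMo _ (hPmem y))]
  -- a vector of the negative subspace orthogonal to the negative eigenspaces
  obtain ⟨c, hc, hcM⟩ : ∃ c : Fin n → ℝ, c ≠ 0 ∧ ι (ψ c) ∈ Mᗮ := by
    let g : (Fin n → ℝ) →ₗ[ℝ] M := (M.orthogonalProjectionOnto : H →ₗ[ℝ] M) ∘ₗ ι ∘ₗ ψ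
    have hlt : Module.finrank ℝ M < Module.finrank ℝ (Fin n → ℝ) := by
      rw [Module.finrank_fin_fun]
      exact (Submodule.finrank_map_le ι N).trans_lt hfr
    obtain ⟨c, hc, hc0⟩ := Submodule.exists_mem_ne_zero_of_ne_bot
      (LinearMap.ker_ne_bot_of_finrank_lt (f := g) hlt)
    exact ⟨c, hc0, Submodule.orthogonalProjectionOnto_eq_zero_iff.1 hc⟩
  -- for that vector `w`, the form of `R` is nonnegative at `w - κ⁻¹ (T + κ) w`
  have hray : 1 / κ * ‖ι (ψ c)‖ ^ 2 < inner ℝ (R₂ (ι (ψ c))) (ι (ψ c)) := by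
    rw [hR₂x, hPself _ hcM]
    set w := ι (ψ c) with hw
    set h := T (ψ c) + κ • w with hh
    have h1 := hRpos (w - κ⁻¹ • h)
    have h2 : R h = w := hRinv _
    have h3 : inner ℝ (R w) h = ‖w‖ ^ 2 := by rw [hRsym, h2, real_inner_self_eq_norm_sq]
    have h4 : inner ℝ w h < κ * ‖w‖ ^ 2 := by
      rw [hh, inner_add_right, inner_smul_right, real_inner_self_eq_norm_sq, real_inner_comm]
      linarith [hψ c hc]
    rw [map_sub, map_smul, h2, inner_sub_left, inner_sub_right, inner_sub_right, inner_smul_left,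
      inner_smul_left, inner_smul_right, inner_smul_right, RCLike.conj_to_real,
      real_inner_self_eq_norm_sq, h3] at h1
    have h5 : κ⁻¹ * (κ⁻¹ * inner ℝ w h) < κ⁻¹ * ‖w‖ ^ 2 := by
      refine mul_lt_mul_of_pos_left ?_ (inv_pos.2 hκ)
      rw [inv_mul_lt_iff₀ hκ]
      exact h4
    rw [one_div]
    linarith
  have hbound : ∀ x ∈ (F.map (R : H →ₗ[ℝ] H) ⊔ M)ᗮ,
      inner ℝ (R₂ x) x ≤ 1 / (κ + δ) * ‖x‖ ^ 2 := fun x hx => by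
    rw [← Submodule.inf_orthogonal] at hx
    obtain ⟨hx1, hx2⟩ := Submodule.mem_inf.1 hx
    rw [hR₂x, hPself x hx2, div_mul_eq_mul_div, one_mul, le_div_iff₀ (by positivity)]
    have h1 : ι (ρ x) ∈ Fᗮ := by
      rw [Submodule.mem_orthogonal] at hx1 ⊢
      intro f hf
      rw [← hRdef, ← hRsym]
      exact hx1 _ ⟨f, hf, rfl⟩
    have h2 := hF _ h1
    have h3 : inner ℝ (R x) x = inner ℝ (T (ρ x)) (ι (ρ x)) + κ * ‖R x‖ ^ 2 := by
      conv_lhs => rw [← hρ x]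
      rw [hRinv, inner_add_right, inner_smul_right, real_inner_self_eq_norm_sq, hRdef,
        real_inner_comm]
    rw [← hRdef] at h2 h3
    have h4 := real_inner_le_norm (R x) x
    have h5 : (κ + δ) * ‖R x‖ ≤ ‖x‖ := by
      rcases (norm_nonneg (R x)).eq_or_lt with h0 | h0
      · rw [← h0, mul_zero]; exact norm_nonneg _
      · refine le_of_mul_le_mul_right ?_ h0
        nlinarith
    nlinarith [norm_nonneg x]
  obtain ⟨μ, hμ, x, hx0, hx⟩ := exists_eigenvector_of_rayleigh R₂ hR₂sym
    (F.map (R : H →ₗ[ℝ] H) ⊔ M) (one_div_le_one_div_of_le hκ (by linarith)) hbound hray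
  have hμ0 : 0 < μ := (one_div_pos.2 hκ).trans hμ
  have hxM : x ∈ Mᗮ := by
    have : x = μ⁻¹ • R₂ x := by rw [hx, inv_smul_smul₀ hμ0.ne']
    rw [this]
    exact Mᗮ.smul_mem _ (hRMo _ (hPmem x))
  rw [hR₂x, hPself x hxM, hRdef] at hx
  have hxe : ρ x ∈ eig T ι (μ⁻¹ - κ) := by
    rw [mem_eig, sub_smul, hx, inv_smul_smul₀ hμ0.ne', ← hx, eq_sub_iff_add_eq]
    exact hρ x
  have hneg : μ⁻¹ - κ < 0 := by
    rw [sub_neg, inv_lt_comm₀ hμ0 hκ, ← one_div]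
    exact hμ
  have hxN : ι (ρ x) ∈ M := ⟨ρ x, Submodule.mem_iSup_of_mem (⟨_, hneg⟩ : Iio (0 : ℝ)) hxe, rfl⟩
  rw [hx] at hxN
  have h0 := (Submodule.mem_orthogonal _ _).1 hxM _ hxN
  rw [inner_smul_left, RCLike.conj_to_real, real_inner_self_eq_norm_sq] at h0
  have := mul_pos hμ0 (pow_pos (norm_pos_iff.2 hx0) 2)
  linarith

end Abstract

/-! ### Solvability of the shifted equations -/

/-- The equation `-f'' + m f = h` has a solution in `H²(ℝ)`: the pair `(f, f' / √m)` is the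
orthogonal projection of `(h / m, 0)` to the closed subspace of all such pairs. -/
theorem exists_neg_D2_add_smul_eq {m : ℝ} (hm : 0 < m) (h : L2) :
    ∃ f : H2, -D2 f + m • (f : L2) = h := by
  have hr := Real.sqrt_pos.2 hm
  have hrr : √m * √m = m := Real.mul_self_sqrt hm.le
  set r := √m with hrdef
  -- the pairs `(f, f' / r)`, where `r = √m`
  let K : Submodule ℝ (WithLp 2 (L2 × L2)) :=
    { carrier := {x | ∀ k k' : L2, IsTest k k' → inner ℝ k' x.fst = -inner ℝ k (r • x.snd)}
      zero_mem' := fun k k' _ => by simp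
      add_mem' := fun {x y} hx hy k k' H => by
        have h1 := hx k k' H
        have h2 := hy k k' H
        rw [WithLp.add_fst, WithLp.add_snd, smul_add, inner_add_right, inner_add_right, h1, h2]
        ring
      smul_mem' := fun c x hx k k' H => by
        have h1 := hx k k' H
        rw [WithLp.smul_fst, WithLp.smul_snd, smul_comm, inner_smul_right, inner_smul_right, h1]
        ring }
  have hmemK : ∀ x, x ∈ K ↔ ∀ k k' : L2, IsTest k k' →
      inner ℝ k' x.fst = -inner ℝ k (r • x.snd) := fun x => Iff.rfl
  have hK : IsClosed (K : Set (WithLp 2 (L2 × L2))) := by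
    have e : (K : Set (WithLp 2 (L2 × L2))) = ⋂ (k : L2) (k' : L2) (_ : IsTest k k'),
        {x | inner ℝ k' x.fst = -inner ℝ k (r • x.snd)} := by
      ext x; simp [hmemK]
    rw [e]
    refine isClosed_iInter fun k => isClosed_iInter fun k' => isClosed_iInter fun _ => ?_
    have c1 : Continuous fun x : WithLp 2 (L2 × L2) => x.fst := WithLp.continuous_fst ..
    have c2 : Continuous fun x : WithLp 2 (L2 × L2) => x.snd := WithLp.continuous_snd ..
    exact isClosed_eq (continuous_const.inner c1) (continuous_const.inner (c2.const_smul r)).neg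
  have : CompleteSpace K := hK.completeSpace_coe
  set x := K.starProjection (WithLp.toLp 2 (m⁻¹ • h, 0)) with hx
  have hxK : x ∈ K := K.starProjection_apply_mem _
  have w1 : IsWeakDeriv x.fst (r • x.snd) := isWeakDeriv_of_isTest hxK
  -- orthogonality of the residual to the pairs of test functions is the weak equation
  have w2 : IsWeakDeriv (r • x.snd) (m • x.fst - h) := by
    refine isWeakDeriv_of_isTest fun k k' H => ?_
    have hy : WithLp.toLp 2 (k, r⁻¹ • k') ∈ K := fun l l' L => by
      change inner ℝ l' k = -inner ℝ l (r • r⁻¹ • k')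
      rw [smul_inv_smul₀ hr.ne']
      exact L.isWeakDeriv.inner_left H.isWeakDeriv
    have h0 := K.starProjection_inner_eq_zero (WithLp.toLp 2 (m⁻¹ • h, 0)) _ hy
    rw [← hx, WithLp.prod_inner_apply] at h0
    change inner ℝ (m⁻¹ • h - x.fst) k + inner ℝ (0 - x.snd) (r⁻¹ • k') = 0 at h0
    rw [zero_sub, inner_neg_left, inner_smul_right, inner_sub_left, inner_smul_left,
      RCLike.conj_to_real] at h0
    rw [inner_smul_right, inner_sub_right, inner_smul_right, real_inner_comm x.snd k',
      real_inner_comm x.fst k, real_inner_comm h k]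
    have e1 : m * (m⁻¹ * inner ℝ h k) = inner ℝ h k := mul_inv_cancel_left₀ hm.ne' _
    have e2 : m * (r⁻¹ * inner ℝ x.snd k') = r * inner ℝ x.snd k' := by
      rw [← hrr, mul_assoc, mul_inv_cancel_left₀ hr.ne']
    rw [← e2]
    linear_combination e1 - m * h0
  refine ⟨⟨x.fst, _, _, w1, w2⟩, ?_⟩
  rw [D2_eq (f := ⟨x.fst, _, _, w1, w2⟩) w1 w2]
  change -(m • x.fst - h) + m • x.fst = h
  abel

/-- Bounded perturbations of a nonnegative self-adjoint operator: large shifts are onto and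
bounded below. -/
theorem exists_shift {H D : Type*} [NormedAddCommGroup H] [InnerProductSpace ℝ H]
    [CompleteSpace H] [AddCommGroup D] [Module ℝ D] {T₀ ι : D →ₗ[ℝ] H} (V : H →L[ℝ] H)
    (hpos : ∀ v, 0 ≤ inner ℝ (T₀ v) (ι v))
    (hsurj : ∀ κ : ℝ, 0 < κ → ∀ h, ∃ v, T₀ v + κ • ι v = h) :
    ∃ κ : ℝ, 0 < κ ∧
      (∀ v, ‖ι v‖ ^ 2 ≤ inner ℝ (T₀ v + V (ι v) + κ • ι v) (ι v)) ∧
      ∀ h, ∃ v, T₀ v + V (ι v) + κ • ι v = h := by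
  set κ := ‖V‖ + 1 with hκ
  have hκ0 : 0 < κ := by positivity
  have hlow : ∀ v, κ * ‖ι v‖ ^ 2 ≤ inner ℝ (T₀ v + κ • ι v) (ι v) := fun v => by
    rw [inner_add_left, inner_smul_left, RCLike.conj_to_real, real_inner_self_eq_norm_sq]
    linarith [hpos v]
  have hnorm : ∀ v, κ * ‖ι v‖ ≤ ‖T₀ v + κ • ι v‖ := fun v => by
    rcases (norm_nonneg (ι v)).eq_or_lt with h0 | h0
    · rw [← h0, mul_zero]; exact norm_nonneg _
    · refine le_of_mul_le_mul_right ?_ h0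
      nlinarith [hlow v, real_inner_le_norm (T₀ v + κ • ι v) (ι v)]
  refine ⟨κ, hκ0, fun v => ?_, fun h => ?_⟩
  · have h1 : -(‖V‖ * ‖ι v‖ ^ 2) ≤ inner ℝ (V (ι v)) (ι v) := by
      have h2 := abs_le.1 (abs_real_inner_le_norm (V (ι v)) (ι v))
      have h3 := mul_le_mul_of_nonneg_right (V.le_opNorm (ι v)) (norm_nonneg (ι v))
      nlinarith [h2.1]
    have h4 : T₀ v + V (ι v) + κ • ι v = (T₀ v + κ • ι v) + V (ι v) := by abel
    rw [h4, inner_add_left]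
    nlinarith [hlow v]
  · choose ρ hρ using hsurj κ hκ0
    have huniq : ∀ v w, T₀ v + κ • ι v = T₀ w + κ • ι w → ι v = ι w := fun v w e => by
      have h1 := hnorm (v - w)
      rw [map_sub, map_sub, smul_sub, sub_add_sub_comm, e, sub_self, norm_zero] at h1
      rw [← sub_eq_zero, ← norm_le_zero_iff]
      nlinarith
    let G : H →L[ℝ] H := LinearMap.mkContinuous
      { toFun := fun h => ι (ρ h)
        map_add' := fun h k => by
          rw [← map_add]
          apply huniq
          rw [hρ, map_add, map_add, smul_add, add_add_add_comm, hρ, hρ]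
        map_smul' := fun r h => by
          rw [RingHom.id_apply, ← map_smul]
          apply huniq
          rw [hρ, map_smul, map_smul, smul_comm, ← smul_add, hρ] }
      κ⁻¹ fun h => by
        have := hnorm (ρ h)
        rw [hρ] at this
        rwa [le_inv_mul_iff₀ hκ0]
    -- `V (T₀ + κ)⁻¹` is a strict contraction, so `1 + V (T₀ + κ)⁻¹` is invertible
    have hG : ‖V ∘L G‖ < 1 := by
      have h1 : ‖G‖ ≤ κ⁻¹ := LinearMap.mkContinuous_norm_le _ (by positivity) _
      calc ‖V ∘L G‖ ≤ ‖V‖ * ‖G‖ := V.opNorm_comp_le G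
        _ ≤ ‖V‖ * κ⁻¹ := by gcongr
        _ < 1 := by rw [← div_eq_mul_inv, div_lt_one hκ0]; linarith
    have hunit : IsUnit (1 - -(V ∘L G)) := isUnit_one_sub_of_norm_lt_one (by rwa [norm_neg])
    obtain ⟨S, hS⟩ := hunit.exists_right_inv
    refine ⟨ρ (S h), ?_⟩
    have h1 := congrArg (fun f : H →L[ℝ] H => f h) hS
    have h2 : S h + V (G (S h)) = h := by
      simpa [sub_neg_eq_add] using h1
    rw [add_right_comm, hρ]
    exact h2

/-! ### The Hessian in Hilbert space -/

/-- The Hilbert space `(L²(ℝ))³`. -/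
abbrev L2x3 : Type := PiLp 2 (fun _ : Fin 3 => L2)

/-- The vector of `(L²(ℝ))³` with given components. -/
def vec3 (x y z : L2) : L2x3 := WithLp.toLp 2 ![x, y, z]

theorem inner_vec3 (x y z x' y' z' : L2) :
    inner ℝ (vec3 x y z) (vec3 x' y' z') = inner ℝ x x' + inner ℝ y y' + inner ℝ z z' := by
  rw [PiLp.inner_apply, Fin.sum_univ_three]; rfl

theorem vec3_add (x y z x' y' z' : L2) :
    vec3 x y z + vec3 x' y' z' = vec3 (x + x') (y + y') (z + z') := by
  ext i : 1
  fin_cases i <;> rfl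

theorem smul_vec3 (r : ℝ) (x y z : L2) : r • vec3 x y z = vec3 (r • x) (r • y) (r • z) := by
  ext i : 1
  fin_cases i <;> rfl

theorem vec3_eta (h : L2x3) : h = vec3 (h 0) (h 1) (h 2) := by
  ext i : 1
  fin_cases i <;> rfl

theorem vec3_inj {x y z x' y' z' : L2} (h : vec3 x y z = vec3 x' y' z') :
    x = x' ∧ y = y' ∧ z = z' :=
  ⟨congrArg (fun v : L2x3 => v 0) h, congrArg (fun v : L2x3 => v 1) h,
    congrArg (fun v : L2x3 => v 2) h⟩

/-- The inclusion of `(H²(ℝ))³` into `(L²(ℝ))³`. -/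
def incl3 : H2x3 →ₗ[ℝ] L2x3 where
  toFun v := vec3 v.1 v.2.1 v.2.2
  map_add' _ _ := (vec3_add _ _ _ _ _ _).symm
  map_smul' _ _ := (smul_vec3 _ _ _ _).symm

theorem incl3_apply (v : H2x3) : incl3 v = vec3 v.1 v.2.1 v.2.2 := rfl

theorem incl3_injective : Function.Injective incl3 := fun v w h => by
  obtain ⟨h1, h2, h3⟩ := vec3_inj h
  exact Prod.ext (Subtype.ext h1) (Prod.ext (Subtype.ext h2) (Subtype.ext h3))

/-- The second order part of the Hessian. -/
def secondOrder (k : ℝ) : H2x3 →ₗ[ℝ] L2x3 where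
  toFun v := vec3 (-D2 v.1) ((2 / k) • -D2 v.2.1) ((2 / k) • -D2 v.2.2)
  map_add' v w := by
    rw [vec3_add]
    simp only [Prod.fst_add, Prod.snd_add, map_add, neg_add, smul_add]
  map_smul' r v := by
    rw [RingHom.id_apply, smul_vec3]
    simp only [Prod.smul_fst, Prod.smul_snd, map_smul, smul_neg, smul_comm r]

/-- The zeroth order part of the Hessian, for bounded continuous profiles `u` and `α`. -/
def zerothOrder (k c Ω : ℝ) (u α : ℝ →ᵇ ℝ) : L2x3 →L[ℝ] L2x3 :=
  let e : L2x3 ≃L[ℝ] (Fin 3 → L2) := PiLp.continuousLinearEquiv 2 ℝ (fun _ : Fin 3 => L2)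
  let pr : Fin 3 → L2x3 →L[ℝ] L2 := PiLp.proj 2 (fun _ => L2)
  (e.symm : (Fin 3 → L2) →L[ℝ] L2x3) ∘L ContinuousLinearMap.pi
    ![c • pr 0 - mulOp u ∘L pr 0 - (2 : ℝ) • (mulOp α ∘L pr 1),
      -((2 : ℝ) • (mulOp α ∘L pr 0)) + (2 / k) • (-(Ω • pr 1) - k • (mulOp u ∘L pr 1)),
      (2 / k) • (-(Ω • pr 2) - k • (mulOp u ∘L pr 2))]

theorem zerothOrder_vec3 (k c Ω : ℝ) (u α : ℝ →ᵇ ℝ) (x y z : L2) :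
    zerothOrder k c Ω u α (vec3 x y z)
      = vec3 (c • x - mulOp u x - (2 : ℝ) • mulOp α y)
          (-((2 : ℝ) • mulOp α x) + (2 / k) • (-(Ω • y) - k • mulOp u y))
          ((2 / k) • (-(Ω • z) - k • mulOp u z)) := by
  ext i : 1
  fin_cases i <;> rfl

/-- The Hessian as an operator in `(L²(ℝ))³` with domain `(H²(ℝ))³`. -/
def hessianL2 (k c Ω : ℝ) (u α : ℝ →ᵇ ℝ) : H2x3 →ₗ[ℝ] L2x3 :=
  secondOrder k + (zerothOrder k c Ω u α : L2x3 →ₗ[ℝ] L2x3) ∘ₗ incl3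

theorem hessianL2_apply (k c Ω : ℝ) (u α : ℝ →ᵇ ℝ) (v : H2x3) :
    hessianL2 k c Ω u α v = vec3
      (-D2 v.1 + c • (v.1 : L2) - mulOp u v.1 - (2 : ℝ) • mulOp α v.2.1)
      (-((2 : ℝ) • mulOp α v.1)
        + (2 / k) • (-D2 v.2.1 - Ω • (v.2.1 : L2) - k • mulOp u v.2.1))
      ((2 / k) • (-D2 v.2.2 - Ω • (v.2.2 : L2) - k • mulOp u v.2.2)) := by
  change secondOrder k v + zerothOrder k c Ω u α (incl3 v) = _
  rw [incl3_apply, zerothOrder_vec3]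
  change vec3 _ _ _ + _ = _
  rw [vec3_add]
  congr 1 <;> module

theorem inner_hessianL2_comm (k c Ω : ℝ) (u α : ℝ →ᵇ ℝ) (v w : H2x3) :
    inner ℝ (hessianL2 k c Ω u α v) (incl3 w) = inner ℝ (incl3 v) (hessianL2 k c Ω u α w) := by
  have hD : ∀ f g : H2, inner ℝ (D2 f) (g : L2) = inner ℝ (f : L2) (D2 g) := fun f g => by
    rw [inner_D2_left, real_inner_comm _ (f : L2), inner_D2_left, real_inner_comm]
  rw [hessianL2_apply, hessianL2_apply, incl3_apply, incl3_apply, inner_vec3, inner_vec3]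
  simp only [inner_add_left, inner_sub_left, inner_neg_left, inner_smul_left, inner_add_right,
    inner_sub_right, inner_neg_right, inner_smul_right, RCLike.conj_to_real, hD,
    inner_mulOp_comm]
  ring

theorem exists_shift_hessianL2 {k : ℝ} (hk : 0 < k) (c Ω : ℝ) (u α : ℝ →ᵇ ℝ) :
    ∃ κ : ℝ, 0 < κ ∧
      (∀ v, ‖incl3 v‖ ^ 2 ≤ inner ℝ (hessianL2 k c Ω u α v + κ • incl3 v) (incl3 v)) ∧
      ∀ h, ∃ v, hessianL2 k c Ω u α v + κ • incl3 v = h := by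
  have hk2 : 0 < 2 / k := by positivity
  refine exists_shift (T₀ := secondOrder k) (ι := incl3) (zerothOrder k c Ω u α) (fun v => ?_)
    fun κ hκ h => ?_
  · change 0 ≤ inner ℝ (vec3 _ _ _) (vec3 _ _ _)
    rw [inner_vec3]
    simp only [inner_smul_left, inner_neg_left, inner_D2_left, neg_neg, RCLike.conj_to_real,
      real_inner_self_eq_norm_sq]
    positivity
  · obtain ⟨f, hf⟩ := exists_neg_D2_add_smul_eq hκ (h 0)
    have hm : 0 < κ / (2 / k) := by positivity
    obtain ⟨g, hg⟩ := exists_neg_D2_add_smul_eq hm ((2 / k)⁻¹ • h 1)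
    obtain ⟨l, hl⟩ := exists_neg_D2_add_smul_eq hm ((2 / k)⁻¹ • h 2)
    refine ⟨(f, g, l), ?_⟩
    change vec3 _ _ _ + κ • vec3 _ _ _ = _
    have key : ∀ (g : H2) (x : L2), -D2 g + (κ / (2 / k)) • (g : L2) = (2 / k)⁻¹ • x →
        (2 / k) • -D2 g + κ • (g : L2) = x := fun g x e => by
      have := congrArg (fun y => (2 / k) • y) e
      simp only [smul_add, smul_smul, mul_inv_cancel₀ hk2.ne', one_smul,
        mul_div_cancel₀ κ hk2.ne'] at this
      exact this
    rw [smul_vec3, vec3_add, key g _ hg, key l _ hl, hf]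
    exact (vec3_eta h).symm

theorem coe_L2_add (f g : L2) : ((f + g : L2) : L0) = (f : L0) + g := rfl
theorem coe_L2_sub (f g : L2) : ((f - g : L2) : L0) = (f : L0) - g := rfl
theorem coe_L2_neg (f : L2) : ((-f : L2) : L0) = -(f : L0) := rfl
theorem coe_L2_smul (r : ℝ) (f : L2) : ((r • f : L2) : L0) = r • (f : L0) := rfl

theorem sub_mul_L0 (f g h : L0) : (f - g) * h = f * h - g * h := by
  apply AEEqFun.ext
  filter_upwards [AEEqFun.coeFn_mul (f - g) h, AEEqFun.coeFn_sub f g,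
    AEEqFun.coeFn_sub (f * h) (g * h), AEEqFun.coeFn_mul f h, AEEqFun.coeFn_mul g h]
    with x h1 h2 h3 h4 h5
  simp only [h1, h2, h3, h4, h5, Pi.mul_apply, Pi.sub_apply, sub_mul]

theorem smul_mul_L0 (r : ℝ) (f h : L0) : (r • f) * h = r • (f * h) := by
  apply AEEqFun.ext
  filter_upwards [AEEqFun.coeFn_mul (r • f) h, AEEqFun.coeFn_smul r f,
    AEEqFun.coeFn_smul r (f * h), AEEqFun.coeFn_mul f h] with x h1 h2 h3 h4
  simp only [h1, h2, h3, h4, Pi.mul_apply, Pi.smul_apply, smul_eq_mul, mul_assoc]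

theorem mul_incl_eq {V : L0} {u : ℝ →ᵇ ℝ} (h : ∀ᵐ x, V x = u x) (f : H2) :
    V * incl f = ((mulOp u f : L2) : L0) := by
  apply AEEqFun.ext
  filter_upwards [AEEqFun.coeFn_mul V (incl f), coeFn_mulOp u f, h] with x h1 h2 h3
  rw [h1, h2, Pi.mul_apply, h3]
  rfl

theorem opL1_eq {c : ℝ} {V : L0} {u : ℝ →ᵇ ℝ} (h : ∀ᵐ x, V x = u x) (f : H2) :
    opL1 c V f = ((-D2 f + c • (f : L2) - mulOp u f : L2) : L0) := by
  change -((D2 f : L2) : L0) + (c • (1 : L0) - V) * incl f = _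
  rw [sub_mul_L0, smul_mul_L0, one_mul, mul_incl_eq h, coe_L2_sub, coe_L2_add, coe_L2_neg,
    coe_L2_smul, add_sub_assoc]
  rfl

theorem opL2_eq {k Ω : ℝ} {V : L0} {u : ℝ →ᵇ ℝ} (h : ∀ᵐ x, V x = u x) (f : H2) :
    opL2 1 k Ω V f = (((2 / k) • (-D2 f - Ω • (f : L2) - k • mulOp u f) : L2) : L0) := by
  change (2 * 1 / k) • (-((D2 f : L2) : L0) + (-(Ω • (1 : L0)) - k • V) * incl f) = _
  rw [← neg_smul, sub_mul_L0, smul_mul_L0, smul_mul_L0, one_mul, mul_incl_eq h, coe_L2_smul,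
    coe_L2_sub, coe_L2_sub, coe_L2_neg, coe_L2_smul, coe_L2_smul, mul_one]
  congr 1
  change _ + (-Ω • ((f : L2) : L0) - _) = _
  rw [neg_smul]
  abel

/-- The eigenspaces of the Hessian are those of its realization in `(L²(ℝ))³`. -/
theorem eigenspace_hessian {k c Ω : ℝ} {U A : H2} {u α : ℝ →ᵇ ℝ}
    (hu : ∀ᵐ x, (U : L2) x = u x) (hα : ∀ᵐ x, (A : L2) x = α x) (lam : ℝ) :
    eigenspace (hessian 1 k c Ω U A) lam = eig (hessianL2 k c Ω u α) incl3 lam := by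
  have hinj : ∀ {f g : L2}, (f : L0) = (g : L0) → f = g := fun h => Subtype.ext h
  ext v
  have e : hessian 1 k c Ω U A v
      = (((-D2 v.1 + c • (v.1 : L2) - mulOp u v.1 - (2 : ℝ) • mulOp α v.2.1 : L2) : L0),
        ((-((2 : ℝ) • mulOp α v.1)
          + (2 / k) • (-D2 v.2.1 - Ω • (v.2.1 : L2) - k • mulOp u v.2.1) : L2) : L0),
        (((2 / k) • (-D2 v.2.2 - Ω • (v.2.2 : L2) - k • mulOp u v.2.2) : L2) : L0)) := by
    change (opL1 c (incl U) v.1 - (2 * 1 : ℝ) • (incl A * incl v.2.1),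
      -((2 * 1 : ℝ) • (incl A * incl v.1)) + opL2 1 k Ω (incl U) v.2.1,
      opL2 1 k Ω (incl U) v.2.2) = _
    rw [opL1_eq (V := incl U) hu, opL2_eq (V := incl U) hu, opL2_eq (V := incl U) hu,
      mul_incl_eq (V := incl A) hα, mul_incl_eq (V := incl A) hα, mul_one]
    rfl
  rw [mem_eig, hessianL2_apply, incl3_apply, smul_vec3]
  change hessian 1 k c Ω U A v = (lam • ((v.1 : L2) : L0), lam • ((v.2.1 : L2) : L0),
    lam • ((v.2.2 : L2) : L0)) ↔ _
  rw [e]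
  constructor
  · intro h
    obtain ⟨h1, h2⟩ := Prod.mk.inj h
    obtain ⟨h2, h3⟩ := Prod.mk.inj h2
    rw [hinj (g := lam • (v.1 : L2)) h1, hinj (g := lam • (v.2.1 : L2)) h2,
      hinj (g := lam • (v.2.2 : L2)) h3]
  · intro h
    obtain ⟨h1, h2, h3⟩ := vec3_inj h
    rw [h1, h2, h3]
    rfl

/-! ### The kernel of the Hessian -/

/-- The system, as a pair of equations in `L²(ℝ)`. -/
theorem IsProfile.eqs {k c Ω : ℝ} {U A : H2} (h : IsProfile 1 k c Ω U A) {u α : ℝ →ᵇ ℝ}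
    (hu : ∀ᵐ x, (U : L2) x = u x) (hα : ∀ᵐ x, (A : L2) x = α x) :
    (∀ᵐ x, D2 U x = c * u x - 1 / 2 * u x ^ 2 - α x ^ 2) ∧
      D2 A = -(Ω • (A : L2)) - k • mulOp u A := by
  obtain ⟨h1, h2⟩ := h
  constructor
  · have z := AEEqFun.coeFn_zero (α := ℝ) (β := ℝ) (μ := volume)
    rw [← h1] at z
    filter_upwards [z, hu, hα,
      AEEqFun.coeFn_add (((D2 U : L2) : L0) - c • incl U + (1 / 2 : ℝ) • incl U ^ 2)
        ((1 : ℝ) • incl A ^ 2),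
      AEEqFun.coeFn_add (((D2 U : L2) : L0) - c • incl U) ((1 / 2 : ℝ) • incl U ^ 2),
      AEEqFun.coeFn_sub ((D2 U : L2) : L0) (c • incl U), AEEqFun.coeFn_smul c (incl U),
      AEEqFun.coeFn_smul (1 / 2 : ℝ) (incl U ^ 2), AEEqFun.coeFn_smul (1 : ℝ) (incl A ^ 2),
      AEEqFun.coeFn_pow (incl U) 2, AEEqFun.coeFn_pow (incl A) 2]
      with x e0 e1 e2 e3 e4 e5 e6 e7 e8 e9 e10
    have e1' : (incl U : L0) x = u x := e1
    have e2' : (incl A : L0) x = α x := e2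
    rw [e3, Pi.add_apply, e4, Pi.add_apply, e5, Pi.sub_apply, e6, Pi.smul_apply, e7,
      Pi.smul_apply, e8, Pi.smul_apply, e9, e10, Pi.pow_apply, Pi.pow_apply, e1', e2'] at e0
    simp only [smul_eq_mul, Pi.zero_apply] at e0
    linarith
  · have h3 : ((D2 A : L2) : L0) - (-Ω • (1 : L0) - k • incl U) * incl A = 0 := by
      rw [← h2, sub_eq_add_neg]
      congr 1
      rw [← neg_one_smul ℝ (_ * _), ← smul_mul_L0]
      congr 1
      module
    rw [sub_mul_L0, smul_mul_L0, smul_mul_L0, one_mul, mul_incl_eq (V := incl U) hu,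
      sub_eq_zero] at h3
    rw [← neg_smul]
    exact Subtype.ext h3

theorem eq_zero_of_isWeakDeriv_zero {f : L2} (h : IsWeakDeriv f 0) : f = 0 := by
  obtain ⟨F, hF, e⟩ := h.exists_hasDerivAt (v := fun _ => 0) continuous_const
    (Lp.coeFn_zero ℝ 2 (volume : Measure ℝ))
  have hc : ∀ x, F x = F 0 := fun x =>
    is_const_of_deriv_eq_zero (fun y => (hF y).differentiableAt) (fun y => (hF y).deriv) x 0
  have hm : MemLp (fun _ : ℝ => F 0) 2 volume := (Lp.memLp f).ae_eq (by
    filter_upwards [e] with x hx; rw [hx, hc])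
  rw [memLp_const_iff (by norm_num) (by norm_num)] at hm
  have h0 : F 0 = 0 := hm.resolve_right (by simp)
  apply Lp.ext
  filter_upwards [e, Lp.coeFn_zero ℝ 2 (volume : Measure ℝ)] with x h1 h2
  rw [h1, h2, hc, h0, Pi.zero_apply]

/-- The kernel of the Hessian at a profile contains `(U', A', 0)` and `(0, 0, A)`, which reflect
the invariance of the system under translations and phase rotations. -/
theorem two_le_rank_ker {k c Ω : ℝ} (hk : k ≠ 0) {U A : H2} (h : IsProfile 1 k c Ω U A)
    (hA : A ≠ 0) {u u' α α' : ℝ →ᵇ ℝ} (hu : ∀ᵐ x, (U : L2) x = u x)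
    (hα : ∀ᵐ x, (A : L2) x = α x) (du : ∀ x, HasDerivAt u (u' x) x)
    (dα : ∀ x, HasDerivAt α (α' x) x) (hu' : ∀ᵐ x, D1 U x = u' x)
    (hα' : ∀ᵐ x, D1 A x = α' x) :
    2 ≤ Module.rank ℝ (eig (hessianL2 k c Ω u α) incl3 0) := by
  obtain ⟨e1, e2⟩ := h.eqs hu hα
  have e2' : ∀ᵐ x, D2 A x = -Ω * α x - k * (u x * α x) := by
    rw [e2]
    filter_upwards [Lp.coeFn_sub (-(Ω • (A : L2))) (k • mulOp u A), Lp.coeFn_neg (Ω • (A : L2)),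
      Lp.coeFn_smul Ω (A : L2), Lp.coeFn_smul k (mulOp u A), coeFn_mulOp u (A : L2), hα]
      with x h1 h2 h3 h4 h5 h6
    rw [h1, Pi.sub_apply, h2, Pi.neg_apply, h3, Pi.smul_apply, h4, Pi.smul_apply, h5, h6,
      smul_eq_mul, smul_eq_mul, neg_mul]
  -- the third derivatives, obtained by differentiating the system
  have wU : IsWeakDeriv (D2 U) (c • D1 U - mulOp u (D1 U) - (2 : ℝ) • mulOp α (D1 A)) := by
    refine isWeakDeriv_of_hasDerivAt (F := fun x => c * u x - 1 / 2 * u x ^ 2 - α x ^ 2)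
      (F' := fun x => c * u' x - u x * u' x - 2 * (α x * α' x)) (fun x => ?_) e1 ?_
    · refine ((((du x).const_mul c).sub (((du x).pow 2).const_mul (1 / 2))).sub
        ((dα x).pow 2)).congr_deriv ?_
      norm_num
      ring
    · filter_upwards [Lp.coeFn_sub (c • D1 U - mulOp u (D1 U)) ((2 : ℝ) • mulOp α (D1 A)),
        Lp.coeFn_sub (c • D1 U) (mulOp u (D1 U)), Lp.coeFn_smul c (D1 U),
        Lp.coeFn_smul (2 : ℝ) (mulOp α (D1 A)), coeFn_mulOp u (D1 U), coeFn_mulOp α (D1 A),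
        hu', hα'] with x h1 h2 h3 h4 h5 h6 h7 h8
      rw [h1, Pi.sub_apply, h2, Pi.sub_apply, h3, Pi.smul_apply, h4, Pi.smul_apply, h5, h6, h7,
        h8, smul_eq_mul, smul_eq_mul]
  have wA : IsWeakDeriv (D2 A) (-(Ω • D1 A) - k • (mulOp α (D1 U) + mulOp u (D1 A))) := by
    refine isWeakDeriv_of_hasDerivAt (F := fun x => -Ω * α x - k * (u x * α x))
      (F' := fun x => -(Ω * α' x) - k * (α x * u' x + u x * α' x)) (fun x => ?_) e2' ?_
    · refine (((dα x).const_mul (-Ω)).sub (((du x).mul (dα x)).const_mul k)).congr_deriv ?_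
      ring
    · filter_upwards [Lp.coeFn_sub (-(Ω • D1 A)) (k • (mulOp α (D1 U) + mulOp u (D1 A))),
        Lp.coeFn_neg (Ω • D1 A), Lp.coeFn_smul Ω (D1 A),
        Lp.coeFn_smul k (mulOp α (D1 U) + mulOp u (D1 A)),
        Lp.coeFn_add (mulOp α (D1 U)) (mulOp u (D1 A)), coeFn_mulOp α (D1 U),
        coeFn_mulOp u (D1 A), hu', hα'] with x h1 h2 h3 h4 h5 h6 h7 h8 h9
      rw [h1, Pi.sub_apply, h2, Pi.neg_apply, h3, Pi.smul_apply, h4, Pi.smul_apply, h5,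
        Pi.add_apply, h6, h7, h8, h9, smul_eq_mul, smul_eq_mul]
  let U₁ : H2 := ⟨D1 U, _, _, isWeakDeriv_D2 U, wU⟩
  let A₁ : H2 := ⟨D1 A, _, _, isWeakDeriv_D2 A, wA⟩
  have dU₁ : D2 U₁ = _ := D2_eq (f := U₁) (isWeakDeriv_D2 U) wU
  have dA₁ : D2 A₁ = _ := D2_eq (f := A₁) (isWeakDeriv_D2 A) wA
  have k1 : ((U₁, A₁, 0) : H2x3) ∈ eig (hessianL2 k c Ω u α) incl3 0 := by
    rw [mem_eig, zero_smul, hessianL2_apply]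
    have c1 : -D2 U₁ + c • (U₁ : L2) - mulOp u U₁ - (2 : ℝ) • mulOp α A₁ = 0 := by
      rw [dU₁]
      change -(_ : L2) + c • D1 U - mulOp u (D1 U) - (2 : ℝ) • mulOp α (D1 A) = 0
      abel
    have c2 : -((2 : ℝ) • mulOp α U₁) + (2 / k) • (-D2 A₁ - Ω • (A₁ : L2) - k • mulOp u A₁)
        = 0 := by
      rw [dA₁]
      change -((2 : ℝ) • mulOp α (D1 U))
        + (2 / k) • (-(_ : L2) - Ω • D1 A - k • mulOp u (D1 A)) = 0
      have : -(-(Ω • D1 A) - k • (mulOp α (D1 U) + mulOp u (D1 A))) - Ω • D1 A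
          - k • mulOp u (D1 A) = k • mulOp α (D1 U) := by module
      rw [this, smul_smul, div_mul_cancel₀ _ hk, neg_add_cancel]
    dsimp only
    rw [c1, c2]
    simp only [ZeroMemClass.coe_zero, map_zero, smul_zero, neg_zero, sub_zero]
    ext i : 1
    fin_cases i <;> rfl
  have k2 : ((0, 0, A) : H2x3) ∈ eig (hessianL2 k c Ω u α) incl3 0 := by
    rw [mem_eig, zero_smul, hessianL2_apply]
    have c3 : -D2 A - Ω • (A : L2) - k • mulOp u A = 0 := by
      rw [e2]; abel
    dsimp only
    rw [c3]
    simp only [ZeroMemClass.coe_zero, map_zero, smul_zero, neg_zero, sub_zero, add_zero]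
    ext i : 1
    fin_cases i <;> rfl
  have hA₁ : A₁ ≠ 0 := fun h0 => by
    have h1 : D1 A = 0 := congrArg Subtype.val h0
    have h2 := isWeakDeriv_D1 A
    rw [h1] at h2
    exact hA (Subtype.ext (eq_zero_of_isWeakDeriv_zero h2))
  have hli : LinearIndependent ℝ
      ![(⟨_, k1⟩ : eig (hessianL2 k c Ω u α) incl3 0), ⟨_, k2⟩] := by
    rw [LinearIndependent.pair_iff]
    intro x y hxy
    have h1 := congrArg Subtype.val hxy
    have h2 : x • U₁ + y • (0 : H2) = 0 ∧ x • A₁ + y • (0 : H2) = 0 ∧ x • (0 : H2) + y • A = 0 :=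
      ⟨congrArg Prod.fst h1, congrArg (fun v : H2x3 => v.2.1) h1,
        congrArg (fun v : H2x3 => v.2.2) h1⟩
    obtain ⟨-, h3, h4⟩ := h2
    rw [smul_zero, add_zero, smul_eq_zero] at h3
    rw [smul_zero, zero_add, smul_eq_zero] at h4
    exact ⟨h3.resolve_right hA₁, h4.resolve_right hA⟩
  simpa using hli.cardinal_le_rank

/-! ### The quadratic form near the bifurcation point -/

/-- The form `⟨(-∂² + μ - ν sech²(a x)) f, f⟩`. -/
def wellForm (a μ ν : ℝ) (f : H2) : ℝ :=
  ‖D1 f‖ ^ 2 + μ * ‖(f : L2)‖ ^ 2 - ν * inner ℝ (mulOp (sechSqB a) f) (f : L2)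

theorem norm_ladder_sq_eq_wellForm (a q : ℝ) (f : H2) :
    ‖D1 f + (q * a) • mulOp (tanhB a) f‖ ^ 2
      = wellForm a (q ^ 2 * a ^ 2) (q * (q + 1) * a ^ 2) f :=
  norm_ladder_sq (isWeakDeriv_D1 f) a q

theorem inner_eq_wellForm (a μ ν : ℝ) (f : H2) :
    inner ℝ (-D2 f + μ • (f : L2) - ν • mulOp (sechSqB a) f) (f : L2) = wellForm a μ ν f := by
  rw [wellForm, inner_sub_left, inner_add_left, inner_neg_left, inner_D2_left, inner_smul_left,
    inner_smul_left, real_inner_self_eq_norm_sq, real_inner_self_eq_norm_sq, RCLike.conj_to_real,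
    neg_neg, RCLike.conj_to_real]

/-- The form of the Hessian at the bifurcation point. -/
def limitForm (a p k : ℝ) (v : H2x3) : ℝ :=
  wellForm a (4 * a ^ 2) (12 * a ^ 2) v.1
    + (2 / k) * (wellForm a (p ^ 2 * a ^ 2) (p * (p + 1) * a ^ 2) v.2.1
      + wellForm a (p ^ 2 * a ^ 2) (p * (p + 1) * a ^ 2) v.2.2)

theorem norm_incl3_sq (v : H2x3) :
    ‖incl3 v‖ ^ 2 = ‖(v.1 : L2)‖ ^ 2 + ‖(v.2.1 : L2)‖ ^ 2 + ‖(v.2.2 : L2)‖ ^ 2 := by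
  rw [← real_inner_self_eq_norm_sq, incl3_apply, inner_vec3]
  simp only [real_inner_self_eq_norm_sq]

/-- The form of the limiting Hessian is positive definite on a subspace of codimension four. -/
theorem exists_limitForm_gap {a p k : ℝ} (ha : 0 < a) (hp : 0 < p) (hk : 0 < k) :
    ∃ δ : ℝ, 0 < δ ∧ ∀ v : H2x3, inner ℝ (sechLp ha three_pos) (v.1 : L2) = 0 →
      inner ℝ (mulOp (tanhB a) (sechLp ha two_pos)) (v.1 : L2) = 0 →
      inner ℝ (sechLp ha hp) (v.2.1 : L2) = 0 → inner ℝ (sechLp ha hp) (v.2.2 : L2) = 0 →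
      δ * ‖incl3 v‖ ^ 2 ≤ limitForm a p k v := by
  obtain ⟨δ₁, h₁, g₁⟩ := exists_gap_three ha
  obtain ⟨δ₂, h₂, g₂⟩ := exists_gap ha hp
  have hk2 : 0 < 2 / k := by positivity
  refine ⟨min δ₁ (2 / k * δ₂), by positivity, fun v e1 e2 e3 e4 => ?_⟩
  have b1 := g₁ _ _ (isWeakDeriv_D1 v.1) e1 e2
  have b2 := g₂ _ _ (isWeakDeriv_D1 v.2.1) e3
  have b3 := g₂ _ _ (isWeakDeriv_D1 v.2.2) e4
  rw [norm_ladder_sq_eq_wellForm] at b1 b2 b3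
  have b1' : δ₁ * ‖(v.1 : L2)‖ ^ 2 ≤ wellForm a (4 * a ^ 2) (12 * a ^ 2) v.1 := by
    unfold wellForm at b1 ⊢
    linarith
  rw [limitForm, norm_incl3_sq]
  have m1 := mul_le_mul_of_nonneg_right (min_le_left δ₁ (2 / k * δ₂)) (sq_nonneg ‖(v.1 : L2)‖)
  have m2 := mul_le_mul_of_nonneg_right (min_le_right δ₁ (2 / k * δ₂)) (sq_nonneg ‖(v.2.1 : L2)‖)
  have m3 := mul_le_mul_of_nonneg_right (min_le_right δ₁ (2 / k * δ₂)) (sq_nonneg ‖(v.2.2 : L2)‖)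
  have n2 := mul_le_mul_of_nonneg_left b2 hk2.le
  have n3 := mul_le_mul_of_nonneg_left b3 hk2.le
  nlinarith

theorem abs_inner_mulOp_le (V : ℝ →ᵇ ℝ) (f g : L2) :
    |inner ℝ (mulOp V f) g| ≤ ‖V‖ * ‖f‖ * ‖g‖ :=
  (abs_real_inner_le_norm _ _).trans
    (mul_le_mul_of_nonneg_right (norm_mulOp_le V f) (norm_nonneg _))

theorem mulOp_add (V W : ℝ →ᵇ ℝ) (f : L2) : mulOp (V + W) f = mulOp V f + mulOp W f := by
  apply Lp.ext
  filter_upwards [coeFn_mulOp V f, coeFn_mulOp W f, coeFn_mulOp (V + W) f,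
    Lp.coeFn_add (mulOp V f) (mulOp W f)] with x h1 h2 h3 h4
  rw [h4, h3, Pi.add_apply, h1, h2, BoundedContinuousFunction.add_apply, add_mul]

theorem mulOp_smul (r : ℝ) (V : ℝ →ᵇ ℝ) (f : L2) : mulOp (r • V) f = r • mulOp V f := by
  apply Lp.ext
  filter_upwards [coeFn_mulOp V f, coeFn_mulOp (r • V) f, Lp.coeFn_smul r (mulOp V f)]
    with x h1 h2 h3
  rw [h3, h2, Pi.smul_apply, h1, smul_eq_mul]
  exact mul_assoc r (V x) _

/-- The difference between the form of the Hessian and its limit is of the order of the distance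
to the bifurcation point. -/
theorem abs_inner_hessianL2_sub_limitForm_le {a p k : ℝ} (hk : 0 < k)
    (hpk : p * (p + 1) = 12 * k) {ε σ : ℝ} {W α : ℝ →ᵇ ℝ} (hσ : |σ| ≤ ε) (hW : ‖W‖ ≤ 2 * ε)
    (hα : ‖α‖ ≤ 2 * ε) (v : H2x3) :
    |inner ℝ (hessianL2 k (4 * a ^ 2) (-(p ^ 2 * a ^ 2) + σ) ((12 * a ^ 2) • sechSqB a + W) α v)
      (incl3 v) - limitForm a p k v| ≤ (8 + 2 / k) * ε * ‖incl3 v‖ ^ 2 := by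
  obtain ⟨w, z₁, z₂⟩ := v
  have hε : 0 ≤ ε := (abs_nonneg σ).trans hσ
  have hk2 : 0 < 2 / k := by positivity
  have e : inner ℝ (hessianL2 k (4 * a ^ 2) (-(p ^ 2 * a ^ 2) + σ)
      ((12 * a ^ 2) • sechSqB a + W) α (w, z₁, z₂)) (incl3 (w, z₁, z₂))
      - limitForm a p k (w, z₁, z₂)
      = -inner ℝ (mulOp W w) (w : L2) - 4 * inner ℝ (mulOp α w) (z₁ : L2)
        - (2 / k) * σ * (‖(z₁ : L2)‖ ^ 2 + ‖(z₂ : L2)‖ ^ 2)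
        - 2 * (inner ℝ (mulOp W z₁) (z₁ : L2) + inner ℝ (mulOp W z₂) (z₂ : L2)) := by
    rw [hessianL2_apply, incl3_apply, inner_vec3]
    simp only [mulOp_add, mulOp_smul, limitForm, wellForm, inner_add_left, inner_sub_left,
      inner_neg_left, inner_smul_left, RCLike.conj_to_real, inner_D2_left,
      real_inner_self_eq_norm_sq]
    rw [show inner ℝ (mulOp α z₁) (w : L2) = inner ℝ (mulOp α w) (z₁ : L2) by
      rw [real_inner_comm, inner_mulOp_comm], hpk]
    field_simp
    ring
  rw [e, norm_incl3_sq]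
  dsimp only
  have b1 := abs_le.1 (abs_inner_mulOp_le W (w : L2) w)
  have b2 := abs_le.1 (abs_inner_mulOp_le α (w : L2) z₁)
  have b3 := abs_le.1 (abs_inner_mulOp_le W (z₁ : L2) z₁)
  have b4 := abs_le.1 (abs_inner_mulOp_le W (z₂ : L2) z₂)
  set x := ‖(w : L2)‖
  set y := ‖(z₁ : L2)‖
  set z := ‖(z₂ : L2)‖
  have hx : 0 ≤ x := norm_nonneg _
  have hy : 0 ≤ y := norm_nonneg _
  have hz : 0 ≤ z := norm_nonneg _
  have c1 : ‖W‖ * x * x ≤ 2 * ε * x ^ 2 := by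
    nlinarith [mul_le_mul_of_nonneg_right hW (mul_nonneg hx hx)]
  have c2 : ‖α‖ * x * y ≤ ε * (x ^ 2 + y ^ 2) := by
    nlinarith [mul_le_mul_of_nonneg_right hα (mul_nonneg hx hy),
      mul_nonneg hε (sq_nonneg (x - y))]
  have c3 : ‖W‖ * y * y ≤ 2 * ε * y ^ 2 := by
    nlinarith [mul_le_mul_of_nonneg_right hW (mul_nonneg hy hy)]
  have c4 : ‖W‖ * z * z ≤ 2 * ε * z ^ 2 := by
    nlinarith [mul_le_mul_of_nonneg_right hW (mul_nonneg hz hz)]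
  have c5 : |2 / k * σ * (y ^ 2 + z ^ 2)| ≤ 2 / k * ε * (y ^ 2 + z ^ 2) := by
    rw [abs_mul, abs_mul, abs_of_pos hk2, abs_of_nonneg (add_nonneg (sq_nonneg y) (sq_nonneg z))]
    gcongr
  have c5' := abs_le.1 c5
  have c6 : 0 ≤ 2 / k * ε * x ^ 2 := by positivity
  have c7 : 0 ≤ ε * x ^ 2 := by positivity
  have c8 : 0 ≤ ε * y ^ 2 := by positivity
  have c9 : 0 ≤ ε * z ^ 2 := by positivity
  rw [abs_le]
  constructor
  · linarith [b1.2, b2.2, b3.2, b4.2, c5'.2]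
  · linarith [b1.1, b2.1, b3.1, b4.1, c5'.1]

/-! ### Asymptotics of the branch -/

theorem norm_le_two_mul_of_rep {f : H2} {F : ℝ →ᵇ ℝ} {ε : ℝ}
    (hF : ‖F‖ ^ 2 ≤ 2 * ‖(f : L2)‖ ^ 2 + 2 * ‖D1 f‖ ^ 2) (hf : h2Norm f < ε) : ‖F‖ ≤ 2 * ε := by
  have h0 : 0 ≤ h2Norm f := Real.sqrt_nonneg _
  have h1 : h2Norm f ^ 2 = ‖(f : L2)‖ ^ 2 + ‖D1 f‖ ^ 2 + ‖D2 f‖ ^ 2 :=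
    Real.sq_sqrt (by positivity)
  refine abs_le_of_sq_le_sq' ?_ (by linarith) |>.2
  nlinarith [sq_nonneg ‖D2 f‖, sq_nonneg ‖(f : L2)‖, sq_nonneg ‖D1 f‖]

theorem sechLp_ne_zero {a q : ℝ} (ha : 0 < a) (hq : 0 < q) : sechLp ha hq ≠ 0 := fun h0 => by
  have h1 : ∀ᵐ x : ℝ, False := by
    filter_upwards [coeFn_sechLp ha hq, Lp.coeFn_zero ℝ 2 (volume : Measure ℝ)] with x h1 h2
    rw [h0, h2] at h1
    exact (sechPow_pos a q x).ne h1
  exact h1.exists.elim fun _ h => h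

/-- Energy bound for solutions of the second equation at a profile `U = 12 a² sech² + W` with
`Ω = -p² a² + σ`. -/
theorem norm_D1_sq_le {a p k : ℝ} (hk : 0 ≤ k) {σ : ℝ} {W : ℝ →ᵇ ℝ} {A : H2} (hσ : |σ| ≤ 1)
    (hW : ‖W‖ ≤ 2)
    (hA : D2 A = -((-(p ^ 2 * a ^ 2) + σ) • (A : L2))
      - k • mulOp ((12 * a ^ 2) • sechSqB a + W) A) :
    ‖D1 A‖ ^ 2 ≤ (p ^ 2 * a ^ 2 + 1 + k * (12 * a ^ 2 * ‖sechSqB a‖ + 2)) * ‖(A : L2)‖ ^ 2 := by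
  have h2 : ‖D1 A‖ ^ 2 = inner ℝ (-D2 A) (A : L2) := by
    rw [inner_neg_left, inner_D2_left, neg_neg, real_inner_self_eq_norm_sq]
  have h3 : inner ℝ (-D2 A) (A : L2) = (-(p ^ 2 * a ^ 2) + σ) * ‖(A : L2)‖ ^ 2
      + k * (12 * a ^ 2 * inner ℝ (mulOp (sechSqB a) A) (A : L2)
        + inner ℝ (mulOp W A) (A : L2)) := by
    rw [hA, mulOp_add, mulOp_smul]
    simp only [inner_neg_left, inner_sub_left, inner_smul_left, inner_add_left,
      RCLike.conj_to_real, real_inner_self_eq_norm_sq]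
    ring
  have b1 := (abs_le.1 (abs_inner_mulOp_le (sechSqB a) (A : L2) A)).2
  have b2 := (abs_le.1 (abs_inner_mulOp_le W (A : L2) A)).2
  rw [h2, h3]
  set n := ‖(A : L2)‖ ^ 2 with hn
  have hn0 : 0 ≤ n := sq_nonneg _
  have b4 : ‖W‖ * ‖(A : L2)‖ * ‖(A : L2)‖ ≤ 2 * n := by
    rw [mul_assoc, ← pow_two, ← hn]
    exact mul_le_mul_of_nonneg_right hW hn0
  have b5 : σ * n ≤ 1 * n := mul_le_mul_of_nonneg_right ((le_abs_self σ).trans hσ) hn0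
  have b6 : 12 * a ^ 2 * inner ℝ (mulOp (sechSqB a) A) (A : L2)
      ≤ 12 * a ^ 2 * (‖sechSqB a‖ * n) :=
    mul_le_mul_of_nonneg_left (by rwa [mul_assoc, ← pow_two] at b1) (by positivity)
  have b7 := mul_le_mul_of_nonneg_left (add_le_add b6 (b2.trans b4)) hk
  have b8 : 0 ≤ p ^ 2 * a ^ 2 * n := by positivity
  linarith

/-- Along the branch, the second component is `t sech^p` up to an error of higher order: the part
`r` orthogonal to `sech^p` is controlled by the spectral gap, as the second equation says that the
limiting operator maps `A` to `σ A + k W A`, which is `O(ε ‖A‖)`. -/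
theorem exists_amplitude {a p k : ℝ} (ha : 0 < a) (hp : 0 < p) (hk : 0 < k)
    (hpk : p * (p + 1) = 12 * k) :
    ∃ C ε₀ : ℝ, 0 ≤ C ∧ 0 < ε₀ ∧ ∀ ε ≤ ε₀, ∀ σ : ℝ, ∀ W : ℝ →ᵇ ℝ, ∀ A : H2, A ≠ 0 → |σ| ≤ ε →
      ‖W‖ ≤ 2 * ε →
      D2 A = -((-(p ^ 2 * a ^ 2) + σ) • (A : L2)) - k • mulOp ((12 * a ^ 2) • sechSqB a + W) A →
      ∃ t : ℝ, t ≠ 0 ∧ inner ℝ (sechLp ha hp) ((A : L2) - t • sechLp ha hp) = 0 ∧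
        ‖(A : L2) - t • sechLp ha hp‖ ≤ C * ε * |t| ∧
        2 * ‖(A : L2)‖ ^ 2 + 2 * ‖D1 A‖ ^ 2 ≤ (C * |t|) ^ 2 := by
  obtain ⟨δ, hδ, hgap⟩ := exists_gap ha hp
  obtain ⟨gH, hgH, -, hg2⟩ := exists_H2_sechLp ha hp
  set g := sechLp ha hp with hg
  have hg0 : 0 < ‖g‖ := norm_pos_iff.2 (sechLp_ne_zero ha hp)
  set B := 1 + 2 * k with hB
  set K := p ^ 2 * a ^ 2 + 1 + k * (12 * a ^ 2 * ‖sechSqB a‖ + 2) with hK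
  have hB0 : 0 < B := by positivity
  have hK0 : 0 < K := by positivity
  have hC2 : 0 ≤ √(8 * (1 + K)) * ‖g‖ := by positivity
  have hC1 : 0 ≤ 2 * B * ‖g‖ / δ := by positivity
  refine ⟨2 * B * ‖g‖ / δ + √(8 * (1 + K)) * ‖g‖, min 1 (δ / (2 * B)), add_nonneg hC1 hC2,
    by positivity, ?_⟩
  intro ε hε₀ σ W A hA hσ hW hA2
  have hε : 0 ≤ ε := (abs_nonneg σ).trans hσ
  have hε1 : ε ≤ 1 := hε₀.trans (min_le_left _ _)
  have hεδ : B * ε ≤ δ / 2 := by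
    have := hε₀.trans (min_le_right _ _)
    rw [le_div_iff₀ (by positivity)] at this
    linarith
  set t := inner ℝ g (A : L2) / ‖g‖ ^ 2 with ht
  have horth : inner ℝ g ((A : L2) - t • g) = 0 := by
    rw [inner_sub_right, inner_smul_right, real_inner_self_eq_norm_sq, ht,
      div_mul_cancel₀ _ (by positivity), sub_self]
  set r : H2 := A - t • gH with hr
  have hrc : (r : L2) = (A : L2) - t • g := by rw [hr, ← hgH]; rfl
  rw [← hrc] at horth
  have hgAop : -D2 A + (p ^ 2 * a ^ 2) • (A : L2) - (p * (p + 1) * a ^ 2) • mulOp (sechSqB a) A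
      = σ • (A : L2) + k • mulOp W A := by
    rw [hA2, mulOp_add, mulOp_smul, hpk]
    module
  have hrop : -D2 r + (p ^ 2 * a ^ 2) • (r : L2) - (p * (p + 1) * a ^ 2) • mulOp (sechSqB a) r
      = σ • (A : L2) + k • mulOp W A := by
    rw [← hgAop, hrc, hr, map_sub, map_smul, hg2, map_sub, map_smul]
    module
  -- test the equation for `r` with `r` and apply the gap
  have hsmall : δ * ‖(r : L2)‖ ≤ B * ε * ‖(A : L2)‖ := by
    rcases (norm_nonneg (r : L2)).eq_or_lt with h0 | h0
    · rw [← h0, mul_zero]; positivity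
    refine le_of_mul_le_mul_right ?_ h0
    have h1 := hgap _ _ (isWeakDeriv_D1 r) horth
    rw [norm_ladder_sq_eq_wellForm, ← inner_eq_wellForm, hrop] at h1
    have h2 := real_inner_le_norm (σ • (A : L2) + k • mulOp W A) (r : L2)
    have h3 : ‖σ • (A : L2) + k • mulOp W A‖ ≤ B * ε * ‖(A : L2)‖ := by
      refine (norm_add_le _ _).trans ?_
      rw [norm_smul, norm_smul, Real.norm_eq_abs, Real.norm_eq_abs, abs_of_pos hk]
      have h4 := norm_mulOp_le W A
      have h5 := mul_le_mul_of_nonneg_right hW (norm_nonneg (A : L2))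
      have h6 := mul_le_mul_of_nonneg_right hσ (norm_nonneg (A : L2))
      have h7 := mul_le_mul_of_nonneg_left (h4.trans h5) hk.le
      rw [hB]
      linarith
    have h4 := mul_le_mul_of_nonneg_right h3 h0.le
    nlinarith
  have hAr : ‖(A : L2)‖ ≤ |t| * ‖g‖ + ‖(r : L2)‖ := by
    have : (A : L2) = t • g + r := by rw [hrc]; abel
    calc ‖(A : L2)‖ = ‖t • g + (r : L2)‖ := by rw [← this]
      _ ≤ ‖t • g‖ + ‖(r : L2)‖ := norm_add_le _ _
      _ = _ := by rw [norm_smul, Real.norm_eq_abs]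
  have hhalf : ‖(r : L2)‖ ≤ ‖(A : L2)‖ / 2 := by
    refine le_of_mul_le_mul_left ?_ hδ
    have := mul_le_mul_of_nonneg_right hεδ (norm_nonneg (A : L2))
    linarith
  have hA2t : ‖(A : L2)‖ ≤ 2 * (|t| * ‖g‖) := by linarith
  have hApos : 0 < ‖(A : L2)‖ := norm_pos_iff.2 fun h => hA (Subtype.ext h)
  have ht0 : t ≠ 0 := by
    intro h
    rw [h, abs_zero, zero_mul, mul_zero] at hA2t
    linarith
  refine ⟨t, ht0, hrc ▸ horth, ?_, ?_⟩
  · rw [← hrc]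
    have h1 : ‖(r : L2)‖ ≤ 2 * B * ‖g‖ / δ * ε * |t| := by
      have e : 2 * B * ‖g‖ / δ * ε * |t| = (B * ε * (2 * (|t| * ‖g‖))) / δ := by ring
      rw [e, le_div_iff₀ hδ]
      have := mul_le_mul_of_nonneg_left hA2t (mul_nonneg hB0.le hε)
      linarith
    have h2 : 0 ≤ √(8 * (1 + K)) * ‖g‖ * ε * |t| := by positivity
    calc _ ≤ _ := h1
      _ ≤ _ := by rw [add_mul, add_mul]; linarith
  · have h1 : ‖D1 A‖ ^ 2 ≤ K * ‖(A : L2)‖ ^ 2 :=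
      norm_D1_sq_le hk.le (hσ.trans hε1) (by linarith) hA2
    calc 2 * ‖(A : L2)‖ ^ 2 + 2 * ‖D1 A‖ ^ 2 ≤ 2 * (1 + K) * ‖(A : L2)‖ ^ 2 := by linarith
      _ ≤ 2 * (1 + K) * (2 * (|t| * ‖g‖)) ^ 2 := by gcongr
      _ = (√(8 * (1 + K)) * ‖g‖ * |t|) ^ 2 := by
          linear_combination (-(‖g‖ ^ 2 * |t| ^ 2)) *
            Real.sq_sqrt (by positivity : 0 ≤ 8 * (1 + K))
      _ ≤ _ := by
          refine pow_le_pow_left₀ (by positivity) ?_ 2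
          rw [add_mul]
          linarith [mul_nonneg hC1 (abs_nonneg t)]

/-- The bounded continuous function `sech^q(a x)`. -/
def sechB (a : ℝ) {q : ℝ} (hq : 0 < q) : ℝ →ᵇ ℝ :=
  .ofNormedAddCommGroup (sechPow a q) (continuous_sechPow a q) 1 fun x => by
    rw [Real.norm_of_nonneg (sechPow_pos a q x).le]; exact sechPow_le_one hq.le x

theorem norm_sechB_le (a : ℝ) {q : ℝ} (hq : 0 < q) : ‖sechB a hq‖ ≤ 1 :=
  BoundedContinuousFunction.norm_ofNormedAddCommGroup_le _ zero_le_one _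

/-- Along the branch, `A² = t² g²` up to an error of higher order. -/
theorem norm_sq_sub_le {a p : ℝ} (ha : 0 < a) (hp : 0 < p) {A : H2} {α : ℝ →ᵇ ℝ}
    (hα : ∀ᵐ x, (A : L2) x = α x) {t C ε : ℝ} (hC : 0 ≤ C) (hαC : ‖α‖ ≤ C * |t|)
    (hr : ‖(A : L2) - t • sechLp ha hp‖ ≤ C * ε * |t|) :
    ‖mulOp α A - t ^ 2 • mulOp (sechB a hp) (sechLp ha hp)‖ ≤ (C + 1) * C * ε * t ^ 2 := by
  set g := sechLp ha hp with hg
  have hswap : mulOp α g = mulOp (sechB a hp) A := by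
    apply Lp.ext
    filter_upwards [coeFn_mulOp α g, coeFn_mulOp (sechB a hp) A, coeFn_sechLp ha hp, hα]
      with x h1 h2 h3 h4
    rw [h1, h2, hg, h3, h4, mul_comm]
    rfl
  have e : mulOp α A - t ^ 2 • mulOp (sechB a hp) g
      = mulOp α ((A : L2) - t • g) + t • mulOp (sechB a hp) ((A : L2) - t • g) := by
    simp only [map_sub, map_smul, hswap]
    module
  rw [e]
  set r := (A : L2) - t • g
  have h1 : ‖mulOp α r‖ ≤ C * |t| * ‖r‖ :=
    (norm_mulOp_le α r).trans (mul_le_mul_of_nonneg_right hαC (norm_nonneg _))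
  have h2 : ‖t • mulOp (sechB a hp) r‖ ≤ |t| * ‖r‖ := by
    rw [norm_smul, Real.norm_eq_abs]
    refine mul_le_mul_of_nonneg_left ((norm_mulOp_le _ r).trans ?_) (abs_nonneg t)
    exact (mul_le_mul_of_nonneg_right (norm_sechB_le a hp) (norm_nonneg _)).trans_eq (one_mul _)
  calc _ ≤ C * |t| * ‖r‖ + |t| * ‖r‖ := (norm_add_le _ _).trans (add_le_add h1 h2)
    _ = (C + 1) * |t| * ‖r‖ := by ring
    _ ≤ (C + 1) * |t| * (C * ε * |t|) :=
        mul_le_mul_of_nonneg_left hr (by positivity)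
    _ = (C + 1) * C * ε * t ^ 2 := by rw [← sq_abs t]; ring

/-- The direction `(2 t² η, A, 0)`, with `η = L₁⁻¹ g²`, in which the degenerate eigenvalue of the
limiting Hessian splits: the form of the Hessian there is `-4 t⁴ ⟨g², η⟩` to leading order, and its
coupling with any other direction is of higher order. -/
theorem exists_critical_direction {a p k : ℝ} (ha : 0 < a) (hp : 0 < p) (hk : 0 < k)
    (hpk : p * (p + 1) = 12 * k) (η : H2)
    (hη : -D2 η + (4 * a ^ 2) • (η : L2) - (12 * a ^ 2) • mulOp (sechSqB a) η
      = mulOp (sechB a hp) (sechLp ha hp)) :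
    ∃ C ε₀ : ℝ, 0 ≤ C ∧ 0 < ε₀ ∧ ∀ ε ≤ ε₀, ∀ (σ : ℝ) (W α : ℝ →ᵇ ℝ) (A : H2), A ≠ 0 →
      |σ| ≤ ε → ‖W‖ ≤ 2 * ε → ‖α‖ ≤ 2 * ε → (∀ᵐ x, (A : L2) x = α x) →
      ‖α‖ ^ 2 ≤ 2 * ‖(A : L2)‖ ^ 2 + 2 * ‖D1 A‖ ^ 2 →
      D2 A = -((-(p ^ 2 * a ^ 2) + σ) • (A : L2)) - k • mulOp ((12 * a ^ 2) • sechSqB a + W) A →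
      ∃ t : ℝ, t ≠ 0 ∧ ∃ e : H2x3, inner ℝ (sechLp ha hp) (e.2.1 : L2) ≠ 0 ∧ e.2.2 = 0 ∧
        |inner ℝ (hessianL2 k (4 * a ^ 2) (-(p ^ 2 * a ^ 2) + σ)
            ((12 * a ^ 2) • sechSqB a + W) α e) (incl3 e)
          + 4 * t ^ 4 * inner ℝ (mulOp (sechB a hp) (sechLp ha hp)) (η : L2)| ≤ C * ε * t ^ 4 ∧
        ∀ v, |inner ℝ (hessianL2 k (4 * a ^ 2) (-(p ^ 2 * a ^ 2) + σ)
            ((12 * a ^ 2) • sechSqB a + W) α e) (incl3 v)| ≤ C * ε * t ^ 2 * ‖incl3 v‖ := by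
  obtain ⟨C₁, ε₀, hC₁, hε₀, hamp⟩ := exists_amplitude ha hp hk hpk
  set g := sechLp ha hp with hg
  set G := mulOp (sechB a hp) g with hG
  set n := ‖(η : L2)‖ with hn
  have hn0 : 0 ≤ n := norm_nonneg _
  set Cd := (C₁ + 1) * C₁ with hCd
  have hCd0 : 0 ≤ Cd := by positivity
  set Cρ := Cd + 2 * n with hCρ
  refine ⟨4 * n * (Cρ + Cd) + (2 * Cρ + 8 * n), ε₀, by positivity, hε₀, ?_⟩
  intro ε hε σ W α A hA hσ hW hα hαA hαn hA2
  have hε0 : 0 ≤ ε := (abs_nonneg σ).trans hσ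
  obtain ⟨t, ht, horth, hr, hAn⟩ := hamp ε hε σ W A hA hσ hW hA2
  have hαt : ‖α‖ ≤ C₁ * |t| := by
    refine (abs_le_of_sq_le_sq' (hαn.trans hAn) (by positivity)).2
  have hd := norm_sq_sub_le ha hp hαA hC₁ hαt hr
  rw [← hg, ← hG] at hd
  set d := mulOp α A - t ^ 2 • G with hddef
  set ρ := -d - t ^ 2 • mulOp W η with hρ
  have ht2 : 0 ≤ t ^ 2 := sq_nonneg t
  have hρn : ‖ρ‖ ≤ Cρ * ε * t ^ 2 := by
    refine (norm_sub_le _ _).trans ?_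
    rw [norm_neg, norm_smul, Real.norm_eq_abs, abs_of_nonneg ht2]
    have h1 := mul_le_mul_of_nonneg_left ((norm_mulOp_le W (η : L2)).trans
      (mul_le_mul_of_nonneg_right hW hn0)) ht2
    rw [hCρ]
    linarith
  -- the second equation for `A` cancels the leading part of the second component, and the
  -- equation for `η` that of the first
  have hTe : hessianL2 k (4 * a ^ 2) (-(p ^ 2 * a ^ 2) + σ) ((12 * a ^ 2) • sechSqB a + W) α
      ((2 * t ^ 2) • η, A, 0) = vec3 ((2 : ℝ) • ρ) (-((4 * t ^ 2) • mulOp α η)) 0 := by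
    rw [hessianL2_apply]
    have c1 : -D2 ((2 * t ^ 2) • η) + (4 * a ^ 2) • (((2 * t ^ 2) • η : H2) : L2)
        - mulOp ((12 * a ^ 2) • sechSqB a + W) (((2 * t ^ 2) • η : H2) : L2)
        - (2 : ℝ) • mulOp α A = (2 : ℝ) • ρ := by
      have h1 : (((2 * t ^ 2) • η : H2) : L2) = (2 * t ^ 2) • (η : L2) := rfl
      rw [h1, map_smul, map_smul, mulOp_add, mulOp_smul, hρ, hddef, ← hη]
      module
    have c2 : -((2 : ℝ) • mulOp α (((2 * t ^ 2) • η : H2) : L2)) + (2 / k) • (-D2 A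
        - (-(p ^ 2 * a ^ 2) + σ) • (A : L2) - k • mulOp ((12 * a ^ 2) • sechSqB a + W) A)
        = -((4 * t ^ 2) • mulOp α η) := by
      have h1 : (((2 * t ^ 2) • η : H2) : L2) = (2 * t ^ 2) • (η : L2) := rfl
      have h2 : -D2 A - (-(p ^ 2 * a ^ 2) + σ) • (A : L2)
          - k • mulOp ((12 * a ^ 2) • sechSqB a + W) A = 0 := by rw [hA2]; abel
      rw [h1, h2, map_smul]
      module
    dsimp only
    rw [c1, c2]
    congr 1
    simp
  refine ⟨t, ht, ((2 * t ^ 2) • η, A, 0), ?_, rfl, ?_, fun v => ?_⟩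
  · dsimp only
    intro h0
    rw [inner_sub_right, h0, inner_smul_right, real_inner_self_eq_norm_sq, zero_sub,
      neg_eq_zero] at horth
    have hg0 : ‖g‖ = 0 := pow_eq_zero_iff two_ne_zero |>.1 ((mul_eq_zero.1 horth).resolve_left ht)
    exact sechLp_ne_zero ha hp (norm_eq_zero.1 hg0)
  · rw [hTe, incl3_apply, inner_vec3]
    have e1 : inner ℝ (mulOp α η) (A : L2) = t ^ 2 * inner ℝ G (η : L2) + inner ℝ d (η : L2) := by
      rw [inner_mulOp_comm, real_inner_comm,
        show mulOp α A = t ^ 2 • G + d by rw [hddef]; abel, inner_add_left, inner_smul_left,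
        RCLike.conj_to_real]
    have e2 : inner ℝ ((2 : ℝ) • ρ) (((2 * t ^ 2) • η : H2) : L2)
        + inner ℝ (-((4 * t ^ 2) • mulOp α η)) (A : L2) + inner ℝ (0 : L2) ((0 : H2) : L2)
        + 4 * t ^ 4 * inner ℝ G (η : L2)
        = 4 * t ^ 2 * (inner ℝ ρ (η : L2) - inner ℝ d (η : L2)) := by
      have h1 : (((2 * t ^ 2) • η : H2) : L2) = (2 * t ^ 2) • (η : L2) := rfl
      rw [h1, inner_smul_left, inner_smul_right, inner_neg_left, inner_smul_left, e1,
        inner_zero_left, RCLike.conj_to_real, RCLike.conj_to_real]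
      ring
    dsimp only
    rw [e2, abs_mul, abs_of_nonneg (by positivity : 0 ≤ 4 * t ^ 2)]
    have b1 : |inner ℝ ρ (η : L2)| ≤ Cρ * ε * t ^ 2 * n :=
      (abs_real_inner_le_norm _ _).trans (mul_le_mul_of_nonneg_right hρn hn0)
    have b2 : |inner ℝ d (η : L2)| ≤ Cd * ε * t ^ 2 * n :=
      (abs_real_inner_le_norm _ _).trans (mul_le_mul_of_nonneg_right hd hn0)
    have b3 := mul_le_mul_of_nonneg_left ((abs_sub _ _).trans (add_le_add b1 b2))
      (by positivity : 0 ≤ 4 * t ^ 2)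
    have b4 : 0 ≤ (2 * Cρ + 8 * n) * ε * t ^ 4 := by positivity
    refine b3.trans ?_
    linarith
  · rw [hTe, incl3_apply, inner_vec3, inner_zero_left, add_zero, inner_neg_left, inner_smul_left,
      inner_smul_left, RCLike.conj_to_real, RCLike.conj_to_real]
    have hv1 : ‖(v.1 : L2)‖ ≤ ‖incl3 v‖ := by
      refine (abs_le_of_sq_le_sq' ?_ (norm_nonneg _)).2
      rw [norm_incl3_sq]
      linarith [sq_nonneg ‖(v.2.1 : L2)‖, sq_nonneg ‖(v.2.2 : L2)‖]
    have hv2 : ‖(v.2.1 : L2)‖ ≤ ‖incl3 v‖ := by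
      refine (abs_le_of_sq_le_sq' ?_ (norm_nonneg _)).2
      rw [norm_incl3_sq]
      linarith [sq_nonneg ‖(v.1 : L2)‖, sq_nonneg ‖(v.2.2 : L2)‖]
    rw [← incl3_apply]
    set m := ‖incl3 v‖ with hm
    have hm0 : 0 ≤ m := norm_nonneg _
    have b1 : |inner ℝ ρ (v.1 : L2)| ≤ Cρ * ε * t ^ 2 * m :=
      (abs_real_inner_le_norm _ _).trans (mul_le_mul hρn hv1 (norm_nonneg _) (by positivity))
    have b2 : |inner ℝ (mulOp α η) (v.2.1 : L2)| ≤ 2 * ε * n * m :=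
      (abs_inner_mulOp_le _ _ _).trans
        (mul_le_mul (mul_le_mul_of_nonneg_right hα hn0) hv2 (norm_nonneg _) (by positivity))
    have b3 := mul_le_mul_of_nonneg_left b2 (by positivity : 0 ≤ 4 * t ^ 2)
    have b4 : 0 ≤ 4 * n * (Cρ + Cd) * ε * t ^ 2 * m := by positivity
    have b5 : |2 * inner ℝ ρ (v.1 : L2) + -(4 * t ^ 2 * inner ℝ (mulOp α η) (v.2.1 : L2))|
        ≤ 2 * |inner ℝ ρ (v.1 : L2)| + 4 * t ^ 2 * |inner ℝ (mulOp α η) (v.2.1 : L2)| := by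
      refine (abs_add_le _ _).trans_eq ?_
      rw [abs_neg, abs_mul, abs_mul, abs_of_pos (two_pos : (0 : ℝ) < 2),
        abs_of_nonneg (by positivity : 0 ≤ 4 * t ^ 2)]
    linarith

/-! ### Counting eigenvalues -/

theorem quadratic_pos {P q r y n : ℝ} (hP : 0 < P) (hr : r ^ 2 < P * q)
    (h : y ≠ 0 ∨ n ≠ 0) : 0 < P * y ^ 2 - 2 * r * y * n + q * n ^ 2 := by
  refine pos_of_mul_pos_right (a := P) ?_ hP.le
  have e : P * (P * y ^ 2 - 2 * r * y * n + q * n ^ 2)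
      = (P * y - r * n) ^ 2 + (P * q - r ^ 2) * n ^ 2 := by ring
  rw [e]
  rcases eq_or_ne n 0 with rfl | hn
  · have hy := h.resolve_right (not_not.2 rfl)
    have : 0 < (P * y) ^ 2 := by positivity
    simpa using this
  · have : 0 < (P * q - r ^ 2) * n ^ 2 := mul_pos (by linarith) (by positivity)
    linarith [sq_nonneg (P * y - r * n)]

/-- The linear functional `⟨f, ·⟩` on `H²(ℝ)`. -/
def innerFun (f : L2) : H2 →ₗ[ℝ] ℝ where
  toFun h := inner ℝ f (h : L2)
  map_add' g h := inner_add_right f (g : L2) h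
  map_smul' r h := inner_smul_right f (h : L2) r

theorem cardinal_eq_of_add_le {x y : Cardinal} {n : ℕ} (h : x + y ≤ ((n + 2 : ℕ) : Cardinal))
    (hx : (n : Cardinal) ≤ x) (hy : 2 ≤ y) : x = n ∧ y = 2 := by
  obtain ⟨i, rfl⟩ := Cardinal.lt_aleph0.1
    (((self_le_add_right x y).trans h).trans_lt Cardinal.natCast_lt_aleph0)
  obtain ⟨j, rfl⟩ := Cardinal.lt_aleph0.1
    (((self_le_add_left y (i : Cardinal)).trans h).trans_lt Cardinal.natCast_lt_aleph0)
  norm_cast at h hx hy ⊢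
  omega

theorem form_smul_add_smul {T : H2x3 →ₗ[ℝ] L2x3}
    (hT : ∀ v w, inner ℝ (T v) (incl3 w) = inner ℝ (incl3 v) (T w)) (x y : ℝ) (v w : H2x3) :
    inner ℝ (T (x • v + y • w)) (incl3 (x • v + y • w)) = x ^ 2 * inner ℝ (T v) (incl3 v)
      + 2 * x * y * inner ℝ (T w) (incl3 v) + y ^ 2 * inner ℝ (T w) (incl3 w) := by
  rw [map_add, map_add, map_smul, map_smul, map_smul, map_smul, inner_add_left, inner_add_right,
    inner_add_right]
  simp only [inner_smul_left, inner_smul_right, RCLike.conj_to_real]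
  rw [hT v w, real_inner_comm (T w)]
  ring

/-- The limiting form is negative at the ground state `sech³` of `-∂² + c - U₀`. -/
theorem exists_negative_direction {a : ℝ} (ha : 0 < a) (p k : ℝ) : ∃ v : H2x3, v ≠ 0 ∧
    limitForm a p k v = -(5 * a ^ 2) * ‖incl3 v‖ ^ 2 := by
  obtain ⟨f, hf, hf1, -⟩ := exists_H2_sechLp ha (three_pos (α := ℝ))
  refine ⟨(f, 0, 0), fun h => ?_, ?_⟩
  · have h1 : f = 0 := congrArg Prod.fst h
    rw [h1] at hf
    exact sechLp_ne_zero ha three_pos hf.symm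
  · have h1 := norm_ladder_sq_eq_wellForm a 3 f
    rw [hf1, hf, neg_add_cancel, norm_zero] at h1
    have h0 : ∀ μ ν : ℝ, wellForm a μ ν 0 = 0 := fun μ ν => by
      simp [wellForm]
    rw [limitForm, norm_incl3_sq]
    dsimp only
    rw [h0]
    simp only [ZeroMemClass.coe_zero, norm_zero]
    unfold wellForm at h1 ⊢
    linarith

/-- The two cases of the eigenvalue count, for a self-adjoint operator `T` whose form differs from
the limiting form by at most the small constant `x`. Here `d` stands for the pairing
`⟨g², L₁⁻¹ g²⟩` and `e` for the critical direction; the smallness of `x` is relative to the gap `δ`,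
to the negative eigenvalue `-5 a²` of the limiting form and to `|d|`. -/
theorem rank_eig_of_critical_direction {a p k : ℝ} (ha : 0 < a) (hp : 0 < p)
    {T : H2x3 →ₗ[ℝ] L2x3} (hT : ∀ v w, inner ℝ (T v) (incl3 w) = inner ℝ (incl3 v) (T w))
    {κ : ℝ} (hκ : 0 < κ) (hlow : ∀ v, ‖incl3 v‖ ^ 2 ≤ inner ℝ (T v + κ • incl3 v) (incl3 v))
    (hsurj : ∀ h, ∃ v, T v + κ • incl3 v = h) {δ : ℝ} (hδ : 0 < δ)
    (hgap : ∀ v : H2x3, inner ℝ (sechLp ha three_pos) (v.1 : L2) = 0 →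
      inner ℝ (mulOp (tanhB a) (sechLp ha two_pos)) (v.1 : L2) = 0 →
      inner ℝ (sechLp ha hp) (v.2.1 : L2) = 0 → inner ℝ (sechLp ha hp) (v.2.2 : L2) = 0 →
      δ * ‖incl3 v‖ ^ 2 ≤ limitForm a p k v)
    {x t d : ℝ} (hx0 : 0 ≤ x) (hxδ : x ≤ δ / 2) (hxa : x ≤ a ^ 2) (hxd : x ≤ |d|) (hd : d ≠ 0)
    (ht : t ≠ 0)
    (hQ : ∀ v, |inner ℝ (T v) (incl3 v) - limitForm a p k v| ≤ x * ‖incl3 v‖ ^ 2) {e : H2x3}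
    (he1 : inner ℝ (sechLp ha hp) (e.2.1 : L2) ≠ 0) (he2 : e.2.2 = 0)
    (heQ : |inner ℝ (T e) (incl3 e) + 4 * t ^ 4 * d| ≤ x * t ^ 4)
    (heT : ∀ v, |inner ℝ (T e) (incl3 v)| ≤ x * t ^ 2 * ‖incl3 v‖)
    (hker : 2 ≤ Module.rank ℝ (eig T incl3 0)) :
    (d < 0 → Module.rank ℝ ↥(⨆ lam : Iio (0 : ℝ), eig T incl3 lam) = 1 ∧
      Module.rank ℝ (eig T incl3 0) = 2) ∧
    (0 < d → Module.rank ℝ ↥(⨆ lam : Iio (0 : ℝ), eig T incl3 lam) = 2 ∧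
      Module.rank ℝ (eig T incl3 0) = 2) := by
  set s := sechLp ha (three_pos (α := ℝ))
  set m := mulOp (tanhB a) (sechLp ha two_pos)
  set g := sechLp ha hp
  have hd0 : 0 < |d| := abs_pos.2 hd
  have ha2 : 0 < a ^ 2 := by positivity
  have ht2 : 0 < t ^ 2 := by positivity
  have ht4 : t ^ 4 = (t ^ 2) ^ 2 := by ring
  have hx2 : x ^ 2 ≤ |d| * (δ / 2) := by
    rw [pow_two]; exact mul_le_mul hxd hxδ hx0 hd0.le
  have hx2' : x ^ 2 ≤ |d| * a ^ 2 := by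
    rw [pow_two]; exact mul_le_mul hxd hxa hx0 hd0.le
  have hpos : ∀ v : H2x3, inner ℝ s (v.1 : L2) = 0 → inner ℝ m (v.1 : L2) = 0 →
      inner ℝ g (v.2.1 : L2) = 0 → inner ℝ g (v.2.2 : L2) = 0 →
      δ / 2 * ‖incl3 v‖ ^ 2 ≤ inner ℝ (T v) (incl3 v) := fun v h1 h2 h3 h4 => by
    have b1 := hgap v h1 h2 h3 h4
    have b2 := (abs_le.1 (hQ v)).1
    have b3 := mul_le_mul_of_nonneg_right hxδ (sq_nonneg ‖incl3 v‖)
    linarith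
  have hne : ∀ v : H2x3, v ≠ 0 → ‖incl3 v‖ ≠ 0 := fun v hv h0 =>
    hv (incl3_injective (by rw [map_zero]; exact norm_eq_zero.1 h0))
  -- lower bounds for the multiplicity of the negative eigenvalues
  have hmany : ∀ {n : ℕ} (ψ : (Fin n → ℝ) →ₗ[ℝ] H2x3),
      (∀ y, y ≠ 0 → inner ℝ (T (ψ y)) (incl3 (ψ y)) < 0) →
      (n : Cardinal) ≤ Module.rank ℝ ↥(⨆ lam : Iio (0 : ℝ), eig T incl3 lam) := by
    intro n ψ hψ
    let S : Set L2x3 := {vec3 s 0 0, vec3 m 0 0, vec3 0 g 0, vec3 0 0 g}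
    have hS : S.Finite := Set.toFinite _
    have : FiniteDimensional ℝ (Submodule.span ℝ S) := FiniteDimensional.span_of_finite ℝ hS
    refine le_rank_iSup_eig incl3_injective hT hκ hlow hsurj (Submodule.span ℝ S)
      (half_pos hδ) (fun v hv => ?_) ψ hψ
    have horth : ∀ w ∈ S, inner ℝ w (incl3 v) = 0 := fun w hw =>
      (Submodule.mem_orthogonal _ _).1 hv w (Submodule.subset_span hw)
    have h1 := horth (vec3 s 0 0) (by simp [S])
    have h2 := horth (vec3 m 0 0) (by simp [S])
    have h3 := horth (vec3 0 g 0) (by simp [S])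
    have h4 := horth (vec3 0 0 g) (by simp [S])
    rw [incl3_apply, inner_vec3, inner_zero_left] at h1 h2 h3 h4
    simp only [inner_zero_left, add_zero, zero_add] at h1 h2 h3 h4
    exact hpos v h1 h2 h3 h4
  obtain ⟨v₀, hv₀, hv₀Q⟩ := exists_negative_direction ha p k
  have hv₀T : inner ℝ (T v₀) (incl3 v₀) ≤ -(4 * a ^ 2) * ‖incl3 v₀‖ ^ 2 := by
    have b2 := (abs_le.1 (hQ v₀)).2
    rw [hv₀Q] at b2
    have b3 := mul_le_mul_of_nonneg_right hxa (sq_nonneg ‖incl3 v₀‖)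
    linarith
  have hn₀ : 0 < ‖incl3 v₀‖ := (norm_nonneg _).lt_of_ne (hne v₀ hv₀).symm
  constructor
  -- positivity in codimension three: `e` is added to the subspace of codimension four
  · intro hdneg
    rw [abs_of_neg hdneg] at hxd hx2
    have heQ' : 3 * -d * (t ^ 2) ^ 2 ≤ inner ℝ (T e) (incl3 e) := by
      have b1 := (abs_le.1 heQ).1
      have b2 := mul_le_mul_of_nonneg_right hxd (sq_nonneg (t ^ 2))
      rw [ht4] at b1
      linarith
    -- the coordinate along `e` in the decomposition `v = τ e + v'` with `v'` orthogonal to `g`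
    let τ : H2x3 →ₗ[ℝ] ℝ := (inner ℝ g (e.2.1 : L2))⁻¹ •
      (innerFun g ∘ₗ LinearMap.fst ℝ H2 H2 ∘ₗ LinearMap.snd ℝ H2 (H2 × H2))
    let π : H2x3 →ₗ[ℝ] H2x3 := LinearMap.id - τ.smulRight e
    let F : H2x3 →ₗ[ℝ] (Fin 3 → ℝ) := LinearMap.pi
      ![innerFun s ∘ₗ LinearMap.fst ℝ H2 (H2 × H2) ∘ₗ π,
        innerFun m ∘ₗ LinearMap.fst ℝ H2 (H2 × H2) ∘ₗ π,
        innerFun g ∘ₗ LinearMap.snd ℝ H2 H2 ∘ₗ LinearMap.snd ℝ H2 (H2 × H2)]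
    have hle := rank_iSup_eig_add_rank_ker_le incl3_injective hT F (fun v hv hFv => by
      set w := π v with hw
      have hvw : v = τ v • e + (1 : ℝ) • w := by
        rw [one_smul, hw]
        change v = τ v • e + (v - τ v • e)
        abel
      have h1 : inner ℝ s (w.1 : L2) = 0 := congrFun hFv 0
      have h2 : inner ℝ m (w.1 : L2) = 0 := congrFun hFv 1
      have h4' : inner ℝ g (v.2.2 : L2) = 0 := congrFun hFv 2
      have h3 : inner ℝ g (w.2.1 : L2) = 0 := by
        change inner ℝ g ((v.2.1 : L2) - ((inner ℝ g (e.2.1 : L2))⁻¹ * inner ℝ g (v.2.1 : L2))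
          • (e.2.1 : L2)) = 0
        rw [inner_sub_right, inner_smul_right, mul_right_comm, inv_mul_cancel₀ he1, one_mul,
          sub_self]
      have h4 : inner ℝ g (w.2.2 : L2) = 0 := by
        change inner ℝ g ((v.2.2 : L2) - τ v • (e.2.2 : L2)) = 0
        rw [he2, ZeroMemClass.coe_zero, smul_zero, sub_zero, h4']
      have hwQ := hpos w h1 h2 h3 h4
      have hex := form_smul_add_smul hT (τ v) 1 e w
      rw [← hvw] at hex
      rw [hex, hT w e, real_inner_comm (T e) (incl3 w)]
      have b2 : -(|τ v| * (x * t ^ 2 * ‖incl3 w‖)) ≤ τ v * inner ℝ (T e) (incl3 w) := by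
        have b0 := neg_abs_le (τ v * inner ℝ (T e) (incl3 w))
        rw [abs_mul] at b0
        linarith [mul_le_mul_of_nonneg_left (heT w) (abs_nonneg (τ v))]
      have key := quadratic_pos (P := 3 * -d) (q := δ / 2) (r := x) (y := |τ v| * t ^ 2)
        (n := ‖incl3 w‖) (by linarith) (by nlinarith) (by
          by_contra hcon
          rw [not_or, not_not, not_not] at hcon
          have hτ : τ v = 0 := abs_eq_zero.1 ((mul_eq_zero.1 hcon.1).resolve_right ht2.ne')
          by_cases hw0 : w = 0
          · exact hv (by rw [hvw, hτ, hw0]; simp)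
          · exact hne w hw0 hcon.2)
      have b3 := mul_le_mul_of_nonneg_left heQ' (sq_nonneg (τ v))
      have b4 : (|τ v| * t ^ 2) ^ 2 = τ v ^ 2 * (t ^ 2) ^ 2 := by rw [mul_pow, sq_abs]
      rw [b4] at key
      linarith)
    let ψ : (Fin 1 → ℝ) →ₗ[ℝ] H2x3 := (LinearMap.proj 0).smulRight v₀
    have hge := hmany ψ (fun y hy => by
      have hy0 : y 0 ≠ 0 := fun h => hy (funext fun i => by rw [Subsingleton.elim i 0, h]; rfl)
      change inner ℝ (T (y 0 • v₀)) (incl3 (y 0 • v₀)) < 0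
      rw [map_smul, map_smul, inner_smul_left, inner_smul_right, RCLike.conj_to_real, ← mul_assoc]
      refine mul_neg_of_pos_of_neg (mul_self_pos.2 hy0) (hv₀T.trans_lt ?_)
      have : 0 < 4 * a ^ 2 * ‖incl3 v₀‖ ^ 2 := by positivity
      linarith)
    have := cardinal_eq_of_add_le hle hge hker
    simpa using this
  -- negativity on the plane spanned by `v₀` and `e`
  · intro hdpos
    rw [abs_of_pos hdpos] at hxd hx2'
    have heQ' : inner ℝ (T e) (incl3 e) ≤ -(3 * d * (t ^ 2) ^ 2) := by
      have b1 := (abs_le.1 heQ).2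
      have b2 := mul_le_mul_of_nonneg_right hxd (sq_nonneg (t ^ 2))
      rw [ht4] at b1
      linarith
    let F : H2x3 →ₗ[ℝ] (Fin 4 → ℝ) := LinearMap.pi
      ![innerFun s ∘ₗ LinearMap.fst ℝ H2 (H2 × H2), innerFun m ∘ₗ LinearMap.fst ℝ H2 (H2 × H2),
        innerFun g ∘ₗ LinearMap.fst ℝ H2 H2 ∘ₗ LinearMap.snd ℝ H2 (H2 × H2),
        innerFun g ∘ₗ LinearMap.snd ℝ H2 H2 ∘ₗ LinearMap.snd ℝ H2 (H2 × H2)]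
    have hle := rank_iSup_eig_add_rank_ker_le incl3_injective hT F (fun v hv hFv => by
      have hwQ := hpos v (congrFun hFv 0) (congrFun hFv 1) (congrFun hFv 2) (congrFun hFv 3)
      have := (norm_nonneg (incl3 v)).lt_of_ne (hne v hv).symm
      exact lt_of_lt_of_le (by positivity) hwQ)
    let ψ : (Fin 2 → ℝ) →ₗ[ℝ] H2x3 :=
      (LinearMap.proj 0).smulRight v₀ + (LinearMap.proj 1).smulRight e
    have hge := hmany ψ (fun y hy => by
      change inner ℝ (T (y 0 • v₀ + y 1 • e)) (incl3 (y 0 • v₀ + y 1 • e)) < 0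
      rw [form_smul_add_smul hT]
      have key := quadratic_pos (P := 3 * d) (q := 4 * a ^ 2) (r := x) (y := |y 1| * t ^ 2)
        (n := |y 0| * ‖incl3 v₀‖) (by linarith) (by nlinarith) (by
          by_contra hcon
          rw [not_or, not_not, not_not] at hcon
          have h1 : y 1 = 0 := abs_eq_zero.1 ((mul_eq_zero.1 hcon.1).resolve_right ht2.ne')
          have h0 : y 0 = 0 := abs_eq_zero.1 ((mul_eq_zero.1 hcon.2).resolve_right hn₀.ne')
          exact hy (funext fun i => by fin_cases i <;> assumption))
      have b1 : y 0 * y 1 * inner ℝ (T e) (incl3 v₀)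
          ≤ |y 0| * |y 1| * (x * t ^ 2 * ‖incl3 v₀‖) := by
        refine (le_abs_self _).trans ?_
        rw [abs_mul, abs_mul]
        exact mul_le_mul_of_nonneg_left (heT v₀) (by positivity)
      have b2 := mul_le_mul_of_nonneg_left heQ' (sq_nonneg (y 1))
      have b3 := mul_le_mul_of_nonneg_left hv₀T (sq_nonneg (y 0))
      have b4 : (|y 1| * t ^ 2) ^ 2 = y 1 ^ 2 * (t ^ 2) ^ 2 := by rw [mul_pow, sq_abs]
      have b5 : (|y 0| * ‖incl3 v₀‖) ^ 2 = y 0 ^ 2 * ‖incl3 v₀‖ ^ 2 := by rw [mul_pow, sq_abs]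
      rw [b4, b5] at key
      linarith)
    have := cardinal_eq_of_add_le hle hge hker
    simpa using this

/-! ### The branch near the bifurcation point -/

theorem gExponent_pos {k : ℝ} (hk : 0 < k) : 0 < gExponent k := by
  have : 1 < √(1 + 48 * k) := by
    rw [Real.lt_sqrt (by norm_num)]; linarith
  unfold gExponent
  linarith

theorem gExponent_mul {k : ℝ} (hk : 0 < k) : gExponent k * (gExponent k + 1) = 12 * k := by
  have := Real.sq_sqrt (by linarith : 0 ≤ 1 + 48 * k)
  unfold gExponent
  linarith

theorem OmegaC_eq {c : ℝ} (hc : 0 < c) (k : ℝ) :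
    OmegaC c k = -(gExponent k ^ 2 * (√c / 2) ^ 2) := by
  have := Real.sq_sqrt hc.le
  unfold OmegaC gExponent
  linear_combination (1 / 16 * (√(1 + 48 * k) - 1) ^ 2) * this

theorem coeFn_U0 {c : ℝ} (hc : 0 < c) :
    ∀ᵐ x, U0 c x = ((12 * (√c / 2) ^ 2) • sechSqB (√c / 2) : ℝ →ᵇ ℝ) x := by
  filter_upwards [AEEqFun.coeFn_mk (soliton c) (continuous_soliton c).aestronglyMeasurable]
    with x hx
  have h : U0 c x = soliton c x := hx
  rw [h]
  change 3 * c / Real.cosh (√c / 2 * x) ^ 2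
    = 12 * (√c / 2) ^ 2 * (1 / Real.cosh (√c / 2 * x)) ^ 2
  rw [div_pow, Real.sq_sqrt hc.le]
  ring

theorem coeFn_gSq {c k : ℝ} (hc : 0 < √c / 2) (hp : 0 < gExponent k) :
    gSq c k = ((mulOp (sechB (√c / 2) hp) (sechLp hc hp) : L2) : L0) := by
  apply AEEqFun.ext
  filter_upwards [AEEqFun.coeFn_mk (fun ξ => gFun c k ξ ^ 2)
    ((continuous_gFun c k).pow 2).aestronglyMeasurable,
    coeFn_mulOp (sechB (√c / 2) hp) (sechLp hc hp), coeFn_sechLp hc hp] with x h1 h2 h3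
  rw [h2, h3]
  refine Eq.trans h1 ?_
  exact pow_two _

theorem pairing_eq {c k : ℝ} (hc : 0 < √c / 2) (hp : 0 < gExponent k) :
    pairing c k = inner ℝ (mulOp (sechB (√c / 2) hp) (sechLp hc hp))
      (L1Inv c (gSq c k) : L2) := by
  rw [inner_L2]
  refine integral_congr_ae ?_
  filter_upwards [coeFn_mulOp (sechB (√c / 2) hp) (sechLp hc hp), coeFn_sechLp hc hp] with x h1 h2
  rw [h1, h2]
  change _ = sechPow (√c / 2) (gExponent k) x * sechPow (√c / 2) (gExponent k) x * _
  rw [← pow_two]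
  rfl

end KdVLS

end

open KdVLS

theorem mainTheorem3 (c k s : ℝ) (hc : 0 < c) (hk : 0 < k) (hs : s = 1) :
    ∃ ε : ℝ, 0 < ε ∧ ∀ (Ω : ℝ) (U A : KdVLS.H2), KdVLS.IsBranchProfile s k c ε Ω U A →
      (KdVLS.pairing c k < 0 →
        KdVLS.morseIndex (KdVLS.hessian s k c Ω U A) = 1 ∧
        KdVLS.nullityIndex (KdVLS.hessian s k c Ω U A) = 2) ∧
      (0 < KdVLS.pairing c k →
        KdVLS.morseIndex (KdVLS.hessian s k c Ω U A) = 2 ∧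
        KdVLS.nullityIndex (KdVLS.hessian s k c Ω U A) = 2) := by
  subst hs
  rcases eq_or_ne (pairing c k) 0 with h0 | hne
  · refine ⟨1, one_pos, fun Ω U A _ => ⟨fun h => ?_, fun h => ?_⟩⟩ <;> rw [h0] at h <;>
      exact absurd h (lt_irrefl 0)
  have ha : 0 < √c / 2 := half_pos (Real.sqrt_pos.2 hc)
  have hp := gExponent_pos hk
  have hpk := gExponent_mul hk
  have hpair := pairing_eq (c := c) ha hp
  -- the pairing being nonzero, `L₁⁻¹ g²` is a genuine solution
  have hη : opL1 c (U0 c) (L1Inv c (gSq c k)) = gSq c k := by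
    by_cases h : ∃ η : H2, IsEven η ∧ opL1 c (U0 c) η = gSq c k
    · rw [L1Inv, dif_pos h]
      exact h.choose_spec.2
    · refine absurd ?_ hne
      rw [hpair, L1Inv, dif_neg h, ZeroMemClass.coe_zero, inner_zero_right]
  set η := L1Inv c (gSq c k) with hηdef
  have h4 : c = 4 * (√c / 2) ^ 2 := by
    rw [div_pow, Real.sq_sqrt hc.le]; ring
  have hη' : -D2 η + (4 * (√c / 2) ^ 2) • (η : L2)
      - (12 * (√c / 2) ^ 2) • mulOp (sechSqB (√c / 2)) η
      = mulOp (sechB (√c / 2) hp) (sechLp ha hp) := by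
    rw [opL1_eq (coeFn_U0 hc), coeFn_gSq ha hp] at hη
    rw [← Subtype.ext hη, mulOp_smul, ← h4]
  obtain ⟨C, ε₁, hC, hε₁, hcrit⟩ := exists_critical_direction ha hp hk hpk η hη'
  obtain ⟨δ, hδ, hgap⟩ := exists_limitForm_gap ha hp hk
  have hd0 : 0 < |pairing c k| := abs_pos.2 hne
  set C' := C + (8 + 2 / k) with hC'
  have hC'0 : 0 < C' := by positivity
  set M := min (δ / 2) (min ((√c / 2) ^ 2) |pairing c k|) with hM
  have hM0 : 0 < M := by positivity
  refine ⟨min ε₁ (M / C'), by positivity, fun Ω U A hb => ?_⟩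
  set ε := min ε₁ (M / C') with hε
  have hε0 : 0 < ε := by positivity
  have hεM : C' * ε ≤ M := by
    have : ε ≤ M / C' := min_le_right _ _
    rw [le_div_iff₀ hC'0] at this
    linarith
  obtain ⟨u, u', du, hu, hu', -⟩ := exists_rep U
  obtain ⟨α, α', dα, hα, hα', hαn⟩ := exists_rep A
  obtain ⟨w, hw, hwε⟩ := hb.near_U
  obtain ⟨W, -, -, hW, -, hWn⟩ := exists_rep w
  have huW : u = (12 * (√c / 2) ^ 2) • sechSqB (√c / 2) + W := by
    have hae : ∀ᵐ x, u x = ((12 * (√c / 2) ^ 2) • sechSqB (√c / 2) + W) x := by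
      filter_upwards [hu, hW, coeFn_U0 hc, AEEqFun.coeFn_sub (incl U) (U0 c)] with x h1 h2 h3 h5
      rw [← hw, Pi.sub_apply, h3] at h5
      have h6 : (incl w : L0) x = W x := h2
      have h7 : (incl U : L0) x = u x := h1
      rw [h6, h7] at h5
      rw [BoundedContinuousFunction.add_apply, h5]
      ring
    exact DFunLike.coe_injective ((u.continuous.ae_eq_iff_eq volume
      (BoundedContinuousFunction.continuous _)).1 hae)
  set σ := Ω - OmegaC c k with hσ
  have hΩ : Ω = -(gExponent k ^ 2 * (√c / 2) ^ 2) + σ := by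
    rw [hσ, OmegaC_eq hc]; ring
  have hσε : |σ| ≤ ε := hb.near_Omega.le
  have hWε : ‖W‖ ≤ 2 * ε := norm_le_two_mul_of_rep hWn hwε
  have hαε : ‖α‖ ≤ 2 * ε := norm_le_two_mul_of_rep hαn hb.near_A
  have hA2 := (hb.profile.eqs hu hα).2
  have hker := two_le_rank_ker hk.ne' hb.profile hb.ne_zero hu hα du dα hu' hα'
  obtain ⟨κ, hκ, hlow, hsurj⟩ := exists_shift_hessianL2 hk c Ω u α
  have hsym := inner_hessianL2_comm k c Ω u α
  have hform := abs_inner_hessianL2_sub_limitForm_le (a := √c / 2) hk hpk hσε hWε hαε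
  obtain ⟨t, ht, e, he1, he2, heQ, heT⟩ := hcrit ε (min_le_left _ _) σ W α A hb.ne_zero hσε hWε
    hαε hα hαn (by rw [← huW, ← hΩ]; exact hA2)
  rw [← huW, ← hΩ, ← h4] at heQ heT hform
  rw [← hpair] at heQ
  have hCε : C * ε ≤ C' * ε := by
    refine mul_le_mul_of_nonneg_right ?_ hε0.le
    have : 0 < 8 + 2 / k := by positivity
    linarith
  have hkε : (8 + 2 / k) * ε ≤ C' * ε := mul_le_mul_of_nonneg_right (by linarith) hε0.le
  have key := rank_eig_of_critical_direction ha hp hsym hκ hlow hsurj hδ hgap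
    (x := C' * ε) (t := t) (d := pairing c k) (by positivity)
    (hεM.trans (min_le_left _ _)) (hεM.trans ((min_le_right _ _).trans (min_le_left _ _)))
    (hεM.trans ((min_le_right _ _).trans (min_le_right _ _))) hne ht
    (fun v => (hform v).trans (mul_le_mul_of_nonneg_right hkε (sq_nonneg _))) he1 he2
    (heQ.trans (mul_le_mul_of_nonneg_right hCε (by positivity)))
    (fun v => (heT v).trans (by gcongr)) hker
  have hE : ∀ lam, eigenspace (hessian 1 k c Ω U A) lam = eig (hessianL2 k c Ω u α) incl3 lam :=
    eigenspace_hessian hu hα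
  have hm : morseIndex (hessian 1 k c Ω U A)
      = Module.rank ℝ ↥(⨆ lam : Set.Iio (0 : ℝ), eig (hessianL2 k c Ω u α) incl3 lam) := by
    unfold morseIndex
    rw [iSup_congr fun lam : Set.Iio (0 : ℝ) => hE lam]
  have hn : nullityIndex (hessian 1 k c Ω U A)
      = Module.rank ℝ (eig (hessianL2 k c Ω u α) incl3 0) := by
    unfold nullityIndex
    rw [hE]
  rw [hm, hn]
  exact key
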